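/- **Non-commutative IPS.** Let $\mathbb F$ be a field and let $F_1,\dots,F_m\in\mathbb F\langle x_1,\dots,x_n\rangle$ be non-commutative polynomials among which are all *Boolean axioms* $x_i(1-x_i)$ ($1\le i\le n$) and all *commutator axioms* $x_ix_j-x_jx_i$ ($1\le i<j\le n$). A *non-commutative IPS refutation* of this system is a non-commutative arithmetic formula (an ordered binary tree with leaves labelled by variables or elements of $\mathbb F$ and inner nodes labelled $+$ or $\times$) that computes a polynomial $C\in\mathbb F\langle x_1,\dots,x_n,y_1,\dots,y_m\rangle$ with $$C(\overline x,\overline 0)=0\quad\text{and}\quad C(\overline x,F_1(\overline x),\dots,F_m(\overline x))=1$$ as identities of non-commutative polynomials. For a propositional formula $\phi$ over $\neg,\vee,\wedge$ and the truth constants, in the variables $x_1,\dots,x_n$, let $\mathrm{tr}(x_i)=x_i$, $\mathrm{tr}(\textsf{false})=1$, $\mathrm{tr}(\textsf{true})=0$, $\mathrm{tr}(\neg T)=1-\mathrm{tr}(T)$, $\mathrm{tr}(T_1\vee T_2)=\mathrm{tr}(T_1)\cdot\mathrm{tr}(T_2)$, $\mathrm{tr}(T_1\wedge T_2)=1-(1-\mathrm{tr}(T_1))\cdot(1-\mathrm{tr}(T_2))$.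 A *non-commutative IPS refutation of $\phi$ over $\mathbb F$* is a refutation of the system consisting of $\mathrm{tr}(\phi)$, the Boolean axioms and the commutator axioms. **Cook–Reckhow systems.** A Cook–Reckhow proof system for a set $L$ of words over a finite alphabet is a relation $V(u,v)$ between words ("$v$ is a proof of $u$") such that $u\in L$ if and only if $V(u,v)$ holds for some word $v$, and such that a deterministic Turing machine decides $V(u,v)$, for arbitrary words $u,v$, in time polynomial in $|u|+|v|$. If $L$ is the set of (words of) unsatisfiable propositional formulas it is called a refutation system. Propositional formulas (together with the number $n$ of variables) and non-commutative formulas are written as words in prefix notation, with numbers and variable indices in binary. **Statement.** Non-commutative IPS is a sound and complete Cook–Reckhow refutation system: 1. For every field $\mathbb F$, a system $F_1,\dots,F_m\in\mathbb F\langle x_1,\dots,x_n\rangle$ that contains the Boolean and the commutator axioms has a non-commutative IPS refutation if and only if the $F_i$ have no common $0$-$1$ solution. 2. For every field $\mathbb F$, a propositional formula has a non-commutative IPS refutation over $\mathbb F$ if and only if it is unsatisfiable. 3. For $\mathbb F=\mathbb Q$ (rationals written as signed binary fractions in lowest terms), and for every finite field $\mathbb F$ (elements written by arbitrary fixed distinct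 binary words), in particular for $\mathbb F=\mathbb Z_q$ with $q$ prime, the relation "$v$ is a non-commutative IPS refutation over $\mathbb F$ of the propositional formula $u$" is a Cook–Reckhow refutation system for unsatisfiable propositional formulas. In particular, refutations can be checked for correctness in deterministic polynomial time. -/

import Mathlib

/-! ### Propositional formulas -/

/-- Propositional formulas over a set `V` of variables (leaves: variables and truth constants). -/
inductive PropFormula (V : Type) : Type
  | var : V → PropFormula V
  | fls : PropFormula V
  | tru : PropFormula V
  | neg : PropFormula V → PropFormula V
  | or : PropFormula V → PropFormula V → PropFormula V
  | and : PropFormula V → PropFormula V → PropFormula V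

namespace PropFormula

/-- Truth value under an assignment. -/
def eval {V : Type} (a : V → Bool) : PropFormula V → Bool
  | var v => a v
  | fls => false
  | tru => true
  | neg f => !(f.eval a)
  | or f g => f.eval a || g.eval a
  | and f g => f.eval a && g.eval a

/-- No assignment satisfies the formula. -/
def Unsat {V : Type} (f : PropFormula V) : Prop :=
  ∀ a : V → Bool, f.eval a = false

end PropFormula

/-! ### Non-commutative arithmetic formulas -/

/-- Non-commutative arithmetic formulas: ordered binary trees whose leaves are labelled by
variables or field elements and whose inner nodes are sum or product gates. -/
inductive NCFormula (K : Type*) (V : Type*)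
  | var : V → NCFormula K V
  | const : K → NCFormula K V
  | add : NCFormula K V → NCFormula K V → NCFormula K V
  | mul : NCFormula K V → NCFormula K V → NCFormula K V

namespace NCFormula

/-- The non-commutative polynomial computed by a formula. -/
noncomputable def toPoly {K V : Type*} [Field K] : NCFormula K V → FreeAlgebra K V
  | var v => FreeAlgebra.ι K v
  | const c => algebraMap K (FreeAlgebra K V) c
  | add f g => f.toPoly + g.toPoly
  | mul f g => f.toPoly * g.toPoly

/-- The formula `1 - f`, with subtraction written through the constant `-1`. -/
def oneSub {K V : Type*} [Field K] (f : NCFormula K V) : NCFormula K V :=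
  add (const 1) (mul (const (-1)) f)

end NCFormula

/-- The translation `tr` of propositional into non-commutative arithmetic formulas. The value `0`
stands for "true" and `1` for "false"; in particular a variable that is true takes the value `0`. -/
def PropFormula.tr (K : Type*) [Field K] {V : Type} : PropFormula V → NCFormula K V
  | .var v => .var v
  | .fls => .const 1
  | .tru => .const 0
  | .neg f => (f.tr K).oneSub
  | .or f g => .mul (f.tr K) (g.tr K)
  | .and f g => (NCFormula.mul (f.tr K).oneSub (g.tr K).oneSub).oneSub

/-! ### Non-commutative IPS -/

section IPS

/-- The Boolean axiom `x_i (1 - x_i)`. -/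
noncomputable def booleanAxiom (K : Type*) [Field K] {n : ℕ} (i : Fin n) :
    FreeAlgebra K (Fin n) :=
  FreeAlgebra.ι K i * (1 - FreeAlgebra.ι K i)

/-- The commutator axiom `x_i x_j - x_j x_i`. -/
noncomputable def commutatorAxiom (K : Type*) [Field K] {n : ℕ} (i j : Fin n) :
    FreeAlgebra K (Fin n) :=
  FreeAlgebra.ι K i * FreeAlgebra.ι K j - FreeAlgebra.ι K j * FreeAlgebra.ι K i

/-- The system contains all Boolean axioms and all commutator axioms. -/
def ContainsAxioms {K : Type*} [Field K] {n : ℕ} {I : Type*}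
    (P : I → FreeAlgebra K (Fin n)) : Prop :=
  (∀ i : Fin n, ∃ k, P k = booleanAxiom K i) ∧
    ∀ i j : Fin n, i < j → ∃ k, P k = commutatorAxiom K i j

/-- `a` is a common `0`-`1` solution of the equations `P k = 0`. -/
def IsZeroOneSolution {K : Type*} [Field K] {n : ℕ} {I : Type*}
    (P : I → FreeAlgebra K (Fin n)) (a : Fin n → K) : Prop :=
  (∀ i, a i = 0 ∨ a i = 1) ∧ ∀ k, FreeAlgebra.lift K a (P k) = 0

/-- A non-commutative polynomial `C(x, y)`, with one variable `y_k` for each polynomial `P k` of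
the system, is a non-commutative IPS certificate for the system if `C(x, 0) = 0` and
`C(x, P) = 1` as non-commutative polynomials in `x`. -/
def IsNCIPSCertificate {K : Type*} [Field K] {n : ℕ} {I : Type*}
    (P : I → FreeAlgebra K (Fin n)) (C : FreeAlgebra K (Fin n ⊕ I)) : Prop :=
  FreeAlgebra.lift K (Sum.elim (FreeAlgebra.ι K) (fun _ : I => (0 : FreeAlgebra K (Fin n)))) C = 0 ∧
    FreeAlgebra.lift K (Sum.elim (FreeAlgebra.ι K) P) C = 1

/-- A refutation is a certificate written as a non-commutative formula. -/
def IsNCIPSRefutation {K : Type*} [Field K] {n : ℕ} {I : Type*}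
    (P : I → FreeAlgebra K (Fin n)) (C : NCFormula K (Fin n ⊕ I)) : Prop :=
  IsNCIPSCertificate P C.toPoly

/-- Names of the equations in the system attached to a propositional formula. -/
inductive AxiomIndex (n : ℕ) : Type
  | formula : AxiomIndex n
  | boolean (i : Fin n) : AxiomIndex n
  | commutator (i j : Fin n) (h : i < j) : AxiomIndex n

/-- The system attached to a propositional formula `f` in the variables `x_1, …, x_n`: the
polynomial computed by `tr f`, the Boolean axioms and the commutator axioms. -/
noncomputable def PropFormula.system (K : Type*) [Field K] {n : ℕ} (f : PropFormula (Fin n)) :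
    AxiomIndex n → FreeAlgebra K (Fin n)
  | .formula => (f.tr K).toPoly
  | .boolean i => booleanAxiom K i
  | .commutator i j _ => commutatorAxiom K i j

end IPS

/-! ### Writing formulas as words

Formulas are written in prefix (Polish) notation, numbers in binary. -/

/-- The alphabet. -/
inductive Letter : Type
  | bit (b : Bool)
  | endMark
  | minus
  | slash
  | xVar
  | tru
  | fls
  | neg
  | or
  | and
  | const
  | add
  | mul
  | yFormula
  | yBoolean
  | yCommutator
  deriving DecidableEq, Fintype

/-- A natural number in binary (least significant bit first), closed by an end mark. -/
def natCode (k : ℕ) : List Letter :=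
  (Nat.bits k).map Letter.bit ++ [Letter.endMark]

/-- A rational number as the signed binary fraction `±num/den` in lowest terms. -/
def ratCode (r : ℚ) : List Letter :=
  (if r.num < 0 then [Letter.minus] else []) ++ (Nat.bits r.num.natAbs).map Letter.bit ++
    Letter.slash :: (Nat.bits r.den).map Letter.bit

/-- Field elements written through given binary words. -/
def bitCode {K : Type*} (c : K → List Bool) (a : K) : List Letter :=
  (c a).map Letter.bit

def PropFormula.code {n : ℕ} : PropFormula (Fin n) → List Letter
  | .var i => Letter.xVar :: natCode i
  | .fls => [Letter.fls]
  | .tru => [Letter.tru]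
  | .neg f => Letter.neg :: f.code
  | .or f g => Letter.or :: (f.code ++ g.code)
  | .and f g => Letter.and :: (f.code ++ g.code)

/-- The word for a propositional formula in `n` variables, with `n` made explicit. -/
def instanceCode (n : ℕ) (f : PropFormula (Fin n)) : List Letter :=
  natCode n ++ f.code

def varCode {n : ℕ} : Fin n ⊕ AxiomIndex n → List Letter
  | .inl i => Letter.xVar :: natCode i
  | .inr .formula => [Letter.yFormula]
  | .inr (.boolean i) => Letter.yBoolean :: natCode i
  | .inr (.commutator i j _) => Letter.yCommutator :: (natCode i ++ natCode j)

/-- The word for a non-commutative formula, when `code` writes the field elements. -/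
def NCFormula.code {K : Type*} (code : K → List Letter) {n : ℕ} :
    NCFormula K (Fin n ⊕ AxiomIndex n) → List Letter
  | .var v => varCode v
  | .const a => Letter.const :: (code a ++ [Letter.endMark])
  | .add f g => Letter.add :: (f.code code ++ g.code code)
  | .mul f g => Letter.mul :: (f.code code ++ g.code code)

/-! ### Cook–Reckhow systems -/

/-- A predicate on pairs of words is decidable in deterministic polynomial time: a (multi-stack)
Turing machine, given any two words, outputs the truth value of the predicate within a number of
steps polynomial in the total length of the two words. -/
def PolyTimeDecidable {A B : Type} (V : List A → List B → Prop) : Prop :=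
  open Classical in
  Nonempty (Turing.TM2ComputableInPolyTime
    (Computability.encodingProd (Computability.encodingList A)
      (Computability.encodingList B)).encode
    Computability.encodeBool (fun p : List A × List B => decide (V p.1 p.2)))

/-- `V` (where `V u v` reads "`v` is a proof of `u`") is a Cook–Reckhow proof system for the set
`L` of words. For `L` the set of unsatisfiable formulas one speaks of a refutation system. -/
structure IsCookReckhowSystem {A B : Type} [Fintype A] [Fintype B]
    (L : Set (List A)) (V : List A → List B → Prop) : Prop where
  sound : ∀ u v, V u v → u ∈ L
  complete : ∀ u, u ∈ L → ∃ v, V u v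
  checkable : PolyTimeDecidable V

/-- The (words of) unsatisfiable propositional formulas. -/
def UnsatWords : Set (List Letter) :=
  {u | ∃ (n : ℕ) (f : PropFormula (Fin n)), u = instanceCode n f ∧ f.Unsat}

/-- The word `v` is (the word of) a non-commutative IPS refutation over `K` of the propositional
formula written as `u`. -/
def NCIPSRefutes {K : Type*} [Field K] (code : K → List Letter) (u v : List Letter) : Prop :=
  ∃ (n : ℕ) (f : PropFormula (Fin n)) (C : NCFormula K (Fin n ⊕ AxiomIndex n)),
    u = instanceCode n f ∧ v = C.code code ∧ IsNCIPSRefutation (f.system K) C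

/-! Soundness: substituting a common 0-1 solution `a` for the variables turns `C(x, F) = 1` and
`C(x, 0) = 0` into `1 = C(a, 0) = 0`.

Completeness: the polynomials `f` for which some `C` satisfies `C(x, 0) = 0` and `C(x, F) = f`
contain the two-sided ideal generated by the `F_i` (`exists_certificate_of_mem_span`). If `1` is
outside this ideal, the quotient is a nonzero ring, commutative because of the commutator axioms. In
a residue field of it every `x_i` becomes `0` or `1` by the Boolean axioms, so the residues form a
solution over the ground field itself (`exists_zeroOneSolution`). For the system of a propositional
formula, the 0-1 solutions are the satisfying assignments, with `0` for "true"
(`PropFormula.unsat_iff`).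

Checking a refutation means testing two non-commutative polynomials given by formulas for zero.
Formulas are compiled to straight-line programs whose only products are by a variable on the right
(`Item.Computes`). Let `f_1, ..., f_r` be the values of such a program. If a functional `ψ` is known
at all `f_i`, so is its composition with right division by a variable `x` (`map_nextVec`), and all
coefficient functionals arise from the constant coefficient by such compositions. Over a finite
field, an echelon basis of the span of the vectors `(ψ(f_1), ..., ψ(f_r))` is extended letter by
letter; the dimension stays below a linear bound, and the output is zero if and only if the span
vanishes at it (`levelTest_iff`). Over the rationals, the bilinear form with orthonormal monomials
is used instead: right division is adjoint to right multiplication, so the Gram matrix of the `f_i`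
is computed row by row in integers of polynomial length, and the output is zero if and only if the
sum of the squares of its coefficients is (`gramTest_iff`).

Polynomial time is established by a calculus: `PolyTime` functions on data coded as binary trees are
closed under composition, pairing, case analysis, and loops whose intermediate results stay
polynomially small. Their programs become Turing machines by `Exec.reaches` and
`PolyTime.tm2ComputableInPolyTime`. The checker is one such function; `ArithCode.check_iff` and
`ArithCode.check_polyTime` state its correctness and its running time. -/

set_option linter.unusedSectionVars false

/-! ### Structured programs for multi-stack machines -/

/-- Structured programs over stacks indexed by `κ`, with stack alphabets `Γ`. -/
inductive StackProg {κ : Type} (Γ : κ → Type) : Type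
  | skip : StackProg Γ
  | push (k : κ) (a : Γ k) : StackProg Γ
  | seq (p q : StackProg Γ) : StackProg Γ
  | pop (k : κ) (f : Option (Γ k) → StackProg Γ) : StackProg Γ
  | loop (k : κ) (f : Γ k → StackProg Γ) : StackProg Γ

namespace StackProg

open Turing Function

variable {κ : Type} {Γ : κ → Type}

/-- The control points of a program. -/
def Pos : StackProg Γ → Type
  | skip => Unit
  | push _ _ => Unit
  | seq p q => Pos p ⊕ Pos q
  | pop _ f => Option (Σ o, Pos (f o))
  | loop _ f => Option (Σ a, Pos (f a))

/-- The control point at which a program starts. -/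
def entry : (p : StackProg Γ) → Pos p
  | skip => ()
  | push _ _ => ()
  | seq p _ => Sum.inl (entry p)
  | pop _ _ => none
  | loop _ _ => none

/-- Branching is over letters of a finite alphabet, so the dependent sums of control points are
finite; the machine therefore has finitely many labels. -/
theorem finite_pos [∀ k, Finite (Γ k)] : (p : StackProg Γ) → Finite (Pos p)
  | skip => inferInstanceAs (Finite Unit)
  | push _ _ => inferInstanceAs (Finite Unit)
  | seq p q =>
    have := finite_pos p
    have := finite_pos q
    inferInstanceAs (Finite (Pos p ⊕ Pos q))
  | pop _ f =>
    have := fun o => finite_pos (f o)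
    inferInstanceAs (Finite (Option (Σ o, Pos (f o))))
  | loop _ f =>
    have := fun a => finite_pos (f a)
    inferInstanceAs (Finite (Option (Σ a, Pos (f a))))

variable [DecidableEq κ]

/-- The machine statement at a control point, where `emb` embeds the control points into the labels
of the machine and `exit` is the label at which the execution continues. -/
def stmt {L : Type} : (p : StackProg Γ) → (Pos p → L) → L → Pos p →
    TM2.Stmt Γ L (Σ k, Option (Γ k))
  | skip, _, exit, _ => .goto fun _ => exit
  | push k a, _, exit, _ => .push k (fun _ => a) (.goto fun _ => exit)
  | seq p q, emb, exit, i =>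
    match i with
    | Sum.inl i => stmt p (fun j => emb (Sum.inl j)) (emb (Sum.inr (entry q))) i
    | Sum.inr i => stmt q (fun j => emb (Sum.inr j)) exit i
  | pop k f, emb, exit, i =>
    match i with
    -- The register holds the symbol just popped, tagged with its stack. The tag is always `k` at
    -- the jump; the alternative only makes the function total.
    | none => .pop k (fun _ o => ⟨k, o⟩) (.goto fun v =>
        if h : v.1 = k then emb (some ⟨h ▸ v.2, entry _⟩) else exit)
    | some ⟨o, i⟩ => stmt (f o) (fun j => emb (some ⟨o, j⟩)) exit i
  | loop k f, emb, exit, i =>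
    match i with
    | none => .pop k (fun _ o => ⟨k, o⟩) (.goto fun v =>
        if h : v.1 = k then
          (match (h ▸ v.2 : Option (Γ k)) with
          | none => exit
          | some a => emb (some ⟨a, entry _⟩)) else exit)
    | some ⟨a, i⟩ => stmt (f a) (fun j => emb (some ⟨a, j⟩)) (emb none) i

/-- `Exec p S S' t`: started on the stacks `S`, the program `p` stops after `t` steps with the
stacks `S'`. -/
inductive Exec : StackProg Γ → (∀ k, List (Γ k)) → (∀ k, List (Γ k)) → ℕ → Prop
  | skip (S) : Exec skip S S 1
  | push (k a S) : Exec (push k a) S (update S k (a :: S k)) 1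
  | seq {p q S S₁ S₂ t₁ t₂} : Exec p S S₁ t₁ → Exec q S₁ S₂ t₂ → Exec (seq p q) S S₂ (t₁ + t₂)
  | pop {k f S S' t} : Exec (f (S k).head?) (update S k (S k).tail) S' t →
      Exec (pop k f) S S' (1 + t)
  | loop_nil {k f S} : S k = [] → Exec (loop k f) S S 1
  | loop_cons {k f S S₁ S₂ t₁ t₂} (a l) : S k = a :: l → Exec (f a) (update S k l) S₁ t₁ →
      Exec (loop k f) S₁ S₂ t₂ → Exec (loop k f) S S₂ (1 + t₁ + t₂)

/-- Every control point costs exactly one machine step, so the step counts agree. The surrounding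
machine, the embedding of labels and the exit are arbitrary, which lets the induction treat a
subprogram in place; the register at the exit is irrelevant. -/
theorem Exec.reaches {p : StackProg Γ} {S S' : ∀ k, List (Γ k)} {t : ℕ} (h : Exec p S S' t) :
    ∀ {L : Type} (m : L → TM2.Stmt Γ L (Σ k, Option (Γ k))) (emb : Pos p → L) (exit : L),
      (∀ i, m (emb i) = stmt p emb exit i) → ∀ v, ∃ v',
        (flip bind (TM2.step m))^[t] (some ⟨some (emb (entry p)), v, S⟩) =
          some (⟨some exit, v', S'⟩ : TM2.Cfg Γ L (Σ k, Option (Γ k))) := by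
  induction h with
  | skip S =>
    intro L m emb exit hm v
    refine ⟨v, ?_⟩
    simp [flip, hm, stmt]
  | push k a S =>
    intro L m emb exit hm v
    refine ⟨v, ?_⟩
    simp [flip, hm, stmt]
  | @seq p q S S₁ S₂ t₁ t₂ _ _ ih₁ ih₂ =>
    intro L m emb exit hm v
    obtain ⟨v₁, h₁⟩ := ih₁ m (fun j => emb (Sum.inl j)) (emb (Sum.inr (entry q)))
      (fun i => hm (Sum.inl i)) v
    obtain ⟨v₂, h₂⟩ := ih₂ m (fun j => emb (Sum.inr j)) exit (fun i => hm (Sum.inr i)) v₁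
    refine ⟨v₂, ?_⟩
    rw [add_comm, iterate_add_apply]
    simp only [entry]
    rw [h₁, h₂]
  | @pop k f S S' t _ ih =>
    intro L m emb exit hm v
    obtain ⟨v₁, h₁⟩ := ih m (fun j => emb (some ⟨_, j⟩)) exit
      (fun i => hm (some ⟨_, i⟩)) ⟨k, (S k).head?⟩
    have h0 := hm (entry (.pop k f))
    refine ⟨v₁, ?_⟩
    rw [add_comm, iterate_add_apply, ← h₁]
    simp only [entry, stmt] at h0
    simp [flip, entry, h0]
  | @loop_nil k f S hS =>
    intro L m emb exit hm v
    refine ⟨⟨k, none⟩, ?_⟩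
    have hu : update S k [] = S := by rw [← hS, update_eq_self]
    have h0 := hm (entry (.loop k f))
    simp only [entry, stmt] at h0
    simp [flip, entry, h0, hS, hu]
  | @loop_cons k f S S₁ S₂ t₁ t₂ a l hS _ _ ih₁ ih₂ =>
    intro L m emb exit hm v
    obtain ⟨v₁, h₁⟩ := ih₁ m (fun j => emb (some ⟨a, j⟩)) (emb none)
      (fun i => hm (some ⟨_, i⟩)) ⟨k, some a⟩
    have h0 := hm (entry (.loop k f))
    obtain ⟨v₂, h₂⟩ := ih₂ m emb exit hm v₁
    refine ⟨v₂, ?_⟩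
    rw [add_comm, iterate_add_apply, add_comm 1, iterate_add_apply, ← h₂]
    refine congrArg _ ?_
    simp only [entry, stmt] at h₁ h0 ⊢
    rw [← h₁]
    simp [flip, h0, hS]

end StackProg

/-! ### Binary trees on stacks -/

/-- Binary trees, the universal data type of the programs below. -/
inductive BTree : Type
  | nil : BTree
  | cons (a b : BTree) : BTree
  deriving DecidableEq

namespace BTree

/-- Trees are written on a stack in prefix notation. -/
def code : BTree → List Bool
  | nil => [false]
  | cons a b => true :: (code a ++ code b)

end BTree

/-- The stacks of the machines: the input, the main stack holding a sequence of trees, an auxiliary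
stack of trees, and two stacks for temporary storage and counting. -/
inductive Stk : Type
  | inp | main | aux | tmp | cnt
  deriving DecidableEq

instance : Fintype Stk :=
  ⟨{.inp, .main, .aux, .tmp, .cnt}, fun x => by cases x <;> decide⟩

/-- The stack alphabets: `A` for the input, bits otherwise. -/
abbrev StkAlphabet (A : Type) : Stk → Type
  | .inp => A
  | .main => Bool
  | .aux => Bool
  | .tmp => Bool
  | .cnt => Bool

/-- The stack contents with the given components. -/
def mkStk {A : Type} (i : List A) (m a t c : List Bool) : ∀ k, List (StkAlphabet A k)
  | .inp => i
  | .main => m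
  | .aux => a
  | .tmp => t
  | .cnt => c

section Stacks

open Function

variable {A : Type} (i : List A) (m a t c : List Bool)

@[simp] theorem mkStk_inp : mkStk i m a t c .inp = i := rfl
@[simp] theorem mkStk_main : mkStk i m a t c .main = m := rfl
@[simp] theorem mkStk_aux : mkStk i m a t c .aux = a := rfl
@[simp] theorem mkStk_tmp : mkStk i m a t c .tmp = t := rfl
@[simp] theorem mkStk_cnt : mkStk i m a t c .cnt = c := rfl

@[simp] theorem update_mkStk_inp (x : List A) :
    update (mkStk i m a t c) .inp x = mkStk x m a t c := by
  funext k; cases k <;> rfl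
@[simp] theorem update_mkStk_main (x : List Bool) :
    update (mkStk i m a t c) .main x = mkStk i x a t c := by
  funext k; cases k <;> rfl
@[simp] theorem update_mkStk_aux (x : List Bool) :
    update (mkStk i m a t c) .aux x = mkStk i m x t c := by
  funext k; cases k <;> rfl
@[simp] theorem update_mkStk_tmp (x : List Bool) :
    update (mkStk i m a t c) .tmp x = mkStk i m a x c := by
  funext k; cases k <;> rfl
@[simp] theorem update_mkStk_cnt (x : List Bool) :
    update (mkStk i m a t c) .cnt x = mkStk i m a t x := by
  funext k; cases k <;> rfl

end Stacks

namespace StackProg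

variable {A : Type} {i : List A} {m a t c : List Bool}

/-- A push followed by a change of the description of the stacks. -/
theorem Exec.push_main (b : Bool) : Exec (Γ := StkAlphabet A) (.push .main b)
    (mkStk i m a t c) (mkStk i (b :: m) a t c) 1 := by
  simpa using Exec.push (Γ := StkAlphabet A) .main b (mkStk i m a t c)
theorem Exec.push_aux (b : Bool) : Exec (Γ := StkAlphabet A) (.push .aux b)
    (mkStk i m a t c) (mkStk i m (b :: a) t c) 1 := by
  simpa using Exec.push (Γ := StkAlphabet A) .aux b (mkStk i m a t c)
theorem Exec.push_tmp (b : Bool) : Exec (Γ := StkAlphabet A) (.push .tmp b)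
    (mkStk i m a t c) (mkStk i m a (b :: t) c) 1 := by
  simpa using Exec.push (Γ := StkAlphabet A) .tmp b (mkStk i m a t c)
theorem Exec.push_cnt (b : Bool) : Exec (Γ := StkAlphabet A) (.push .cnt b)
    (mkStk i m a t c) (mkStk i m a t (b :: c)) 1 := by
  simpa using Exec.push (Γ := StkAlphabet A) .cnt b (mkStk i m a t c)

theorem Exec.pop_main {f : Option Bool → StackProg (StkAlphabet A)} {b : Bool} {S' n}
    (h : Exec (f (some b)) (mkStk i m a t c) S' n) :
    Exec (.pop .main f) (mkStk i (b :: m) a t c) S' (1 + n) :=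
  .pop (by simpa using h)

theorem Exec.loop_step {k : Stk} {f : StkAlphabet A k → StackProg (StkAlphabet A)}
    {S S₁ S₂ : ∀ k, List (StkAlphabet A k)} {t₁ t₂ : ℕ} (b l) (hS : S k = b :: l)
    {S₀} (h₀ : Function.update S k l = S₀)
    (h₁ : Exec (f b) S₀ S₁ t₁) (h₂ : Exec (loop k f) S₁ S₂ t₂) :
    Exec (loop k f) S S₂ (1 + t₁ + t₂) :=
  .loop_cons b l hS (h₀ ▸ h₁) h₂

/-- Repeat `f` as long as `f` leaves a mark on the counter stack. -/
def whileCnt (f : StackProg (StkAlphabet A)) : StackProg (StkAlphabet A) :=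
  seq (push .cnt true) (loop .cnt fun _ => f)

/-- Read one bit of a tree; the counter stack counts the subtrees that remain to be read. -/
def dropStep : Option Bool → StackProg (StkAlphabet A)
  | none => skip
  | some false => skip
  | some true => seq (push .cnt true) (push .cnt true)

/-- Move one bit of a tree to the temporary stack. -/
def moveStep : Option Bool → StackProg (StkAlphabet A)
  | none => skip
  | some false => push .tmp false
  | some true => seq (push .tmp true) (seq (push .cnt true) (push .cnt true))

/-- Discard the topmost tree of the main stack. -/
def drop : StackProg (StkAlphabet A) := whileCnt (pop .main dropStep)

/-- Move the topmost tree of the main stack to the temporary stack, reversing its code. -/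
def mainToTmp : StackProg (StkAlphabet A) := whileCnt (pop .main moveStep)

/-- Move the topmost tree of the auxiliary stack to the temporary stack, reversing its code. -/
def auxToTmp : StackProg (StkAlphabet A) := whileCnt (pop .aux moveStep)

/-- Prefix codes delimit themselves if one counts the subtrees still to be read: a leaf uses up one
mark, an inner node replaces one mark by two. The continuation of the run is a hypothesis, so that
the runs for the two subtrees can be chained; a bit costs fewer than six steps. -/
theorem exec_drop_loop (x : BTree) : ∀ (m c : List Bool) {S' n},
    Exec (Γ := StkAlphabet A) (loop .cnt fun _ => pop .main dropStep)
      (mkStk i m a t c) S' n →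
    ∃ n', n' ≤ n + 6 * x.code.length ∧
    Exec (Γ := StkAlphabet A) (loop .cnt fun _ => pop .main dropStep)
      (mkStk i (x.code ++ m) a t (true :: c)) S' n' := by
  induction x with
  | nil =>
    intro m c S' n h
    refine ⟨_, ?_, .loop_step true c rfl (update_mkStk_cnt ..) (.pop_main (.skip _)) h⟩
    simp [BTree.code]; omega
  | cons x y ihx ihy =>
    intro m c S' n h
    obtain ⟨n₁, hn₁, h₁⟩ := ihy m c h
    obtain ⟨n₂, hn₂, h₂⟩ := ihx (y.code ++ m) (true :: c) h₁
    refine ⟨_, ?_, .loop_step true c rfl (update_mkStk_cnt ..)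
      (.pop_main (.seq (.push_cnt _) (.push_cnt _))) (by simpa using h₂)⟩
    simp [BTree.code]; omega

theorem exec_drop (x : BTree) : ∃ n ≤ 6 * x.code.length + 2,
    Exec (Γ := StkAlphabet A) drop (mkStk i (x.code ++ m) a t []) (mkStk i m a t []) n := by
  obtain ⟨n, hn, h⟩ := exec_drop_loop (A := A) (i := i) (a := a) (t := t) x m []
    (Exec.loop_nil rfl)
  exact ⟨_, by omega, .seq (.push_cnt true) h⟩

theorem exec_mainToTmp_loop (x : BTree) : ∀ (m t c : List Bool) {S' n},
    Exec (Γ := StkAlphabet A) (loop .cnt fun _ => pop .main moveStep)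
      (mkStk i m a (x.code.reverse ++ t) c) S' n →
    ∃ n', n' ≤ n + 6 * x.code.length ∧
    Exec (Γ := StkAlphabet A) (loop .cnt fun _ => pop .main moveStep)
      (mkStk i (x.code ++ m) a t (true :: c)) S' n' := by
  induction x with
  | nil =>
    intro m t c S' n h
    refine ⟨_, ?_, .loop_step true c rfl (update_mkStk_cnt ..) (.pop_main (.push_tmp _)) h⟩
    simp [BTree.code]; omega
  | cons x y ihx ihy =>
    intro m t c S' n h
    obtain ⟨n₁, hn₁, h₁⟩ := ihy m (x.code.reverse ++ true :: t) c (by simpa [BTree.code] using h)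
    obtain ⟨n₂, hn₂, h₂⟩ := ihx (y.code ++ m) (true :: t) (true :: c) h₁
    refine ⟨_, ?_, .loop_step true c rfl (update_mkStk_cnt ..)
      (.pop_main (.seq (.push_tmp _) (.seq (.push_cnt _) (.push_cnt _)))) (by simpa using h₂)⟩
    simp [BTree.code]; omega

theorem exec_mainToTmp (x : BTree) : ∃ n ≤ 6 * x.code.length + 2,
    Exec (Γ := StkAlphabet A) mainToTmp (mkStk i (x.code ++ m) a t [])
      (mkStk i m a (x.code.reverse ++ t) []) n := by
  obtain ⟨n, hn, h⟩ := exec_mainToTmp_loop (A := A) (i := i) (a := a) x m t []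
    (Exec.loop_nil rfl)
  exact ⟨_, by omega, .seq (.push_cnt true) h⟩

theorem Exec.pop_aux {f : Option Bool → StackProg (StkAlphabet A)} {b : Bool} {S' n}
    (h : Exec (f (some b)) (mkStk i m a t c) S' n) :
    Exec (.pop .aux f) (mkStk i m (b :: a) t c) S' (1 + n) :=
  .pop (by simpa using h)

theorem exec_auxToTmp_loop (x : BTree) : ∀ (a t c : List Bool) {S' n},
    Exec (Γ := StkAlphabet A) (loop .cnt fun _ => pop .aux moveStep)
      (mkStk i m a (x.code.reverse ++ t) c) S' n →
    ∃ n', n' ≤ n + 6 * x.code.length ∧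
    Exec (Γ := StkAlphabet A) (loop .cnt fun _ => pop .aux moveStep)
      (mkStk i m (x.code ++ a) t (true :: c)) S' n' := by
  induction x with
  | nil =>
    intro a t c S' n h
    refine ⟨_, ?_, .loop_step true c rfl (update_mkStk_cnt ..) (.pop_aux (.push_tmp _)) h⟩
    simp [BTree.code]; omega
  | cons x y ihx ihy =>
    intro a t c S' n h
    obtain ⟨n₁, hn₁, h₁⟩ := ihy a (x.code.reverse ++ true :: t) c (by simpa [BTree.code] using h)
    obtain ⟨n₂, hn₂, h₂⟩ := ihx (y.code ++ a) (true :: t) (true :: c) h₁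
    refine ⟨_, ?_, .loop_step true c rfl (update_mkStk_cnt ..)
      (.pop_aux (.seq (.push_tmp _) (.seq (.push_cnt _) (.push_cnt _)))) (by simpa using h₂)⟩
    simp [BTree.code]; omega

theorem exec_auxToTmp (x : BTree) : ∃ n ≤ 6 * x.code.length + 2,
    Exec (Γ := StkAlphabet A) auxToTmp (mkStk i m (x.code ++ a) t [])
      (mkStk i m a (x.code.reverse ++ t) []) n := by
  obtain ⟨n, hn, h⟩ := exec_auxToTmp_loop (A := A) (i := i) (m := m) x a t []
    (Exec.loop_nil rfl)
  exact ⟨_, by omega, .seq (.push_cnt true) h⟩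

/-- Empty the temporary stack onto the main stack. -/
def tmpToMain : StackProg (StkAlphabet A) := loop .tmp fun b => push .main b
/-- Empty the temporary stack onto the auxiliary stack. -/
def tmpToAux : StackProg (StkAlphabet A) := loop .tmp fun b => push .aux b
/-- Empty the temporary stack onto both the main and the auxiliary stack. -/
def tmpToBoth : StackProg (StkAlphabet A) :=
  loop .tmp fun b => seq (push .main b) (push .aux b)

theorem exec_tmpToMain (t : List Bool) : ∀ m, Exec (Γ := StkAlphabet A) tmpToMain
    (mkStk i m a t c) (mkStk i (t.reverse ++ m) a [] c) (2 * t.length + 1) := by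
  induction t with
  | nil => intro m; exact .loop_nil rfl
  | cons b t ih =>
    intro m
    have := Exec.loop_step (A := A) (k := .tmp) (f := fun b => push .main b) b t (S := mkStk i m a (b :: t) c) rfl
      (update_mkStk_tmp ..) (.push_main b) (ih (b :: m))
    rw [show 2 * (b :: t).length + 1 = 1 + 1 + (2 * t.length + 1) by simp; omega]
    simpa [tmpToMain] using this

theorem exec_tmpToAux (t : List Bool) : ∀ a, Exec (Γ := StkAlphabet A) tmpToAux
    (mkStk i m a t c) (mkStk i m (t.reverse ++ a) [] c) (2 * t.length + 1) := by
  induction t with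
  | nil => intro a; exact .loop_nil rfl
  | cons b t ih =>
    intro a
    have := Exec.loop_step (A := A) (k := .tmp) (f := fun b => push .aux b) b t (S := mkStk i m a (b :: t) c) rfl
      (update_mkStk_tmp ..) (.push_aux b) (ih (b :: a))
    rw [show 2 * (b :: t).length + 1 = 1 + 1 + (2 * t.length + 1) by simp; omega]
    simpa [tmpToAux] using this

theorem exec_tmpToBoth (t : List Bool) : ∀ m a, Exec (Γ := StkAlphabet A) tmpToBoth
    (mkStk i m a t c) (mkStk i (t.reverse ++ m) (t.reverse ++ a) [] c) (3 * t.length + 1) := by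
  induction t with
  | nil => intro m a; exact .loop_nil rfl
  | cons b t ih =>
    intro m a
    have := Exec.loop_step (A := A) (k := .tmp) (f := fun b => seq (push .main b) (push .aux b)) b t
      (S := mkStk i m a (b :: t) c) rfl
      (update_mkStk_tmp ..) (.seq (.push_main b) (.push_aux b)) (ih (b :: m) (b :: a))
    rw [show 3 * (b :: t).length + 1 = 1 + (1 + 1) + (3 * t.length + 1) by simp; omega]
    simpa [tmpToBoth] using this

/-- Move the topmost tree of the main stack to the auxiliary stack. -/
def stash : StackProg (StkAlphabet A) := seq mainToTmp tmpToAux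
/-- Copy the topmost tree of the main stack to the auxiliary stack. -/
def stashCopy : StackProg (StkAlphabet A) := seq mainToTmp tmpToBoth
/-- Move the topmost tree of the auxiliary stack to the main stack. -/
def unstash : StackProg (StkAlphabet A) := seq auxToTmp tmpToMain

/-- The detour over the temporary stack reverses the code twice. -/
theorem exec_stash (x : BTree) : ∃ n ≤ 8 * x.code.length + 3, Exec (Γ := StkAlphabet A) stash
    (mkStk i (x.code ++ m) a [] []) (mkStk i m (x.code ++ a) [] []) n := by
  obtain ⟨n, hn, h⟩ := exec_mainToTmp (A := A) (i := i) (m := m) (a := a) (t := []) x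
  rw [List.append_nil] at h
  have h' := exec_tmpToAux (A := A) (i := i) (m := m) (c := []) x.code.reverse a
  rw [List.reverse_reverse, List.length_reverse] at h'
  exact ⟨_, by omega, .seq h h'⟩

theorem exec_stashCopy (x : BTree) : ∃ n ≤ 9 * x.code.length + 3,
    Exec (Γ := StkAlphabet A) stashCopy
    (mkStk i (x.code ++ m) a [] []) (mkStk i (x.code ++ m) (x.code ++ a) [] []) n := by
  obtain ⟨n, hn, h⟩ := exec_mainToTmp (A := A) (i := i) (m := m) (a := a) (t := []) x
  rw [List.append_nil] at h
  have h' := exec_tmpToBoth (A := A) (i := i) (c := []) x.code.reverse m a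
  rw [List.reverse_reverse, List.length_reverse] at h'
  exact ⟨_, by omega, .seq h h'⟩

theorem exec_unstash (x : BTree) : ∃ n ≤ 8 * x.code.length + 3,
    Exec (Γ := StkAlphabet A) unstash
    (mkStk i m (x.code ++ a) [] []) (mkStk i (x.code ++ m) a [] []) n := by
  obtain ⟨n, hn, h⟩ := exec_auxToTmp (A := A) (i := i) (m := m) (a := a) (t := []) x
  rw [List.append_nil] at h
  have h' := exec_tmpToMain (A := A) (i := i) (a := a) (c := []) x.code.reverse m
  rw [List.reverse_reverse, List.length_reverse] at h'
  exact ⟨_, by omega, .seq h h'⟩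

end StackProg

/-! ### Polynomial-time functions on encoded data -/

/-- Types whose elements are written as binary trees. -/
class TreeEnc (α : Type*) where
  enc : α → BTree

open TreeEnc

/-- The word of the tree of an element. -/
def tcode {α : Type*} [TreeEnc α] (x : α) : List Bool := (enc x).code

/-- The length of the word of the tree of an element. -/
def tsize {α : Type*} [TreeEnc α] (x : α) : ℕ := (tcode x).length

/-- The tree of a list. -/
def encList {α : Type*} [TreeEnc α] : List α → BTree
  | [] => .nil
  | x :: l => .cons (enc x) (encList l)

instance : TreeEnc Unit := ⟨fun _ => .nil⟩
instance : TreeEnc Bool := ⟨fun b => bif b then .cons .nil .nil else .nil⟩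
instance {α β : Type*} [TreeEnc α] [TreeEnc β] : TreeEnc (α × β) :=
  ⟨fun p => .cons (enc p.1) (enc p.2)⟩
instance {α : Type*} [TreeEnc α] : TreeEnc (List α) := ⟨encList⟩
instance {α : Type*} [TreeEnc α] : TreeEnc (Option α) := ⟨fun o => enc o.toList⟩

section Code

variable {α β : Type*} [TreeEnc α] [TreeEnc β]

theorem tcode_pair (p : α × β) : tcode p = true :: (tcode p.1 ++ tcode p.2) := rfl
theorem tcode_cons (x : α) (l : List α) : tcode (x :: l) = true :: (tcode x ++ tcode l) := rfl
theorem tcode_true : tcode true = [true, false, false] := rfl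
theorem tcode_false : tcode false = [false] := rfl

@[simp] theorem tsize_pair (p : α × β) : tsize p = tsize p.1 + tsize p.2 + 1 := by
  simp [tsize, tcode_pair]
@[simp] theorem tsize_nil : tsize ([] : List α) = 1 := rfl
@[simp] theorem tsize_cons (x : α) (l : List α) : tsize (x :: l) = tsize x + tsize l + 1 := by
  simp [tsize, tcode_cons]
theorem tsize_pos (x : α) : 0 < tsize x := by
  unfold tsize tcode
  cases enc x <;> simp [BTree.code]

end Code

/-- Quantities bounded by a polynomial in the size of the argument. -/
def PolyBdd {α : Type*} [TreeEnc α] (g : α → ℕ) : Prop :=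
  ∃ P : Polynomial ℕ, ∀ x, g x ≤ P.eval (tsize x)

theorem Polynomial.eval_le_eval_of_le (P : Polynomial ℕ) {m n : ℕ} (h : m ≤ n) :
    P.eval m ≤ P.eval n := by
  rw [Polynomial.eval_eq_sum_range, Polynomial.eval_eq_sum_range]
  gcongr

namespace PolyBdd

variable {α β : Type*} [TreeEnc α] [TreeEnc β] {f g : α → ℕ}

theorem mono (hg : PolyBdd g) (h : ∀ x, f x ≤ g x) : PolyBdd f :=
  let ⟨P, hP⟩ := hg
  ⟨P, fun x => (h x).trans (hP x)⟩

theorem const (n : ℕ) : PolyBdd fun _ : α => n := ⟨.C n, fun x => by simp⟩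

theorem size : PolyBdd fun x : α => tsize x := ⟨.X, fun x => by simp⟩

theorem add (hf : PolyBdd f) (hg : PolyBdd g) : PolyBdd fun x => f x + g x :=
  let ⟨P, hP⟩ := hf
  let ⟨Q, hQ⟩ := hg
  ⟨P + Q, fun x => by simpa using Nat.add_le_add (hP x) (hQ x)⟩

theorem mul (hf : PolyBdd f) (hg : PolyBdd g) : PolyBdd fun x => f x * g x :=
  let ⟨P, hP⟩ := hf
  let ⟨Q, hQ⟩ := hg
  ⟨P * Q, fun x => by simpa using Nat.mul_le_mul (hP x) (hQ x)⟩

theorem comp {g : β → ℕ} (hg : PolyBdd g) {f : α → β} (hf : PolyBdd fun x => tsize (f x)) :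
    PolyBdd fun x => g (f x) :=
  let ⟨P, hP⟩ := hg
  let ⟨Q, hQ⟩ := hf
  ⟨P.comp Q, fun x => by
    simpa using (hP (f x)).trans (P.eval_le_eval_of_le (hQ x))⟩

theorem eval (P : Polynomial ℕ) (hf : PolyBdd f) : PolyBdd fun x => P.eval (f x) :=
  let ⟨Q, hQ⟩ := hf
  ⟨P.comp Q, fun x => by simpa using P.eval_le_eval_of_le (hQ x)⟩

end PolyBdd

open StackProg

/-- Functions computed on encoded data by a program whose running time, and with it the size of the
result, is bounded by a polynomial in the size of the argument. -/
@[fun_prop]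
def PolyTime {α β : Type*} [TreeEnc α] [TreeEnc β] (f : α → β) : Prop :=
  (PolyBdd fun x => tsize (f x)) ∧
    -- The run leaves everything below the argument untouched, for arbitrary contents of the main
    -- and auxiliary stacks, so programs can be used as subroutines in any context.
    ∃ (p : ∀ A : Type, StackProg (StkAlphabet A)) (T : α → ℕ), PolyBdd T ∧
      ∀ (x : α) (A : Type) (i : List A) (m a : List Bool), ∃ t ≤ T x,
        Exec (p A) (mkStk i (tcode x ++ m) a [] []) (mkStk i (tcode (f x) ++ m) a [] []) t

namespace PolyTime

variable {α β γ δ : Type*} [TreeEnc α] [TreeEnc β] [TreeEnc γ] [TreeEnc δ]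

theorem bdd {f : α → β} (hf : PolyTime f) : PolyBdd fun x => tsize (f x) := hf.1

/-- A function that does not change the code. -/
theorem of_tcode_eq {f : α → β} (h : ∀ x, tcode (f x) = tcode x) : PolyTime f :=
  ⟨PolyBdd.size.mono fun x => by simp [tsize, h], fun _ => .skip, fun _ => 1, .const 1,
    fun x A i m a => ⟨1, le_rfl, by rw [h]; exact .skip _⟩⟩

/-- A function with a polynomial-time first stage and an explicit program for the rest. -/
theorem then_exec {f : α → β} (hf : PolyTime f) {g : α → γ} (hg : PolyBdd fun x => tsize (g x))
    (q : ∀ A : Type, StackProg (StkAlphabet A)) (T : α → ℕ) (hT : PolyBdd T)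
    (h : ∀ (x : α) (A : Type) (i : List A) (m a : List Bool), ∃ t ≤ T x,
        Exec (q A) (mkStk i (tcode (f x) ++ m) a [] []) (mkStk i (tcode (g x) ++ m) a [] []) t) :
    PolyTime g := by
  obtain ⟨_, p, T', hT', hp⟩ := hf
  refine ⟨hg, fun A => .seq (p A) (q A), _, hT'.add hT, fun x A i m a => ?_⟩
  obtain ⟨t, ht, h₁⟩ := hp x A i m a
  obtain ⟨t', ht', h₂⟩ := h x A i m a
  exact ⟨_, by omega, h₁.seq h₂⟩

@[fun_prop] theorem id' : PolyTime fun x : α => x := of_tcode_eq fun _ => rfl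

@[fun_prop] theorem comp {g : β → γ} {f : α → β} (hg : PolyTime g) (hf : PolyTime f) :
    PolyTime fun x => g (f x) := by
  obtain ⟨hb, q, T, hT, h⟩ := hg
  exact hf.then_exec (hb.comp hf.1) q _ (hT.comp hf.1) fun x => h (f x)

/-- Push a tree onto the main stack. -/
def _root_.StackProg.pushTree {A : Type} : BTree → StackProg (StkAlphabet A)
  | .nil => .push .main false
  | .cons x y => .seq (pushTree y) (.seq (pushTree x) (.push .main true))

theorem _root_.StackProg.exec_pushTree {A : Type} {i : List A} {a t c : List Bool} (x : BTree) :
    ∀ m, Exec (Γ := StkAlphabet A) (pushTree x) (mkStk i m a t c) (mkStk i (x.code ++ m) a t c)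
      x.code.length := by
  induction x with
  | nil => intro m; exact .push_main false
  | cons x y ihx ihy =>
    intro m
    have := (ihy m).seq ((ihx _).seq (.push_main true))
    simp only [pushTree, BTree.code]
    convert this using 1
    · simp
    · simp; omega

@[fun_prop] theorem const (y : β) : PolyTime fun _ : α => y := by
  refine ⟨.const _, fun A => .seq drop (pushTree (enc y)), fun x => 6 * tsize x + 2 + tsize y,
    (((PolyBdd.const 6).mul .size).add (.const 2)).add (.const _), fun x A i m a => ?_⟩
  obtain ⟨t, ht, h⟩ := exec_drop (A := A) (i := i) (m := m) (a := a) (t := []) (enc x)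
  exact ⟨_, Nat.add_le_add ht le_rfl, h.seq (exec_pushTree _ _)⟩

-- A copy of the argument waits on the auxiliary stack while `g` is computed. The second component
-- comes first because stacks grow at the front. The factor `17` is `9` for copying plus `8` for
-- fetching back.
@[fun_prop] theorem prodMk {f : α → β} {g : α → γ} (hf : PolyTime f) (hg : PolyTime g) :
    PolyTime fun x => (f x, g x) := by
  obtain ⟨hfb, p, T, hT, hp⟩ := hf
  obtain ⟨hgb, q, T', hT', hq⟩ := hg
  refine ⟨((hfb.add hgb).add (.const 1)).mono fun x => by simp,
    fun A => .seq stashCopy (.seq (q A) (.seq unstash (.seq (p A) (.push .main true)))),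
    fun x => 17 * tsize x + T x + T' x + 7,
    ((((PolyBdd.const 17).mul .size).add hT).add hT').add (.const 7), fun x A i m a => ?_⟩
  obtain ⟨t₁, ht₁, h₁⟩ := exec_stashCopy (A := A) (i := i) (m := m) (a := a) (enc x)
  obtain ⟨t₂, ht₂, h₂⟩ := hq x A i m (tcode x ++ a)
  obtain ⟨t₃, ht₃, h₃⟩ := exec_unstash (A := A) (i := i) (m := tcode (g x) ++ m) (a := a) (enc x)
  obtain ⟨t₄, ht₄, h₄⟩ := hp x A i (tcode (g x) ++ m) a
  refine ⟨t₁ + (t₂ + (t₃ + (t₄ + 1))), ?_, h₁.seq (h₂.seq (h₃.seq (h₄.seq ?_)))⟩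
  · simp only [tsize, tcode] at *; omega
  · simpa [tcode_pair] using Exec.push_main true

@[fun_prop] theorem fst' : PolyTime fun p : α × β => p.1 := by
  refine ⟨PolyBdd.size.mono fun x => by simp; omega,
    fun A => .pop .main fun _ => .seq stash (.seq drop unstash),
    fun x => 22 * tsize x + 9, ((PolyBdd.const 22).mul .size).add (.const 9), fun x A i m a => ?_⟩
  obtain ⟨t₁, ht₁, h₁⟩ := exec_stash (A := A) (i := i) (m := tcode x.2 ++ m) (a := a) (enc x.1)
  obtain ⟨t₂, ht₂, h₂⟩ := exec_drop (A := A) (i := i) (m := m) (a := tcode x.1 ++ a) (t := [])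
    (enc x.2)
  obtain ⟨t₃, ht₃, h₃⟩ := exec_unstash (A := A) (i := i) (m := m) (a := a) (enc x.1)
  refine ⟨1 + (t₁ + (t₂ + t₃)), ?_, ?_⟩
  · simp only [tsize_pair]; simp only [tsize, tcode] at *; omega
  · simpa [tcode_pair] using Exec.pop_main (h₁.seq (h₂.seq h₃))

@[fun_prop] theorem snd' : PolyTime fun p : α × β => p.2 := by
  refine ⟨PolyBdd.size.mono fun x => by simp; omega,
    fun A => .pop .main fun _ => drop,
    fun x => 6 * tsize x + 3, ((PolyBdd.const 6).mul .size).add (.const 3), fun x A i m a => ?_⟩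
  obtain ⟨t₂, ht₂, h₂⟩ := exec_drop (A := A) (i := i) (m := tcode x.2 ++ m) (a := a) (t := [])
    (enc x.1)
  refine ⟨1 + t₂, ?_, ?_⟩
  · simp only [tsize_pair]; simp only [tsize, tcode] at *; omega
  · simpa [tcode_pair] using Exec.pop_main h₂

@[fun_prop] theorem fst {f : α → β × γ} (hf : PolyTime f) : PolyTime fun x => (f x).1 :=
  fst'.comp hf
@[fun_prop] theorem snd {f : α → β × γ} (hf : PolyTime f) : PolyTime fun x => (f x).2 :=
  snd'.comp hf

-- A nonempty list and the pair of its head and tail have the same code.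
@[fun_prop] theorem cons {f : α → β} {g : α → List β} (hf : PolyTime f) (hg : PolyTime g) :
    PolyTime fun x => f x :: g x :=
  (of_tcode_eq (f := fun p : β × List β => p.1 :: p.2) fun _ => rfl).comp (hf.prodMk hg)

/-- Branch on the second bit of the code of a pair with a list as its first component. -/
def listCaseStep {A : Type} (p q : StackProg (StkAlphabet A)) : Option Bool →
    StackProg (StkAlphabet A)
  | some true => .seq (.push .main true) (.seq (.push .main true) q)
  | _ => p

theorem exec_pop_pop {A : Type} {i : List A} {m a t c : List Bool}
    {f : Option Bool → StackProg (StkAlphabet A)} {b b' : Bool} {S' n}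
    (h : Exec (f (some b')) (mkStk i m a t c) S' n) :
    Exec (.pop .main fun _ => .pop .main f) (mkStk i (b :: b' :: m) a t c) S' (1 + (1 + n)) :=
  Exec.pop_main (f := fun _ => _) (Exec.pop_main h)

/-- Popping two bits removes the mark of the pair and the first bit of the list. For an empty list
the code of `p.2` remains; for a nonempty one, pushing both marks back gives the code of `((x, l),
p.2)`. -/
theorem listCase' {f : γ → β} {g : (α × List α) × γ → β} (hf : PolyTime f) (hg : PolyTime g) :
    PolyTime fun p : List α × γ => (match p.1 with | [] => f p.2 | x :: l => g ((x, l), p.2)) := by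
  obtain ⟨⟨F, hF⟩, p, T, ⟨P, hP⟩, hp⟩ := hf
  obtain ⟨⟨G, hG⟩, q, T', ⟨Q, hQ⟩, hq⟩ := hg
  refine ⟨((PolyBdd.size.eval F).add (.eval G .size)).mono ?_,
    fun A => .pop .main fun _ => .pop .main (listCaseStep (p A) (q A)),
    fun x => P.eval (tsize x) + Q.eval (tsize x) + 4,
    ((PolyBdd.size.eval P).add (.eval Q .size)).add (.const 4), ?_⟩
  · rintro ⟨_ | ⟨x, l⟩, c⟩
    · refine (hF c).trans ?_
      have := F.eval_le_eval_of_le (show tsize c ≤ tsize (([] : List α), c) by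
        rw [tsize_pair]; dsimp only; omega)
      omega
    · refine (hG ((x, l), c)).trans ?_
      have := G.eval_le_eval_of_le (show tsize ((x, l), c) ≤ tsize (x :: l, c) by simp)
      omega
  · rintro ⟨_ | ⟨x, l⟩, c⟩ A i m a
    · obtain ⟨t, ht, h⟩ := hp c A i m a
      refine ⟨1 + (1 + t), ?_, ?_⟩
      · have := P.eval_le_eval_of_le (show tsize c ≤ tsize (([] : List α), c) by
          rw [tsize_pair]; dsimp only; omega)
        have := hP c
        dsimp only
        omega
      · exact exec_pop_pop (f := listCaseStep (p A) (q A)) (b' := false) h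
    · obtain ⟨t, ht, h⟩ := hq ((x, l), c) A i m a
      refine ⟨1 + (1 + (1 + (1 + t))), ?_, ?_⟩
      · have := Q.eval_le_eval_of_le (show tsize ((x, l), c) ≤ tsize (x :: l, c) by simp)
        have := hQ ((x, l), c)
        dsimp only
        omega
      · exact exec_pop_pop (f := listCaseStep (p A) (q A)) (b' := true)
          (.seq (.push_main true) (.seq (.push_main true) h))

/-- The body of a loop over a list: take out the first element and process it. -/
def foldStep {A : Type} (p : StackProg (StkAlphabet A)) : Option Bool →
    StackProg (StkAlphabet A)
  | some true => .seq (.push .main true) (.seq (.push .main true) (.seq p (.push .cnt true)))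
  | _ => .skip

/-- The loop works on the pair of the remaining list and the accumulator, and renews its counter
mark only after a nonempty list; for an empty one the two popped bits leave the bare accumulator.
The body is needed only on states that really occur, so its time bound may use bounds for the
intermediate results. -/
theorem exec_fold {A : Type} {i : List A} {m a : List Bool} {σ : Type*} [TreeEnc σ]
    {step : σ → α → σ} {p : StackProg (StkAlphabet A)} {T : ℕ} : ∀ (l : List α) (s : σ),
    (∀ l₁ x l₂, l = l₁ ++ x :: l₂ → ∃ t ≤ T, Exec p
      (mkStk i (tcode ((x, l₂), l₁.foldl step s) ++ m) a [] [])
      (mkStk i (tcode (l₂, (l₁ ++ [x]).foldl step s) ++ m) a [] []) t) →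
    ∃ t ≤ l.length * (T + 6) + 5, Exec
      (.loop .cnt fun _ => .pop .main fun _ => .pop .main (foldStep p))
      (mkStk i (tcode (l, s) ++ m) a [] [true]) (mkStk i (tcode (l.foldl step s) ++ m) a [] []) t
  | [], s, _ => by
    have h := Exec.loop_step (A := A) (k := .cnt) true []
      (f := fun _ => .pop .main fun _ => .pop .main (foldStep p))
      (S := mkStk i (tcode (([] : List α), s) ++ m) a [] [true]) rfl (update_mkStk_cnt ..)
      (exec_pop_pop (f := foldStep p) (b' := false) (.skip _))
      (Exec.loop_nil rfl)
    exact ⟨_, by simp, h⟩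
  | x :: l, s, H => by
    obtain ⟨t, ht, h⟩ := H [] x l rfl
    obtain ⟨t', ht', h'⟩ := exec_fold l (step s x) fun l₁ y l₂ hl => by
      simpa using H (x :: l₁) y l₂ (by simp [hl])
    have h := Exec.loop_step (A := A) (k := .cnt) true []
      (f := fun _ => .pop .main fun _ => .pop .main (foldStep p))
      (S := mkStk i (tcode (x :: l, s) ++ m) a [] [true]) rfl (update_mkStk_cnt ..)
      (exec_pop_pop (f := foldStep p) (b' := true) (.seq (.push_main true)
        (.seq (.push_main true) (.seq h (.push_cnt true))))) h'
    refine ⟨_, ?_, h⟩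
    simp only [List.length_cons, Nat.add_mul]
    omega

theorem length_le_tsize (l : List α) : l.length ≤ tsize l := by
  induction l with
  | nil => simp
  | cons x l ih => simp; omega

theorem tsize_le_of_mem {l : List α} {x : α} (h : x ∈ l) : tsize x ≤ tsize l := by
  induction l with
  | nil => simp at h
  | cons y l ih =>
    rcases List.mem_cons.1 h with rfl | h
    · simp; omega
    · have := ih h; simp; omega

theorem tsize_append (l l' : List α) : tsize (l ++ l') + 1 = tsize l + tsize l' := by
  induction l with
  | nil => simp [add_comm]
  | cons y l ih => simp; omega

/-- A loop over a list whose intermediate results are of polynomial size. -/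
theorem foldl {l : γ → List α} {s : γ → β} {f : γ → β → α → β} (hl : PolyTime l)
    (hs : PolyTime s) (hf : PolyTime fun p : γ × β × α => f p.1 p.2.1 p.2.2)
    (B : γ → ℕ) (hB : PolyBdd B)
    (h : ∀ c l₁, l₁ <+: l c → tsize (l₁.foldl (f c) (s c)) ≤ B c) :
    PolyTime fun c => (l c).foldl (f c) (s c) := by
  -- The parameter travels with the accumulator, since the loop body sees nothing but its own
  -- argument.
  have hG : PolyTime fun p : (α × List α) × (β × γ) => (p.1.2, (f p.2.2 p.2.1 p.1.1, p.2.2)) := by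
    refine prodMk (by fun_prop) (prodMk (hf.comp (f := fun p : (α × List α) × (β × γ) =>
      (p.2.2, p.2.1, p.1.1)) (by fun_prop)) (by fun_prop))
  obtain ⟨-, p, T, ⟨P, hP⟩, hp⟩ := hG
  have hinit : PolyTime fun c => (l c, (s c, c)) := by fun_prop
  let step : γ → β × γ → α → β × γ := fun c t x => (f t.2 t.1 x, t.2)
  have hstep : ∀ c (l' : List α) s, l'.foldl (step c) (s, c) = (l'.foldl (f c) s, c) := by
    intro c l'
    induction l' with
    | nil => intro s; rfl
    | cons x l' ih => intro s; exact ih _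
  -- A bound for the size of the argument of the loop body in every round.
  let Z : γ → ℕ := fun c => tsize (l c) + B c + tsize c + 2
  have hZ : PolyBdd Z := ((hl.1.add hB).add .size).add (.const 2)
  refine PolyTime.comp (g := Prod.fst (α := β) (β := γ)) fst' (f := fun c =>
    ((l c).foldl (f c) (s c), c)) ?_
  refine hinit.then_exec (((hB.add .size).add (.const 1)).mono fun c => ?_)
    (fun A => whileCnt (.pop .main fun _ => .pop .main (foldStep (p A))))
    (fun c => 1 + (tsize (l c) * (P.eval (Z c) + 6) + 5))
    ((PolyBdd.const 1).add ((hl.1.mul ((hZ.eval P).add (.const 6))).add (.const 5)))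
    fun c A i m a => ?_
  · have := h c (l c) List.prefix_rfl
    simp; omega
  · obtain ⟨t, ht, h'⟩ := exec_fold (A := A) (i := i) (m := m) (a := a) (step := step c)
      (p := p A) (T := P.eval (Z c)) (l c) (s c, c) (fun l₁ x l₂ hl' => by
        obtain ⟨t, ht, h'⟩ := hp ((x, l₂), l₁.foldl (step c) (s c, c)) A i m a
        refine ⟨t, (ht.trans (hP _)).trans (P.eval_le_eval_of_le ?_), by simpa [step] using h'⟩
        have h₁ := h c l₁ ⟨x :: l₂, hl'.symm⟩
        have h₂ := tsize_append l₁ (x :: l₂)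
        have h₃ := tsize_pos l₁
        rw [← hl'] at h₂
        simp only [hstep, tsize_pair, Z, tsize_cons] at *
        omega)
    rw [hstep] at h'
    exact ⟨_, Nat.add_le_add le_rfl (ht.trans (Nat.add_le_add_right
      (Nat.mul_le_mul_right _ (length_le_tsize _)) _)), .seq (.push_cnt true) h'⟩

end PolyTime

/-! ### From programs to machines -/

section Machine

open Turing Function

variable {A : Type}

/-- Turn the code of a Boolean on the main stack into a bit. -/
def outputStep : Option Bool → StackProg (StkAlphabet A)
  | some true => .pop .main fun _ => .pop .main fun _ => .push .main true
  | _ => .push .main false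

/-- Read the input word into a list on the main stack, run `p` and output a bit. -/
def wholeProg [TreeEnc A] (p : StackProg (StkAlphabet A)) : StackProg (StkAlphabet A) :=
  .seq (.push .main false)
    (.seq (.loop .inp fun a => .seq (pushTree (enc a)) (.push .main true))
      (.seq p (.pop .main outputStep)))

/-- Letters are put in front of the list in reading order, hence the reversal; each costs at most
`C` pushes, one mark and one loop step. -/
theorem exec_read [TreeEnc A] {C : ℕ} (hC : ∀ a : A, tsize a ≤ C) : ∀ (w l : List A),
    ∃ t ≤ w.length * (C + 2) + 1, Exec (Γ := StkAlphabet A)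
      (.loop .inp fun a => .seq (pushTree (enc a)) (.push .main true))
      (mkStk w (tcode l) [] [] []) (mkStk [] (tcode (w.reverse ++ l)) [] [] []) t
  | [], l => ⟨1, by simp, .loop_nil rfl⟩
  | a :: w, l => by
    obtain ⟨t, ht, h⟩ := exec_read hC w (a :: l)
    have h' := Exec.loop_step (A := A) (k := .inp) a w
      (f := fun a => .seq (pushTree (enc a)) (.push .main true))
      (S := mkStk (a :: w) (tcode l) [] [] []) rfl (update_mkStk_inp ..)
      (.seq (exec_pushTree _ _) (.push_main true)) h
    refine ⟨_, ?_, by simpa using h'⟩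
    have := hC a
    simp only [tsize, tcode, List.length_cons, Nat.add_mul] at *
    omega

/-- The machine of a program. -/
noncomputable def progTM [Finite A] (p : StackProg (StkAlphabet A)) : FinTM2 :=
  haveI : Fintype A := Fintype.ofFinite A
  haveI : ∀ k, Finite (StkAlphabet A k) := fun k => by cases k <;> infer_instance
  haveI := finite_pos p
  { K := Stk
    k₀ := .inp
    k₁ := .main
    Γ := StkAlphabet A
    Λ := Option (Pos p)
    main := some (entry p)
    ΛFin := Fintype.ofFinite _
    σ := Σ k, Option (StkAlphabet A k)
    initialState := ⟨.inp, none⟩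
    σFin := Fintype.ofFinite _
    Γk₀Fin := Fintype.ofFinite A
    m := fun l => match l with
      -- A halting configuration in the sense of `haltList` has its register in the initial state,
      -- so the register is reset.
      | none => .load (fun _ => ⟨.inp, none⟩) .halt
      | some i => stmt p some none i }

theorem exec_output (b : Bool) : ∃ t ≤ 4, Exec (Γ := StkAlphabet A) (.pop .main outputStep)
    (mkStk [] (tcode b) [] [] []) (mkStk [] [b] [] [] []) t := by
  cases b
  · exact ⟨1 + 1, by simp, .pop_main (.push_main false)⟩
  · exact ⟨1 + (1 + (1 + 1)), by simp, .pop_main (f := outputStep) (b := true)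
      (PolyTime.exec_pop_pop (f := fun _ => .push .main true) (.push_main true))⟩

theorem exec_wholeProg [TreeEnc A] {C : ℕ} (hC : ∀ a : A, tsize a ≤ C)
    {p : StackProg (StkAlphabet A)} {w : List A} {b : Bool} {T : ℕ}
    (h : ∃ t ≤ T, Exec p (mkStk [] (tcode w.reverse) [] [] []) (mkStk [] (tcode b) [] [] []) t) :
    ∃ t ≤ w.length * (C + 2) + T + 6, Exec (wholeProg p) (mkStk w [] [] [] [])
      (mkStk [] [b] [] [] []) t := by
  obtain ⟨t₁, ht₁, h₁⟩ := exec_read hC w []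
  obtain ⟨t₂, ht₂, h₂⟩ := h
  obtain ⟨t₃, ht₃, h₃⟩ := exec_output (A := A) b
  rw [List.append_nil] at h₁
  exact ⟨_, by omega, .seq (.push_main false) (.seq h₁ (.seq h₂ h₃))⟩

theorem tsize_list_le [TreeEnc A] {C : ℕ} (hC : ∀ a : A, tsize a ≤ C) (l : List A) :
    tsize l ≤ (C + 1) * l.length + 1 := by
  induction l with
  | nil => simp
  | cons a l ih =>
    have := hC a
    simp only [tsize_cons, List.length_cons, Nat.mul_add]
    omega

/-- Polynomial-time functions on words are computed by machines in polynomial time. -/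
theorem PolyTime.tm2ComputableInPolyTime [Finite A] [TreeEnc A] {ι : Type} {ea : ι → List A}
    {g : ι → Bool} {f : List A → Bool} (hf : PolyTime f) (h : ∀ x, f (ea x).reverse = g x) :
    Nonempty (TM2ComputableInPolyTime ea Computability.encodeBool g) := by
  obtain ⟨-, p, T, ⟨P, hP⟩, hp⟩ := hf
  obtain ⟨C, hC⟩ : ∃ C, ∀ a : A, tsize a ≤ C := by
    obtain ⟨C, hC⟩ := (Set.finite_range fun a : A => tsize a).bddAbove
    exact ⟨C, fun a => hC ⟨a, rfl⟩⟩
  refine ⟨⟨⟨progTM (wholeProg (p A)), Equiv.refl A, Equiv.refl Bool⟩,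
    .X * .C (C + 2) + P.comp (.C (C + 1) * .X + 1) + 7, fun x => ?_⟩⟩
  have hx : ∃ t ≤ P.eval ((C + 1) * (ea x).length + 1), Exec (p A)
      (mkStk [] (tcode (ea x).reverse) [] [] []) (mkStk [] (tcode (g x)) [] [] []) t := by
    obtain ⟨t, ht, h'⟩ := hp (ea x).reverse A [] [] []
    refine ⟨t, (ht.trans (hP _)).trans (P.eval_le_eval_of_le ?_), by simpa [h] using h'⟩
    simpa using tsize_list_le hC (ea x).reverse
  have hw := exec_wholeProg hC hx
  have hsteps : ∃ t ≤ (ea x).length * (C + 2) + P.eval ((C + 1) * (ea x).length + 1) + 7,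
      (flip bind (progTM (wholeProg (p A))).step)^[t]
        (some (initList (progTM (wholeProg (p A))) (ea x))) =
      some (haltList (progTM (wholeProg (p A))) [g x]) := by
    obtain ⟨t, ht, h⟩ := hw
    obtain ⟨v, hv⟩ := h.reaches (progTM (wholeProg (p A))).m some none (fun _ => rfl)
      ⟨.inp, none⟩
    -- The additional step executes the halting label.
    refine ⟨1 + t, by omega, ?_⟩
    have h₀ : initList (progTM (wholeProg (p A))) (ea x) =
        ⟨some (some (entry (wholeProg (p A)))), ⟨.inp, none⟩, mkStk (ea x) [] [] [] []⟩ := by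
      unfold initList
      congr 1
      funext k
      cases k <;> rfl
    have h₁ : haltList (progTM (wholeProg (p A))) [g x] =
        ⟨none, ⟨.inp, none⟩, mkStk [] [g x] [] [] []⟩ := by
      unfold haltList
      congr 1
      funext k
      cases k <;> rfl
    rw [iterate_add_apply, h₀, h₁]
    exact (congrArg (flip bind (progTM (wholeProg (p A))).step)^[1] hv).trans rfl
  choose t ht hs using hsteps
  refine ⟨⟨t, ?_⟩, ?_⟩
  · have e₁ : List.map (Equiv.refl A).invFun (ea x) = ea x := List.map_id _
    refine Eq.trans ?_ hs
    exact congrArg (fun w => (flip bind (progTM (wholeProg (p A))).step)^[t]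
      (some (initList (progTM (wholeProg (p A))) w))) e₁
  · simpa using ht

end Machine

namespace PolyTime

variable {α β γ δ : Type*} [TreeEnc α] [TreeEnc β] [TreeEnc γ] [TreeEnc δ]

/-! ### Case analysis -/

theorem listCase {l : γ → List α} {f : γ → β} {g : γ → α → List α → β} (hl : PolyTime l)
    (hf : PolyTime f) (hg : PolyTime fun p : γ × α × List α => g p.1 p.2.1 p.2.2) :
    PolyTime fun c => (match l c with | [] => f c | x :: t => g c x t) := by
  have h := (listCase' hf (g := fun p : (α × List α) × γ => g p.2 p.1.1 p.1.2)
    (hg.comp (f := fun p : (α × List α) × γ => (p.2, p.1.1, p.1.2)) (by fun_prop))).comp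
    (hl.prodMk id')
  refine Eq.mp (congrArg PolyTime ?_) h
  funext c
  cases l c <;> rfl

@[fun_prop] theorem cond {b : γ → Bool} {f g : γ → β} (hb : PolyTime b) (hf : PolyTime f)
    (hg : PolyTime g) : PolyTime fun c => bif b c then f c else g c := by
  -- `true` and `[()]` have the same code, and so have `false` and `[]`, which reduces this
  -- branching to lists.
  have hu : PolyTime fun b : Bool => (bif b then [()] else []) :=
    of_tcode_eq fun b => by cases b <;> rfl
  have h := listCase (hu.comp hb) hg (g := fun c _ _ => f c) (hf.comp (by fun_prop))
  refine Eq.mp (congrArg PolyTime ?_) h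
  funext c
  cases b c <;> rfl

@[fun_prop] theorem and {f g : γ → Bool} (hf : PolyTime f) (hg : PolyTime g) :
    PolyTime fun c => f c && g c :=
  Eq.mp (congrArg PolyTime (by funext c; cases f c <;> rfl)) (hf.cond hg (const false))

@[fun_prop] theorem or {f g : γ → Bool} (hf : PolyTime f) (hg : PolyTime g) :
    PolyTime fun c => f c || g c :=
  Eq.mp (congrArg PolyTime (by funext c; cases f c <;> rfl)) (hf.cond (const true) hg)

@[fun_prop] theorem not {f : γ → Bool} (hf : PolyTime f) : PolyTime fun c => !f c :=
  Eq.mp (congrArg PolyTime (by funext c; cases f c <;> rfl)) (hf.cond (const false) (const true))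

theorem congr_tcode {f : γ → α} {g : γ → β} (hf : PolyTime f) (h : ∀ c, tcode (g c) = tcode (f c)) :
    PolyTime g := by
  obtain ⟨hb, p, T, hT, hp⟩ := hf
  exact ⟨hb.mono fun c => by simp [tsize, h], p, T, hT, fun c => by simpa only [h] using hp c⟩

/-! ### Options -/

@[fun_prop] theorem some {f : γ → α} (hf : PolyTime f) : PolyTime fun c => Option.some (f c) :=
  (hf.cons (const [])).congr_tcode fun _ => rfl

@[fun_prop] theorem toList {o : γ → Option α} (ho : PolyTime o) : PolyTime fun c => (o c).toList :=
  ho.congr_tcode fun _ => rfl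

@[fun_prop] theorem optionElim {o : γ → Option α} {d : γ → β} {f : γ → α → β} (ho : PolyTime o)
    (hd : PolyTime d) (hf : PolyTime fun p : γ × α => f p.1 p.2) :
    PolyTime fun c => (o c).elim (d c) (f c) := by
  have h := listCase ho.toList hd (g := fun c x _ => f c x)
    (hf.comp (f := fun p : γ × α × List α => (p.1, p.2.1)) (by fun_prop))
  refine Eq.mp (congrArg PolyTime ?_) h
  funext c
  cases o c <;> rfl

@[fun_prop] theorem optionMap {o : γ → Option α} {f : γ → α → β} (ho : PolyTime o)
    (hf : PolyTime fun p : γ × α => f p.1 p.2) : PolyTime fun c => (o c).map (f c) :=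
  Eq.mp (congrArg PolyTime (by funext c; cases o c <;> rfl))
    (ho.optionElim (const none) (f := fun c x => Option.some (f c x)) hf.some)

@[fun_prop] theorem optionBind {o : γ → Option α} {f : γ → α → Option β} (ho : PolyTime o)
    (hf : PolyTime fun p : γ × α => f p.1 p.2) : PolyTime fun c => (o c).bind (f c) :=
  Eq.mp (congrArg PolyTime (by funext c; cases o c <;> rfl))
    (ho.optionElim (const none) (f := f) hf)

@[fun_prop] theorem optionGetD {o : γ → Option α} {d : γ → α} (ho : PolyTime o) (hd : PolyTime d) :
    PolyTime fun c => (o c).getD (d c) :=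
  Eq.mp (congrArg PolyTime (by funext c; cases o c <;> rfl))
    (ho.optionElim hd (f := fun _ x => x) (by fun_prop))

@[fun_prop] theorem optionIsSome {o : γ → Option α} (ho : PolyTime o) :
    PolyTime fun c => (o c).isSome :=
  Eq.mp (congrArg PolyTime (by funext c; cases o c <;> rfl))
    (ho.optionElim (const false) (f := fun _ _ => true) (by fun_prop))

@[fun_prop] theorem optionIsNone {o : γ → Option α} (ho : PolyTime o) :
    PolyTime fun c => (o c).isNone :=
  Eq.mp (congrArg PolyTime (by funext c; cases o c <;> rfl))
    (ho.optionElim (const true) (f := fun _ _ => false) (by fun_prop))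

/-! ### Lists -/

@[fun_prop] theorem head? {l : γ → List α} (hl : PolyTime l) : PolyTime fun c => (l c).head? :=
  Eq.mp (congrArg PolyTime (by funext c; cases l c <;> rfl))
    (hl.listCase (const none) (g := fun _ x _ => Option.some x) (by fun_prop))

@[fun_prop] theorem tail {l : γ → List α} (hl : PolyTime l) : PolyTime fun c => (l c).tail :=
  Eq.mp (congrArg PolyTime (by funext c; cases l c <;> rfl))
    (hl.listCase (const []) (g := fun _ _ t => t) (by fun_prop))

@[fun_prop] theorem isEmpty {l : γ → List α} (hl : PolyTime l) : PolyTime fun c => (l c).isEmpty :=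
  Eq.mp (congrArg PolyTime (by funext c; cases l c <;> rfl))
    (hl.listCase (const true) (g := fun _ _ _ => false) (by fun_prop))

/-- The sizes of the results of `G` on the elements of a list are uniformly bounded. -/
theorem exists_bdd_of_mem {l : γ → List α} (hl : PolyTime l) {G : γ × α → ℕ} (hG : PolyBdd G) :
    ∃ M : γ → ℕ, PolyBdd M ∧ ∀ c, ∀ x ∈ l c, G (c, x) ≤ M c := by
  obtain ⟨P, hP⟩ := hG
  refine ⟨fun c => P.eval (tsize c + tsize (l c) + 1),
    ((PolyBdd.size.add hl.1).add (.const 1)).eval P, fun c x hx => (hP _).trans ?_⟩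
  refine P.eval_le_eval_of_le ?_
  have := tsize_le_of_mem hx
  simp only [tsize_pair]
  omega

/-- A loop in which each round adds a bounded amount to the size of the result. -/
theorem foldl_of_add {l : γ → List α} {s : γ → β} {f : γ → β → α → β} (hl : PolyTime l)
    (hs : PolyTime s) (hf : PolyTime fun p : γ × β × α => f p.1 p.2.1 p.2.2)
    {G : γ × α → ℕ} (hG : PolyBdd G) (h : ∀ c s x, tsize (f c s x) ≤ tsize s + G (c, x)) :
    PolyTime fun c => (l c).foldl (f c) (s c) := by
  obtain ⟨M, hM, hMl⟩ := exists_bdd_of_mem hl hG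
  refine foldl hl hs hf (fun c => tsize (s c) + tsize (l c) * M c) (hs.1.add (hl.1.mul hM))
    fun c l₁ hl₁ => ?_
  have key : ∀ (l₁ : List α) (b : β), (∀ x ∈ l₁, G (c, x) ≤ M c) →
      tsize (l₁.foldl (f c) b) ≤ tsize b + l₁.length * M c := by
    intro l₁
    induction l₁ with
    | nil => intro b _; simp
    | cons x l₁ ih =>
      intro b hb
      have h₁ := ih (f c b x) fun y hy => hb y (List.mem_cons_of_mem _ hy)
      have h₂ := h c b x
      have h₃ := hb x List.mem_cons_self
      simp only [List.foldl_cons, List.length_cons, Nat.add_mul]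
      omega
  refine (key l₁ _ fun x hx => hMl c x (hl₁.subset hx)).trans ?_
  gcongr
  exact hl₁.length_le.trans (length_le_tsize _)

@[fun_prop] theorem reverse {l : γ → List α} (hl : PolyTime l) :
    PolyTime fun c => (l c).reverse := by
  have h : PolyTime fun c => (l c).foldl (fun s x => x :: s) [] :=
    foldl_of_add hl (const []) (f := fun _ s x => x :: s) (by fun_prop)
      (G := fun p => tsize p) .size (fun c s x => by simp; omega)
  simpa using h

theorem foldr {l : γ → List α} {s : γ → β} {f : γ → α → β → β} (hl : PolyTime l)
    (hs : PolyTime s) (hf : PolyTime fun p : γ × α × β => f p.1 p.2.1 p.2.2)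
    (B : γ → ℕ) (hB : PolyBdd B)
    (h : ∀ c l₁, l₁ <:+ l c → tsize (l₁.foldr (f c) (s c)) ≤ B c) :
    PolyTime fun c => (l c).foldr (f c) (s c) := by
  have := foldl hl.reverse hs (f := fun c s x => f c x s)
    (hf.comp (f := fun p : γ × β × α => (p.1, p.2.2, p.2.1)) (by fun_prop)) B hB
    fun c l₁ hl₁ => by
      have := h c l₁.reverse (by simpa using List.reverse_suffix.2 hl₁)
      simpa using this
  simpa using this

theorem foldr_of_add {l : γ → List α} {s : γ → β} {f : γ → α → β → β} (hl : PolyTime l)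
    (hs : PolyTime s) (hf : PolyTime fun p : γ × α × β => f p.1 p.2.1 p.2.2)
    {G : γ × α → ℕ} (hG : PolyBdd G) (h : ∀ c x s, tsize (f c x s) ≤ tsize s + G (c, x)) :
    PolyTime fun c => (l c).foldr (f c) (s c) := by
  have := foldl_of_add hl.reverse hs (f := fun c s x => f c x s)
    (hf.comp (f := fun p : γ × β × α => (p.1, p.2.2, p.2.1)) (by fun_prop)) hG
    fun c s x => h c x s
  simpa using this

@[fun_prop] theorem append {l l' : γ → List α} (hl : PolyTime l) (hl' : PolyTime l') :
    PolyTime fun c => l c ++ l' c := by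
  have h : PolyTime fun c => (l c).foldr (fun x s => x :: s) (l' c) :=
    foldr_of_add hl hl' (f := fun _ x s => x :: s) (by fun_prop)
      (G := fun p => tsize p) .size (fun c x s => by simp; omega)
  simpa using h

@[fun_prop] theorem map {l : γ → List α} {f : γ → α → β} (hl : PolyTime l)
    (hf : PolyTime fun p : γ × α => f p.1 p.2) : PolyTime fun c => (l c).map (f c) := by
  have h : PolyTime fun c => (l c).foldr (fun x s => f c x :: s) [] :=
    foldr_of_add hl (const []) (f := fun c x s => f c x :: s)
      ((hf.comp (f := fun p : γ × α × List β => (p.1, p.2.1)) (by fun_prop)).cons (by fun_prop))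
      (G := fun p => tsize (f p.1 p.2) + 1) (hf.1.add (.const 1)) (fun c x s => by simp; omega)
  refine Eq.mp (congrArg PolyTime ?_) h
  funext c
  induction l c with
  | nil => rfl
  | cons x l ih => simp [ih]

@[fun_prop] theorem flatMap {l : γ → List α} {f : γ → α → List β} (hl : PolyTime l)
    (hf : PolyTime fun p : γ × α => f p.1 p.2) : PolyTime fun c => (l c).flatMap (f c) := by
  have h : PolyTime fun c => (l c).foldr (fun x s => f c x ++ s) [] :=
    foldr_of_add hl (const []) (f := fun c x s => f c x ++ s)
      ((hf.comp (f := fun p : γ × α × List β => (p.1, p.2.1)) (by fun_prop)).append (by fun_prop))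
      (G := fun p => tsize (f p.1 p.2)) hf.1 (fun c x s => by
        have := tsize_append (f c x) s
        dsimp only; omega)
  refine Eq.mp (congrArg PolyTime ?_) h
  funext c
  induction l c with
  | nil => rfl
  | cons x l ih => simp [ih]

@[fun_prop] theorem filterMap {l : γ → List α} {f : γ → α → Option β} (hl : PolyTime l)
    (hf : PolyTime fun p : γ × α => f p.1 p.2) : PolyTime fun c => (l c).filterMap (f c) := by
  have h := flatMap hl (f := fun c x => (f c x).toList) hf.toList
  refine Eq.mp (congrArg PolyTime ?_) h
  funext c
  induction l c with
  | nil => rfl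
  | cons x l ih => cases hx : f c x <;> simp [ih, hx]

@[fun_prop] theorem all {l : γ → List α} {f : γ → α → Bool} (hl : PolyTime l)
    (hf : PolyTime fun p : γ × α => f p.1 p.2) : PolyTime fun c => (l c).all (f c) := by
  have h : PolyTime fun c => (l c).foldr (fun x s => f c x && s) true :=
    foldr_of_add hl (const true) (f := fun c x s => f c x && s)
      ((hf.comp (f := fun p : γ × α × Bool => (p.1, p.2.1)) (by fun_prop)).and (by fun_prop))
      (G := fun p => 3) (.const 3) (fun c x s => by
        cases f c x <;> cases s <;> simp [tsize, tcode_true, tcode_false])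
  refine Eq.mp (congrArg PolyTime ?_) h
  funext c
  induction l c with
  | nil => rfl
  | cons x l ih => simp [ih]

/-- Unary numbers are lists without information. -/
@[fun_prop] theorem drop {l : γ → List α} {k : γ → List Unit} (hl : PolyTime l) (hk : PolyTime k) :
    PolyTime fun c => (l c).drop (k c).length := by
  have h : PolyTime fun c => (k c).foldl (fun s _ => s.tail) (l c) :=
    foldl_of_add hk hl (f := fun _ s _ => s.tail) (by fun_prop)
      (G := fun p => 0) (.const 0) (fun c s x => by cases s <;> simp; omega)
  refine Eq.mp (congrArg PolyTime ?_) h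
  funext c
  generalize l c = l
  induction k c generalizing l with
  | nil => rfl
  | cons x k ih => simp [ih]

/-- One step of the computation of `zip` by a loop over the first list. -/
def zipStep (s : List β × List (α × β)) (x : α) : List β × List (α × β) :=
  s.1.head?.elim s fun y => (s.1.tail, (x, y) :: s.2)

theorem foldl_zipStep {σ τ : Type*} (l : List σ) : ∀ s : List τ × List (σ × τ),
    (l.foldl zipStep s).2 = (l.zip s.1).reverse ++ s.2 := by
  induction l with
  | nil => intro s; simp
  | cons x l ih =>
    rintro ⟨_ | ⟨y, r⟩, acc⟩
    · simp [zipStep, ih]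
    · simp [zipStep, ih]

@[fun_prop] theorem zip {l : γ → List α} {l' : γ → List β} (hl : PolyTime l) (hl' : PolyTime l') :
    PolyTime fun c => (l c).zip (l' c) := by
  have hz : PolyTime fun p : γ × (List β × List (α × β)) × α => zipStep p.2.1 p.2.2 := by
    unfold zipStep; fun_prop
  have h : PolyTime fun c => (l c).foldl zipStep (l' c, []) :=
    foldl_of_add hl (by fun_prop) (f := fun _ => zipStep) hz (G := fun p => tsize p) .size
    (by
      rintro c ⟨_ | ⟨y, r⟩, acc⟩ x
      · simp [zipStep]
      · simp [zipStep]; omega)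
  have h' := h.snd.reverse
  simpa [foldl_zipStep] using h'

@[fun_prop] theorem zipWith {l : γ → List α} {l' : γ → List β} {f : γ → α → β → δ} (hl : PolyTime l)
    (hl' : PolyTime l') (hf : PolyTime fun p : γ × α × β => f p.1 p.2.1 p.2.2) :
    PolyTime fun c => List.zipWith (f c) (l c) (l' c) := by
  have h := (hl.zip hl').map (f := fun c p => f c p.1 p.2)
    (hf.comp (f := fun p : γ × α × β => (p.1, p.2.1, p.2.2)) (by fun_prop))
  refine Eq.mp (congrArg PolyTime ?_) h
  funext c
  rw [List.zip, List.map_zipWith]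

/-! ### Equality tests -/

/-- One step of a comparison of lists. -/
def eqStep [DecidableEq α] (s : Bool × List α) (x : α) : Bool × List α :=
  s.2.head?.elim (false, []) fun y => (s.1 && decide (x = y), s.2.tail)

/-- Lists agree if all compared heads agree and nothing of the second list is left over. A second
list that ends too early clears the flag for good. -/
theorem foldl_eqStep {σ : Type*} [DecidableEq σ] (l : List σ) : ∀ b (r : List σ),
    ((l.foldl eqStep (b, r)).1 && (l.foldl eqStep (b, r)).2.isEmpty) = (b && decide (l = r)) := by
  induction l with
  | nil =>
    intro b r
    cases r <;> simp
  | cons x l ih =>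
    rintro b (_ | ⟨y, r⟩)
    · simp only [List.foldl_cons, eqStep, List.head?_nil, Option.elim_none, ih]
      simp
    · simp only [List.foldl_cons, eqStep, List.head?_cons, Option.elim_some, List.tail_cons, ih]
      by_cases h : x = y <;> simp [h]

theorem listEq [DecidableEq α] (h : PolyTime fun p : α × α => decide (p.1 = p.2)) :
    PolyTime fun p : List α × List α => decide (p.1 = p.2) := by
  have hs : PolyTime fun p : (List α × List α) × (Bool × List α) × α => eqStep p.2.1 p.2.2 := by
    unfold eqStep
    refine optionElim (by fun_prop) (const _) (f := fun (p : (List α × List α) ×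
      (Bool × List α) × α) y => (p.2.1.1 && decide (p.2.2 = y), p.2.1.2.tail)) ?_
    exact ((by fun_prop : PolyTime fun p : ((List α × List α) × (Bool × List α) × α) × α =>
      p.1.2.1.1).and (h.comp (f := fun p : ((List α × List α) × (Bool × List α) × α) × α =>
        (p.1.2.2, p.2)) (by fun_prop))).prodMk (by fun_prop)
  have h : PolyTime fun p : List α × List α => p.1.foldl eqStep (true, p.2) :=
    foldl_of_add (by fun_prop) (by fun_prop) (f := fun _ => eqStep) hs (G := fun _ => 3) (.const 3)
    (by
      rintro c ⟨b, _ | ⟨y, r⟩⟩ x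
      · have := tsize_pos b
        simp [eqStep]
        simp [tsize, tcode_false] at *
      · have : tsize (b && decide (x = y)) ≤ 3 := by
          cases (b && decide (x = y)) <;> simp [tsize, tcode_true, tcode_false]
        simp [eqStep]; omega)
  have h' := h.fst.and h.snd.isEmpty
  simpa [foldl_eqStep] using h'

end PolyTime

/-! ### Trees as data, finite types and injective encodings. -/

instance : TreeEnc BTree := ⟨id⟩

namespace BTree

/-- The elements along the right spine of a tree. -/
def spine : BTree → List BTree
  | nil => []
  | cons a b => a :: spine b

/-- The tree with a given right spine. -/
def ofSpine : List BTree → BTree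
  | [] => nil
  | a :: l => cons a (ofSpine l)

theorem encList_spine : ∀ x : BTree, encList x.spine = x
  | nil => rfl
  | cons a b => congrArg (cons a) (encList_spine b)

theorem encList_eq_ofSpine : ∀ l : List BTree, encList l = ofSpine l
  | [] => rfl
  | a :: l => congrArg (cons a) (encList_eq_ofSpine l)

end BTree

/-- The encoding of a finite type by numbering its elements. All codes have the same length. -/
@[reducible] noncomputable def finTreeEnc (α : Type*) [Finite α] : TreeEnc α :=
  -- The unary number is padded by its complement to the cardinality, so that all codes have the
  -- same length.
  ⟨fun a => enc (List.replicate (Finite.equivFin α a : ℕ) (),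
    List.replicate (Nat.card α - (Finite.equivFin α a : ℕ)) ())⟩

theorem tsize_unary (l : List Unit) : tsize l = 2 * l.length + 1 := by
  induction l with
  | nil => rfl
  | cons x l ih => rw [tsize_cons, ih, List.length_cons]; simp [tsize, tcode, enc, BTree.code]; omega

theorem tsize_finTreeEnc {α : Type*} [Finite α] (a : α) :
    @tsize α (finTreeEnc α) a = 2 * Nat.card α + 3 := by
  have h : @tsize α (finTreeEnc α) a = tsize (List.replicate (Finite.equivFin α a : ℕ) (),
    List.replicate (Nat.card α - (Finite.equivFin α a : ℕ)) ()) := rfl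
  have := (Finite.equivFin α a).2
  rw [h, tsize_pair, tsize_unary, tsize_unary]
  simp
  omega

/-- Encodings as trees that determine the encoded element. -/
class InjTreeEnc (α : Type*) [TreeEnc α] : Prop where
  inj : Function.Injective (enc : α → BTree)

theorem encList_injective {α : Type*} [TreeEnc α] [InjTreeEnc α] :
    Function.Injective (encList : List α → BTree) := by
  intro l
  induction l with
  | nil => rintro (_ | ⟨y, l'⟩) h; exacts [rfl, by cases h]
  | cons x l ih =>
    rintro (_ | ⟨y, l'⟩) h
    · cases h
    · injection h with h₁ h₂
      rw [InjTreeEnc.inj h₁, ih h₂]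

instance : InjTreeEnc Unit := ⟨fun _ _ _ => rfl⟩
instance : InjTreeEnc Bool := ⟨by decide⟩
instance {α β : Type*} [TreeEnc α] [TreeEnc β] [InjTreeEnc α] [InjTreeEnc β] :
    InjTreeEnc (α × β) := ⟨fun p q h => by
  injection h with h₁ h₂
  exact Prod.ext (InjTreeEnc.inj h₁) (InjTreeEnc.inj h₂)⟩
instance {α : Type*} [TreeEnc α] [InjTreeEnc α] : InjTreeEnc (List α) := ⟨encList_injective⟩

theorem finTreeEnc_injective (α : Type*) [Finite α] : @InjTreeEnc α (finTreeEnc α) :=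
  @InjTreeEnc.mk α (finTreeEnc α) fun a b h => by
    have h' := congrArg (fun p => p.1.length) (InjTreeEnc.inj (α := List Unit × List Unit) h)
    simpa [Fin.val_inj] using h'

namespace PolyTime

variable {α β γ δ : Type*} [TreeEnc α] [TreeEnc β] [TreeEnc γ] [TreeEnc δ]

/-- The recursion is on the fixed tree `t` and not on the argument, so the test is a fixed nesting
of case distinctions. A tree is taken apart as the list along its right spine, which has the same
code. -/
theorem eqTree (t : BTree) : PolyTime fun x : BTree => decide (x = t) := by
  have hsp : PolyTime BTree.spine := of_tcode_eq fun x => congrArg BTree.code x.encList_spine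
  have hof : PolyTime BTree.ofSpine :=
    of_tcode_eq fun l => congrArg BTree.code (BTree.encList_eq_ofSpine l).symm
  induction t with
  | nil =>
    refine Eq.mp (congrArg PolyTime ?_) hsp.isEmpty
    funext x
    cases x <;> rfl
  | cons a b iha ihb =>
    have h := hsp.listCase (const false) (g := fun _ y l => decide (y = a) &&
      decide (BTree.ofSpine l = b))
      ((iha.comp (f := fun p : BTree × BTree × List BTree => p.2.1) (by fun_prop)).and
        (ihb.comp (hof.comp (f := fun p : BTree × BTree × List BTree => p.2.2) (by fun_prop))))
    refine Eq.mp (congrArg PolyTime ?_) h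
    have hs : ∀ y : BTree, BTree.ofSpine y.spine = y := fun y => by
      rw [← BTree.encList_eq_ofSpine, BTree.encList_spine]
    funext x
    cases x <;> simp [BTree.spine, hs]

theorem eqConst [DecidableEq α] [InjTreeEnc α] (a : α) : PolyTime fun x : α => decide (x = a) := by
  have h : PolyTime (enc : α → BTree) := of_tcode_eq fun _ => rfl
  have h' := (eqTree (enc a)).comp h
  simpa [InjTreeEnc.inj.eq_iff] using h'

/-- Case analysis on an element of a finite type. -/
theorem finCases [Finite α] [InjTreeEnc α] {g : γ → α} {f : γ → α → β} (hg : PolyTime g)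
    (hf : ∀ a, PolyTime fun c => f c a) : PolyTime fun c => f c (g c) := by
  classical
  rcases isEmpty_or_nonempty α with hα | ⟨⟨a₀⟩⟩
  · exact ⟨⟨0, fun c => hα.elim (g c)⟩, fun _ => .skip, fun _ => 0, .const 0,
      fun c => hα.elim (g c)⟩
  -- A chain of comparisons with fixed elements; outside `L` the value is that for `a₀` and does not
  -- matter.
  · have key : ∀ L : List α, ∃ F : γ → β, PolyTime F ∧ ∀ c, g c ∈ L → F c = f c (g c) := by
      intro L
      induction L with
      | nil => exact ⟨_, hf a₀, by simp⟩
      | cons a L ih =>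
        obtain ⟨F, hF, hFL⟩ := ih
        refine ⟨_, ((eqConst a).comp hg).cond (hf a) hF, fun c hc => ?_⟩
        by_cases h : g c = a
        · simp [h]
        · simp [h, hFL c ((List.mem_cons.1 hc).resolve_left h)]
    have := Fintype.ofFinite α
    obtain ⟨F, hF, hFL⟩ := key Finset.univ.toList
    exact Eq.mp (congrArg PolyTime (funext fun c => hFL c (by simp))) hF

theorem of_finite [Finite α] [InjTreeEnc α] (f : α → β) : PolyTime f :=
  finCases (g := fun x : α => x) (f := fun _ a => f a) id' fun a => const (f a)

theorem of_finite_prod [Finite α] [InjTreeEnc α] [Finite δ] [InjTreeEnc δ] (f : α × δ → β) :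
    PolyTime f := of_finite f

end PolyTime

/-! ### Arithmetic of binary numbers -/

instance : TreeEnc ℕ := ⟨fun n => enc n.bits⟩

theorem tsize_bits (n : ℕ) : tsize n.bits = tsize n := rfl

theorem tsize_list_bool_le (l : List Bool) : tsize l ≤ 4 * l.length + 1 := by
  induction l with
  | nil => simp
  | cons b l ih =>
    have : tsize b ≤ 3 := by cases b <;> simp [tsize, tcode_true, tcode_false]
    simp only [tsize_cons, List.length_cons]; omega

theorem tsize_nat_le (n : ℕ) : tsize n ≤ 4 * n.size + 1 := by
  rw [← tsize_bits, ← Nat.size_eq_bits_len]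
  exact tsize_list_bool_le _

theorem size_le_tsize (n : ℕ) : n.size ≤ tsize n := by
  rw [← tsize_bits, ← Nat.size_eq_bits_len]
  exact PolyTime.length_le_tsize _

/-- The number with the given binary digits. -/
def ofBits (l : List Bool) : ℕ := l.foldr Nat.bit 0

@[simp] theorem ofBits_nil : ofBits [] = 0 := rfl
@[simp] theorem ofBits_cons (b : Bool) (l : List Bool) : ofBits (b :: l) = Nat.bit b (ofBits l) :=
  rfl

@[simp] theorem ofBits_bits (n : ℕ) : ofBits n.bits = n := by
  induction n using Nat.binaryRec' with
  | zero => simp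
  | bit b n h ih => rw [Nat.bits_append_bit n b h, ofBits_cons, ih]

theorem ofBits_lt (l : List Bool) : ofBits l < 2 ^ l.length := by
  induction l with
  | nil => simp
  | cons b l ih => simpa using ih

@[simp] theorem ofBits_append_map_false {α : Type*} (l : List Bool) (l' : List α) :
    ofBits (l ++ l'.map fun _ => false) = ofBits l := by
  induction l with
  | nil =>
    induction l' with
    | nil => rfl
    | cons x l' ih => simpa using ih
  | cons b l ih => rw [List.cons_append, ofBits_cons, ih, ofBits_cons]

namespace PolyTime

variable {γ : Type*} [TreeEnc γ]

@[fun_prop] theorem natBits {f : γ → ℕ} (hf : PolyTime f) : PolyTime fun c => (f c).bits :=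
  hf.congr_tcode fun _ => rfl

-- Prepending the digit is right except for the digit `0` in front of the number `0`, whose
-- canonical word is empty.
@[fun_prop] theorem natBit {b : γ → Bool} {f : γ → ℕ} (hb : PolyTime b) (hf : PolyTime f) :
    PolyTime fun c => Nat.bit (b c) (f c) := by
  have h : PolyTime fun c => bif (!(b c) && (f c).bits.isEmpty) then [] else b c :: (f c).bits := by
    fun_prop
  refine h.congr_tcode fun c => ?_
  change tcode (Nat.bit (b c) (f c)).bits = _
  congr 1
  by_cases h : f c = 0 → b c = true
  · rw [Nat.bits_append_bit _ _ h]
    cases hb : b c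
    · have : (f c).bits ≠ [] := fun h' => by
        have := ofBits_bits (f c)
        rw [h'] at this
        have := h this.symm
        simp_all
      cases h' : (f c).bits <;> simp_all
    · rfl
  · push Not at h
    simp [h.1, h.2]

@[fun_prop] theorem natOfBits {l : γ → List Bool} (hl : PolyTime l) :
    PolyTime fun c => ofBits (l c) :=
  foldr hl (const 0) (f := fun _ b n => Nat.bit b n) (by fun_prop) (fun c => 4 * tsize (l c) + 1)
    (((PolyBdd.const 4).mul hl.1).add (.const 1)) fun c l₁ hl₁ => by
      refine (tsize_nat_le _).trans ?_
      have h := Nat.size_le.2 (ofBits_lt l₁)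
      have := hl₁.length_le.trans (length_le_tsize _)
      have : (ofBits l₁).size ≤ tsize (l c) := h.trans this
      change (l₁.foldr (fun b n => Nat.bit b n) 0).size ≤ _ at this
      omega

@[fun_prop] theorem natBodd {f : γ → ℕ} (hf : PolyTime f) : PolyTime fun c => (f c).bodd :=
  Eq.mp (congrArg PolyTime (by
    funext c
    rw [Nat.bodd_eq_bits_head]
    cases (f c).bits <;> rfl)) (hf.natBits.head?.optionGetD (const false))

@[fun_prop] theorem natDiv2 {f : γ → ℕ} (hf : PolyTime f) : PolyTime fun c => (f c).div2 :=
  hf.natBits.tail.congr_tcode fun c => by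
    change tcode (f c).div2.bits = _
    rw [Nat.div2_bits_eq_tail]

/-- The digits of two numbers, padded to the same length. -/
def bitPairs (m n : ℕ) : List (Bool × Bool) :=
  (m.bits ++ n.bits.map fun _ => false).zip (n.bits ++ m.bits.map fun _ => false)

theorem ofBits_bitPairs_fst (m n : ℕ) : ofBits ((bitPairs m n).map Prod.fst) = m := by
  rw [bitPairs, List.map_fst_zip (by simp [add_comm]), ofBits_append_map_false, ofBits_bits]

theorem ofBits_bitPairs_snd (m n : ℕ) : ofBits ((bitPairs m n).map Prod.snd) = n := by
  rw [bitPairs, List.map_snd_zip (by simp [add_comm]), ofBits_append_map_false, ofBits_bits]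

theorem bitPairs_polyTime {f g : γ → ℕ} (hf : PolyTime f) (hg : PolyTime g) :
    PolyTime fun c => bitPairs (f c) (g c) := by
  unfold bitPairs; fun_prop

/-- One step of an addition, for the sum and the successor of the sum. -/
def addStep (p : Bool × Bool) (s : ℕ × ℕ) : ℕ × ℕ :=
  (Nat.bit (xor p.1 p.2) (bif p.1 && p.2 then s.2 else s.1),
    Nat.bit (!(xor p.1 p.2)) (bif p.1 || p.2 then s.2 else s.1))

/-- Digits are stored with the least significant one first, so `foldr` meets the most significant
digits before the carry into them is known. Both possible outcomes are kept, and the next lower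
digits select between them. -/
theorem foldr_addStep (l : List (Bool × Bool)) : l.foldr addStep (0, 1) =
    (ofBits (l.map Prod.fst) + ofBits (l.map Prod.snd),
      ofBits (l.map Prod.fst) + ofBits (l.map Prod.snd) + 1) := by
  induction l with
  | nil => rfl
  | cons p l ih =>
    obtain ⟨_ | _, _ | _⟩ := p <;> simp [ih, addStep, Nat.bit_val] <;> omega

@[fun_prop] theorem xor' {f g : γ → Bool} (hf : PolyTime f) (hg : PolyTime g) :
    PolyTime fun c => xor (f c) (g c) :=
  Eq.mp (congrArg PolyTime (by funext c; cases f c <;> cases g c <;> rfl)) (hf.cond hg.not hg)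

@[fun_prop] theorem natAdd {f g : γ → ℕ} (hf : PolyTime f) (hg : PolyTime g) :
    PolyTime fun c => f c + g c := by
  have hs : PolyTime fun p : γ × (Bool × Bool) × (ℕ × ℕ) => addStep p.2.1 p.2.2 := by
    unfold addStep; fun_prop
  have h := foldr (bitPairs_polyTime hf hg) (const (0, 1)) (f := fun _ => addStep) hs
    (fun c => 8 * tsize (bitPairs (f c) (g c)) + 11)
    (((PolyBdd.const 8).mul (bitPairs_polyTime hf hg).1).add (.const 11)) fun c l₁ hl₁ => by
      have h₁ := ofBits_lt (l₁.map Prod.fst)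
      have h₂ := ofBits_lt (l₁.map Prod.snd)
      have h₃ := hl₁.length_le.trans (length_le_tsize _)
      simp only [List.length_map] at h₁ h₂
      rw [foldr_addStep, tsize_pair]
      generalize ofBits (l₁.map Prod.fst) = x at *
      generalize ofBits (l₁.map Prod.snd) = y at *
      have h₄ : (x + y).size ≤ l₁.length + 1 := Nat.size_le.2 (by rw [pow_succ]; omega)
      have h₅ : (x + y + 1).size ≤ l₁.length + 1 := Nat.size_le.2 (by rw [pow_succ]; omega)
      have h₆ := tsize_nat_le (x + y)
      have h₇ := tsize_nat_le (x + y + 1)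
      dsimp only
      omega
  simpa [foldr_addStep, ofBits_bitPairs_fst, ofBits_bitPairs_snd] using h.fst

/-- One step of a subtraction, for the difference and its predecessor. -/
def subStep (p : Bool × Bool) (s : Option ℕ × Option ℕ) : Option ℕ × Option ℕ :=
  ((bif !p.1 && p.2 then s.2 else s.1).map (Nat.bit (xor p.1 p.2)),
    (bif p.1 && !p.2 then s.1 else s.2).map (Nat.bit (!(xor p.1 p.2))))

/-- The same selection with a borrow in place of a carry; `none` stands for a negative result, which
later decides `≤`. -/
theorem foldr_subStep (l : List (Bool × Bool)) : l.foldr subStep (Option.some 0, none) =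
    (if ofBits (l.map Prod.snd) ≤ ofBits (l.map Prod.fst) then
      Option.some (ofBits (l.map Prod.fst) - ofBits (l.map Prod.snd)) else none,
     if ofBits (l.map Prod.snd) + 1 ≤ ofBits (l.map Prod.fst) then
      Option.some (ofBits (l.map Prod.fst) - ofBits (l.map Prod.snd) - 1) else none) := by
  induction l with
  | nil => rfl
  | cons p l ih =>
    rw [List.foldr_cons, ih]
    generalize hx : ofBits (l.map Prod.fst) = x
    generalize hy : ofBits (l.map Prod.snd) = y
    obtain ⟨_ | _, _ | _⟩ := p <;>
      simp only [subStep, List.map_cons, ofBits_cons, hx, hy, Nat.bit_val] <;>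
      refine Prod.ext ?_ ?_ <;> simp <;> split_ifs <;> (try simp) <;> omega

theorem tsize_option_nat_le {o : Option ℕ} {k : ℕ} (h : ∀ n ∈ o, n.size ≤ k) :
    tsize o ≤ 4 * k + 3 := by
  cases o with
  | none => change 1 ≤ _; omega
  | some n =>
    change tsize [n] ≤ _
    have := tsize_nat_le n
    have := h n rfl
    simp
    omega

theorem subPairs_polyTime {f g : γ → ℕ} (hf : PolyTime f) (hg : PolyTime g) :
    PolyTime fun c => (bitPairs (f c) (g c)).foldr subStep (Option.some 0, none) := by
  have hs : PolyTime fun p : γ × (Bool × Bool) × (Option ℕ × Option ℕ) => subStep p.2.1 p.2.2 := by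
    unfold subStep; fun_prop
  refine foldr (bitPairs_polyTime hf hg) (const (Option.some 0, none)) (f := fun _ => subStep) hs
    (fun c => 8 * tsize (bitPairs (f c) (g c)) + 7)
    (((PolyBdd.const 8).mul (bitPairs_polyTime hf hg).1).add (.const 7)) fun c l₁ hl₁ => ?_
  have h₁ := ofBits_lt (l₁.map Prod.fst)
  have h₃ := hl₁.length_le.trans (length_le_tsize _)
  simp only [List.length_map] at h₁
  rw [foldr_subStep, tsize_pair]
  have h₄ : ∀ n, n ≤ ofBits (l₁.map Prod.fst) → n.size ≤ l₁.length := fun n hn =>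
    Nat.size_le.2 (hn.trans_lt h₁)
  have h₅ := tsize_option_nat_le (k := l₁.length)
    (o := if ofBits (l₁.map Prod.snd) ≤ ofBits (l₁.map Prod.fst) then
      Option.some (ofBits (l₁.map Prod.fst) - ofBits (l₁.map Prod.snd)) else none) (by
      intro n hn
      refine h₄ n ?_
      split_ifs at hn <;> simp at hn; omega)
  have h₆ := tsize_option_nat_le (k := l₁.length)
    (o := if ofBits (l₁.map Prod.snd) + 1 ≤ ofBits (l₁.map Prod.fst) then
      Option.some (ofBits (l₁.map Prod.fst) - ofBits (l₁.map Prod.snd) - 1) else none) (by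
      intro n hn
      refine h₄ n ?_
      split_ifs at hn <;> simp at hn; omega)
  dsimp only
  omega

@[fun_prop] theorem natSub {f g : γ → ℕ} (hf : PolyTime f) (hg : PolyTime g) :
    PolyTime fun c => f c - g c := by
  have h := (subPairs_polyTime hf hg).fst.optionGetD (const 0)
  refine Eq.mp (congrArg PolyTime ?_) h
  funext c
  rw [foldr_subStep, ofBits_bitPairs_fst, ofBits_bitPairs_snd]
  dsimp only
  split_ifs <;> simp; omega

@[fun_prop] theorem natLe {f g : γ → ℕ} (hf : PolyTime f) (hg : PolyTime g) :
    PolyTime fun c => decide (f c ≤ g c) := by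
  have h := (subPairs_polyTime hg hf).fst.optionIsSome
  refine Eq.mp (congrArg PolyTime ?_) h
  funext c
  rw [foldr_subStep, ofBits_bitPairs_fst, ofBits_bitPairs_snd]
  dsimp only
  split_ifs <;> simp [*]

@[fun_prop] theorem natLt {f g : γ → ℕ} (hf : PolyTime f) (hg : PolyTime g) :
    PolyTime fun c => decide (f c < g c) :=
  Eq.mp (congrArg PolyTime (by
    funext c
    rw [← decide_not]
    exact decide_eq_decide.2 not_le)) (hg.natLe hf).not

@[fun_prop] theorem natEq {f g : γ → ℕ} (hf : PolyTime f) (hg : PolyTime g) :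
    PolyTime fun c => decide (f c = g c) :=
  Eq.mp (congrArg PolyTime (by
    funext c
    rw [← Bool.decide_and]
    exact decide_eq_decide.2 le_antisymm_iff.symm))
    ((hf.natLe hg).and (hg.natLe hf))

theorem size_mul_le (m n : ℕ) : (m * n).size ≤ m.size + n.size :=
  Nat.size_le.2 (by
    rw [pow_add]
    exact mul_lt_mul'' (Nat.lt_size_self m) (Nat.lt_size_self n) (Nat.zero_le _) (Nat.zero_le _))

theorem size_add_le (m n : ℕ) : (m + n).size ≤ max m.size n.size + 1 :=
  Nat.size_le.2 (by
    have h₁ := (Nat.lt_size_self m).trans_le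
      (Nat.pow_le_pow_right (n := 2) (by norm_num) (le_max_left m.size n.size))
    have h₂ := (Nat.lt_size_self n).trans_le
      (Nat.pow_le_pow_right (n := 2) (by norm_num) (le_max_right m.size n.size))
    rw [pow_succ]; omega)

/-- Horner's scheme in base two. -/
theorem foldr_mul (y : ℕ) (l : List Bool) :
    l.foldr (fun b s => Nat.bit false s + bif b then y else 0) 0 = ofBits l * y := by
  induction l with
  | nil => simp
  | cons b l ih => rw [List.foldr_cons, ih]; cases b <;> simp [Nat.bit_val] <;> ring

@[fun_prop] theorem natMul {f g : γ → ℕ} (hf : PolyTime f) (hg : PolyTime g) :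
    PolyTime fun c => f c * g c := by
  have h := foldr hf.natBits (const 0)
    (f := fun c b s => Nat.bit false s + bif b then g c else 0)
    (PolyTime.natAdd (by fun_prop) (cond (by fun_prop)
      (hg.comp (f := fun p : γ × Bool × ℕ => p.1) (by fun_prop)) (by fun_prop)))
    (fun c => 4 * (tsize (f c) + tsize (g c)) + 1)
    (((PolyBdd.const 4).mul (hf.1.add hg.1)).add (.const 1)) fun c l₁ hl₁ => by
      rw [foldr_mul]
      refine (tsize_nat_le _).trans ?_
      have h₁ := size_mul_le (ofBits l₁) (g c)
      have h₂ := Nat.size_le.2 (ofBits_lt l₁)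
      have h₃ := hl₁.length_le.trans (length_le_tsize _)
      have h₄ := size_le_tsize (g c)
      rw [tsize_bits] at h₃
      omega
  simpa only [foldr_mul, ofBits_bits] using h

/-! ### The binary algorithm for coprimality -/

/-- One step of the binary algorithm for the greatest common divisor, modified so that it stops
with `(0, 0)` if both numbers are even. -/
def gcdStep (s : ℕ × ℕ) : ℕ × ℕ :=
  bif decide (s.1 = 0) || decide (s.2 = 0) then s else
  bif !s.1.bodd && !s.2.bodd then (0, 0) else
  bif !s.1.bodd then (s.1.div2, s.2) else
  bif !s.2.bodd then (s.1, s.2.div2) else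
  bif decide (s.2 ≤ s.1) then ((s.1 - s.2).div2, s.2) else (s.1, (s.2 - s.1).div2)

theorem even_of_bodd_false {n : ℕ} (h : n.bodd = false) : n = 2 * n.div2 := by
  have := Nat.bodd_add_div2 n; rw [h] at this; simp at this; omega

/-- A factor `2` can be dropped from one number when the other is odd. The difference of two odd
numbers is even and is halved at once. If both numbers are even, neither they nor `(0, 0)` are
coprime. -/
theorem coprime_gcdStep (s : ℕ × ℕ) :
    (gcdStep s).1.Coprime (gcdStep s).2 ↔ s.1.Coprime s.2 := by
  obtain ⟨a, b⟩ := s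
  have hodd : ∀ {n : ℕ}, n.bodd = true → Nat.Coprime 2 n := fun {n} h => by
    have := Nat.bodd_add_div2 n
    rw [h] at this
    exact (Nat.coprime_two_left).2 ⟨n.div2, by simp at this; omega⟩
  have h2 : ∀ {m n : ℕ}, n.bodd = true → (Nat.Coprime (2 * m) n ↔ Nat.Coprime m n) :=
    fun h => by rw [Nat.coprime_mul_iff_left]; exact and_iff_right (hodd h)
  unfold gcdStep
  dsimp only
  by_cases h0 : a = 0 ∨ b = 0
  · simp [← Bool.decide_or, h0]
  have h0' : (decide (a = 0) || decide (b = 0)) = false := by simpa using h0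
  rw [h0', cond_false]
  cases ha : a.bodd <;> cases hb : b.bodd
  · simp only [Bool.not_false, Bool.and_self, cond_true]
    rw [even_of_bodd_false ha, even_of_bodd_false hb]
    simp [Nat.coprime_mul_iff_left]
  · simp only [Bool.not_false, Bool.not_true, Bool.and_false, cond_true, cond_false]
    conv_rhs => rw [even_of_bodd_false ha]
    exact (h2 hb).symm
  · simp only [Bool.not_false, Bool.not_true, Bool.and_true, cond_true, cond_false]
    conv_rhs => rw [even_of_bodd_false hb]
    exact (Nat.coprime_comm.trans (h2 ha).symm).trans Nat.coprime_comm
  · simp only [Bool.not_true, Bool.and_self, cond_false]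
    by_cases hle : b ≤ a
    · have he : (a - b).bodd = false := by
        have h := Nat.bodd_add (a - b) b
        rw [Nat.sub_add_cancel hle, ha, hb] at h
        simpa using h
      simp only [hle, decide_true, cond_true]
      rw [← h2 hb, ← even_of_bodd_false he, Nat.coprime_sub_self_left hle]
    · have hle' : a ≤ b := by omega
      have he : (b - a).bodd = false := by
        have h := Nat.bodd_add (b - a) a
        rw [Nat.sub_add_cancel hle', ha, hb] at h
        simpa using h
      simp only [hle, decide_false, cond_false]
      refine Nat.coprime_comm.trans (Iff.trans ?_ Nat.coprime_comm)
      rw [← h2 ha, ← even_of_bodd_false he, Nat.coprime_sub_self_left hle']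

theorem gcdStep_le (s : ℕ × ℕ) : (gcdStep s).1 ≤ s.1 ∧ (gcdStep s).2 ≤ s.2 := by
  have hd : ∀ n : ℕ, n.div2 ≤ n := fun n => by rw [Nat.div2_val]; omega
  obtain ⟨a, b⟩ := s
  have h₁ := hd a
  have h₂ := hd b
  have h₃ := hd (a - b)
  have h₄ := hd (b - a)
  unfold gcdStep
  dsimp only
  simp only [Bool.cond_eq_ite]
  split_ifs <;> simp <;> omega

theorem size_div2_lt {m n : ℕ} (h : m ≤ n) (hn : n ≠ 0) : m.div2.size < n.size := by
  have h₁ : m.div2 ≤ n.div2 := by rw [Nat.div2_val, Nat.div2_val]; omega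
  refine (Nat.size_le_size h₁).trans_lt ?_
  have h₂ := Nat.size_bit (b := n.bodd) (n := n.div2) (by rwa [Nat.bit_bodd_div2])
  rw [Nat.bit_bodd_div2] at h₂
  omega

/-- Each step removes at least one binary digit in total, so linearly many rounds suffice. -/
theorem size_gcdStep (s : ℕ × ℕ) (h₁ : s.1 ≠ 0) (h₂ : s.2 ≠ 0) :
    (gcdStep s).1.size + (gcdStep s).2.size < s.1.size + s.2.size := by
  obtain ⟨a, b⟩ := s
  dsimp only at h₁ h₂
  have ha := size_div2_lt le_rfl h₁
  have hb := size_div2_lt le_rfl h₂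
  have hab := size_div2_lt (Nat.sub_le a b) h₁
  have hba := size_div2_lt (Nat.sub_le b a) h₂
  unfold gcdStep
  dsimp only
  simp only [Bool.cond_eq_ite]
  split_ifs with h
  · simp [h₁, h₂] at h
  all_goals (simp only [Nat.size_zero]; omega)

/-- A pair with a zero entry is a fixed point, and it is coprime exactly if its sum is `1`. Any
other pair loses a digit and keeps its coprimality, so a fixed point is reached within `l.length`
rounds. -/
theorem foldl_gcdStep {σ : Type*} (l : List σ) : ∀ s : ℕ × ℕ, s.1.size + s.2.size ≤ l.length →
    ((l.foldl (fun s _ => gcdStep s) s).1 + (l.foldl (fun s _ => gcdStep s) s).2 = 1 ↔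
      s.1.Coprime s.2) := by
  have hz : ∀ s : ℕ × ℕ, (s.1 = 0 ∨ s.2 = 0) → (s.1 + s.2 = 1 ↔ s.1.Coprime s.2) := by
    rintro ⟨a, b⟩ (rfl | rfl : a = 0 ∨ b = 0) <;> simp
  induction l with
  | nil =>
    intro s hs
    refine hz s (Or.inl ?_)
    simp at hs
    exact Nat.size_eq_zero.1 hs.1
  | cons x l ih =>
    intro s hs
    rw [List.foldl_cons]
    by_cases h : s.1 = 0 ∨ s.2 = 0
    · have h' : gcdStep s = s := by unfold gcdStep; simp [← Bool.decide_or, h]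
      rw [h']
      have key : ∀ l : List σ, l.foldl (fun s _ => gcdStep s) s = s := by
        intro l
        induction l with
        | nil => rfl
        | cons y l ihl => rw [List.foldl_cons, h', ihl]
      rw [key]
      exact hz s h
    · push Not at h
      rw [ih _ (by have := size_gcdStep s h.1 h.2; simp at hs; omega), coprime_gcdStep]

theorem natCoprime {f g : γ → ℕ} (hf : PolyTime f) (hg : PolyTime g) :
    PolyTime fun c => decide ((f c).Coprime (g c)) := by
  have hs : PolyTime fun p : γ × (ℕ × ℕ) × Bool => gcdStep p.2.1 := by
    unfold gcdStep; fun_prop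
  -- The digits of both numbers serve only as a counter of rounds.
  have h := foldl (hf.natBits.append hg.natBits) (hf.prodMk hg)
    (f := fun _ s _ => gcdStep s) hs
    (fun c => 4 * (tsize (f c) + tsize (g c)) + 3)
    (((PolyBdd.const 4).mul (hf.1.add hg.1)).add (.const 3)) fun c l₁ _ => by
      have key : ∀ (l : List Bool) (s : ℕ × ℕ), (l.foldl (fun s _ => gcdStep s) s).1 ≤ s.1 ∧
          (l.foldl (fun s _ => gcdStep s) s).2 ≤ s.2 := by
        intro l
        induction l with
        | nil => intro s; simp
        | cons x l ih =>
          intro s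
          exact ⟨(ih _).1.trans (gcdStep_le s).1, (ih _).2.trans (gcdStep_le s).2⟩
      have h₁ := key l₁ (f c, g c)
      have h₂ := Nat.size_le_size h₁.1
      have h₃ := Nat.size_le_size h₁.2
      have h₄ := size_le_tsize (f c)
      have h₅ := size_le_tsize (g c)
      rw [tsize_pair]
      have h₆ := tsize_nat_le (l₁.foldl (fun s _ => gcdStep s) (f c, g c)).1
      have h₇ := tsize_nat_le (l₁.foldl (fun s _ => gcdStep s) (f c, g c)).2
      dsimp only at *
      omega
  have h' := (h.fst.natAdd h.snd).natEq (const 1)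
  refine Eq.mp (congrArg PolyTime ?_) h'
  funext c
  congr 1
  exact propext (foldl_gcdStep _ _ (by simp [Nat.size_eq_bits_len]))

end PolyTime

/-! ### Integers -/

instance : TreeEnc ℤ := ⟨fun z => enc (z.toNat, (-z).toNat)⟩

theorem tcode_int (z : ℤ) : tcode z = tcode (z.toNat, (-z).toNat) := rfl

namespace PolyTime

variable {γ : Type*} [TreeEnc γ]

theorem intToNat {f : γ → ℤ} (hf : PolyTime f) : PolyTime fun c => ((f c).toNat, (-f c).toNat) :=
  hf.congr_tcode fun _ => rfl

-- The positive and the negative part of a difference are the two truncated differences.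
@[fun_prop] theorem natSubNat {f g : γ → ℕ} (hf : PolyTime f) (hg : PolyTime g) :
    PolyTime fun c => (f c : ℤ) - (g c : ℤ) :=
  ((hf.natSub hg).prodMk (hg.natSub hf)).congr_tcode fun c => by
    rw [tcode_int]
    congr 2 <;> omega

theorem intAdd : PolyTime fun p : ℤ × ℤ => p.1 + p.2 := by
  have h₁ := intToNat (fst' (α := ℤ) (β := ℤ))
  have h₂ := intToNat (snd' (α := ℤ) (β := ℤ))
  refine Eq.mp (congrArg PolyTime ?_) ((h₁.fst.natAdd h₂.fst).natSubNat (h₁.snd.natAdd h₂.snd))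
  funext p
  push_cast
  omega

theorem intMul : PolyTime fun p : ℤ × ℤ => p.1 * p.2 := by
  have h₁ := intToNat (fst' (α := ℤ) (β := ℤ))
  have h₂ := intToNat (snd' (α := ℤ) (β := ℤ))
  refine Eq.mp (congrArg PolyTime ?_)
    (((h₁.fst.natMul h₂.fst).natAdd (h₁.snd.natMul h₂.snd)).natSubNat
      ((h₁.fst.natMul h₂.snd).natAdd (h₁.snd.natMul h₂.fst)))
  funext p
  have e : ∀ z : ℤ, z = (z.toNat : ℤ) - ((-z).toNat : ℤ) := fun z => by omega
  conv_rhs => rw [e p.1, e p.2]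
  push_cast
  ring

@[fun_prop] theorem intEqZero {f : γ → ℤ} (hf : PolyTime f) : PolyTime fun c => decide (f c = 0) := by
  have h := hf.intToNat
  refine Eq.mp (congrArg PolyTime ?_) ((h.fst.natEq (const 0)).and (h.snd.natEq (const 0)))
  funext c
  rw [← Bool.decide_and]
  exact decide_eq_decide.2 (by dsimp only; omega)

end PolyTime

/-! ### Rings with polynomial-time arithmetic -/

/-- Commutative rings whose operations are computable in polynomial time, with a measure `nm` of the
sizes of the elements that grows slowly along computations. -/
class PolyRing (R : Type*) [CommRing R] [TreeEnc R] where
  nm : R → ℕ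
  add_polyTime : PolyTime fun p : R × R => p.1 + p.2
  mul_polyTime : PolyTime fun p : R × R => p.1 * p.2
  -- The constant enters only in the comparison with the code length. The growth laws of `nm` are
  -- free of such factors, so nothing is compounded along a loop.
  factor : ℕ
  tsize_le : ∀ a : R, tsize a ≤ factor * nm a + factor
  nm_le : ∀ a : R, nm a ≤ tsize a
  nm_add : ∀ a b : R, nm (a + b) ≤ max (nm a) (nm b) + 1
  nm_mul : ∀ a b : R, nm (a * b) ≤ nm a + nm b
  nm_zero : nm (0 : R) ≤ 1
  nm_one : nm (1 : R) ≤ 1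

open PolyRing (nm)

theorem natAbs_size_le (z : ℤ) : z.natAbs.size ≤ tsize z := by
  have h : tsize z = tsize (z.toNat, (-z).toNat) := rfl
  rw [h, tsize_pair]
  have h₁ := size_le_tsize z.toNat
  have h₂ := size_le_tsize (-z).toNat
  rcases le_total 0 z with hz | hz
  · rw [show z.natAbs = z.toNat by omega]; dsimp only; omega
  · rw [show z.natAbs = (-z).toNat by omega]; dsimp only; omega

instance : PolyRing ℤ where
  nm z := z.natAbs.size
  add_polyTime := PolyTime.intAdd
  mul_polyTime := PolyTime.intMul
  factor := 8
  tsize_le z := by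
    have h : tsize z = tsize (z.toNat, (-z).toNat) := rfl
    rw [h, tsize_pair]
    have h₁ := tsize_nat_le z.toNat
    have h₂ := tsize_nat_le (-z).toNat
    have h₃ := Nat.size_le_size (show z.toNat ≤ z.natAbs by omega)
    have h₄ := Nat.size_le_size (show (-z).toNat ≤ z.natAbs by omega)
    dsimp only
    omega
  nm_le := natAbs_size_le
  nm_add a b := (Nat.size_le_size (Int.natAbs_add_le a b)).trans (PolyTime.size_add_le _ _)
  nm_mul a b := by rw [Int.natAbs_mul]; exact PolyTime.size_mul_le _ _
  nm_zero := by simp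
  nm_one := by simp

/-- The arithmetic of a finite ring is a finite table. -/
@[reducible] noncomputable def finPolyRing (K : Type*) [CommRing K] [Finite K] :
    @PolyRing K _ (finTreeEnc K) :=
  letI := finTreeEnc K
  haveI := finTreeEnc_injective K
  -- All codes have one length, which is absorbed in `factor`.
  { nm := fun _ => 0
    add_polyTime := PolyTime.of_finite _
    mul_polyTime := PolyTime.of_finite _
    factor := 2 * Nat.card K + 3
    tsize_le := fun a => by rw [tsize_finTreeEnc]; omega
    nm_le := fun _ => Nat.zero_le _
    nm_add := fun _ _ => by simp
    nm_mul := fun _ _ => by simp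
    nm_zero := by simp
    nm_one := by simp }

section PolyRing

variable {R γ : Type*} [CommRing R] [TreeEnc R] [PolyRing R] [TreeEnc γ]

@[fun_prop] theorem PolyTime.ringAdd {f g : γ → R} (hf : PolyTime f) (hg : PolyTime g) :
    PolyTime fun c => f c + g c := PolyRing.add_polyTime.comp (hf.prodMk hg)

@[fun_prop] theorem PolyTime.ringMul {f g : γ → R} (hf : PolyTime f) (hg : PolyTime g) :
    PolyTime fun c => f c * g c := PolyRing.mul_polyTime.comp (hf.prodMk hg)

theorem tsize_list_le_of_nm {l : List R} {B : ℕ} (h : ∀ a ∈ l, nm a ≤ B) :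
    tsize l ≤ l.length * (PolyRing.factor R * (B + 1) + 1) + 1 := by
  induction l with
  | nil => simp
  | cons a l ih =>
    have h₁ := ih fun b hb => h b (List.mem_cons_of_mem _ hb)
    have h₂ := PolyRing.tsize_le a
    have h₃ := Nat.mul_le_mul_left (PolyRing.factor R) (h a List.mem_cons_self)
    simp only [tsize_cons, List.length_cons, Nat.add_mul, Nat.mul_add] at *
    omega

theorem nm_le_of_mem {l : List R} {a : R} (h : a ∈ l) : nm a ≤ tsize l :=
  (PolyRing.nm_le a).trans (PolyTime.tsize_le_of_mem h)

end PolyRing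

/-! ### Right-linear straight-line programs -/

/-- Instructions of straight-line programs: `(some x, _)` multiplies the last value by the variable
`x`; `(none, a, k, b)` forms the linear combination of the last value and the value before the last
`k` ones with coefficients `a` and `b`. Counters are in unary. -/
abbrev Instr (R : Type*) := Option ℕ × R × List Unit × R

/-- The element with a given distance to the top of a list. -/
def nth {V : Type*} (d : V) (H : List V) (k : List Unit) : V := (H.drop k.length).head?.getD d

/-- One step of a straight-line program on the list of values computed before, the last one first.
-/
def slpStep {R V : Type*} (X : ℕ → V → V) (L : R → V → R → V → V) (d : V) (i : Instr R)
    (H : List V) : List V :=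
  i.1.elim (L i.2.1 (nth d H []) i.2.2.2 (nth d H i.2.2.1)) (fun x => X x (nth d H [])) :: H

/-- Run a straight-line program. Programs are written in reverse order. -/
def slpRun {R V : Type*} (X : ℕ → V → V) (L : R → V → R → V → V) (d : V) (p : List (Instr R))
    (H : List V) : List V :=
  p.foldr (slpStep X L d) H

/-- A linear combination. -/
def lin {R : Type*} [CommRing R] (a u b v : R) : R := a * u + b * v

/-- A linear combination of vectors. -/
def linVec {R : Type*} [CommRing R] (a : R) (u : List R) (b : R) (v : List R) : List R :=
  List.zipWith (fun s t => lin a s b t) u v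

/-- From the values of a functional `ψ` at the polynomials computed by a straight-line program,
compute those of the functional that vanishes on the products `f * y` with variables `y ≠ x`, has
the value `ψ f` on `f * x`, and the value `s` on `1`. -/
def nextVec {R : Type*} [CommRing R] (x : ℕ) (s : R) (p : List (Instr R)) (v : List R) : List R :=
  (p.zip v.tail).foldr (fun q H => slpStep (fun y _ => bif decide (y = x) then q.2 else 0) lin 0 q.1 H)
    [s]

/-- The zero vector. -/
def zeroVec {R : Type*} [CommRing R] (p : List (Instr R)) : List R := 0 :: p.map fun _ => 0

/-- The rows of the Gram matrix of the polynomials computed by a straight-line program. -/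
def gram {R : Type*} [CommRing R] (p : List (Instr R)) : List (List R) :=
  slpRun (fun x v => nextVec x 0 p v) linVec (zeroVec p) p [nextVec 0 1 p (zeroVec p)]

namespace PolyTime

variable {R V α γ : Type*} [CommRing R] [TreeEnc R] [PolyRing R] [TreeEnc γ] [TreeEnc α] [TreeEnc V]

@[fun_prop] theorem nth' {d : γ → α} {H : γ → List α} {k : γ → List Unit} (hd : PolyTime d)
    (hH : PolyTime H) (hk : PolyTime k) : PolyTime fun c => nth (d c) (H c) (k c) := by
  unfold nth; fun_prop

@[fun_prop] theorem lin' {a u b v : γ → R} (ha : PolyTime a) (hu : PolyTime u) (hb : PolyTime b)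
    (hv : PolyTime v) : PolyTime fun c => lin (a c) (u c) (b c) (v c) := by
  unfold lin; fun_prop

@[fun_prop] theorem linVec' {a b : γ → R} {u v : γ → List R} (ha : PolyTime a) (hu : PolyTime u)
    (hb : PolyTime b) (hv : PolyTime v) : PolyTime fun c => linVec (a c) (u c) (b c) (v c) := by
  unfold linVec; fun_prop

@[fun_prop] theorem zeroVec' {p : γ → List (Instr R)} (hp : PolyTime p) :
    PolyTime fun c => zeroVec (p c) := by
  unfold zeroVec; fun_prop

end PolyTime

/-! ### Size bounds for the vectors and the Gram matrix of a program. -/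

section Bounds

variable {R γ : Type*} [CommRing R] [TreeEnc R] [PolyRing R] [TreeEnc γ]

theorem nth_mem_or {V : Type*} (d : V) (H : List V) (k : List Unit) :
    nth d H k = d ∨ nth d H k ∈ H := by
  unfold nth
  cases h : (H.drop k.length).head? with
  | none => exact Or.inl rfl
  | some v => exact Or.inr (List.mem_of_mem_drop (List.mem_of_mem_head? h))

theorem nm_lin_le {a u b v : R} {S B : ℕ} (ha : nm a ≤ S) (hu : nm u ≤ B) (hb : nm b ≤ S)
    (hv : nm v ≤ B) : nm (lin a u b v) ≤ S + B + 1 := by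
  have h₁ := PolyRing.nm_add (a * u) (b * v)
  have h₂ := PolyRing.nm_mul a u
  have h₃ := PolyRing.nm_mul b v
  unfold lin
  omega

/-- All coefficients of a program are small. -/
def NmProg (S : ℕ) (p : List (Instr R)) : Prop := ∀ i ∈ p, nm i.2.1 ≤ S ∧ nm i.2.2.2 ≤ S

theorem nmProg_tsize (p : List (Instr R)) : NmProg (tsize p) p := by
  intro i hi
  have h := PolyTime.tsize_le_of_mem hi
  have h₁ := PolyRing.nm_le i.2.1
  have h₂ := PolyRing.nm_le i.2.2.2
  simp only [tsize_pair] at h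
  omega

/-- A linear combination raises the bound by at most `S + 1`; a product with a variable starts
afresh from an entry of the given vector or from zero. -/
theorem nm_nextStep {S W I : ℕ} {x : ℕ} {s : R} (hs : nm s ≤ I) : ∀ {l : List (Instr R × R)},
    (∀ q ∈ l, (nm q.1.2.1 ≤ S ∧ nm q.1.2.2.2 ≤ S) ∧ nm q.2 ≤ W) →
    ∀ a ∈ l.foldr (fun q H => slpStep (fun y _ => bif decide (y = x) then q.2 else 0) lin 0 q.1 H)
      [s], nm a ≤ I + W + 1 + l.length * (S + 1) := by
  intro l
  induction l with
  | nil => intro _ a ha; simp at ha; subst ha; omega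
  | cons q l ih =>
    intro h a ha
    have ih := ih fun q hq => h q (List.mem_cons_of_mem _ hq)
    obtain ⟨⟨h₁, h₂⟩, h₃⟩ := h q List.mem_cons_self
    have hz := PolyRing.nm_zero (R := R)
    rw [List.foldr_cons] at ha
    generalize l.foldr _ [s] = H at *
    have hn : ∀ k, nm (nth (0 : R) H k) ≤ I + W + 1 + l.length * (S + 1) := fun k => by
      rcases nth_mem_or (0 : R) H k with h | h
      · rw [h]; omega
      · exact ih _ h
    simp only [List.length_cons, Nat.add_mul]
    rcases List.mem_cons.1 ha with rfl | ha
    · rcases q.1.1 with _ | y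
      · have := nm_lin_le h₁ (hn []) h₂ (hn q.1.2.2.1)
        simp only [Option.elim_none]
        omega
      · simp only [Option.elim_some]
        cases decide (y = x)
        · rw [cond_false]; omega
        · rw [cond_true]; omega
    · have := ih a ha
      omega

theorem length_nextStep {x : ℕ} {s : R} (l : List (Instr R × R)) :
    (l.foldr (fun q H => slpStep (fun y _ => bif decide (y = x) then q.2 else 0) lin 0 q.1 H)
      [s]).length = l.length + 1 := by
  induction l with
  | nil => rfl
  | cons q l ih => rw [List.foldr_cons]; simpa [slpStep] using ih

theorem mem_zip_tail {p : List (Instr R)} {v : List R} {S W : ℕ} (hp : NmProg S p)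
    (hv : ∀ a ∈ v, nm a ≤ W) : ∀ q ∈ p.zip v.tail,
      (nm q.1.2.1 ≤ S ∧ nm q.1.2.2.2 ≤ S) ∧ nm q.2 ≤ W := by
  rintro ⟨i, a⟩ hq
  have h := List.of_mem_zip hq
  exact ⟨hp i h.1, hv a (List.mem_of_mem_tail h.2)⟩

theorem nm_nextVec {S W I x : ℕ} {s : R} {p : List (Instr R)} {v : List R} (hs : nm s ≤ I)
    (hp : NmProg S p) (hv : ∀ a ∈ v, nm a ≤ W) :
    ∀ a ∈ nextVec x s p v, nm a ≤ I + W + 1 + p.length * (S + 1) := by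
  intro a ha
  refine (nm_nextStep hs (mem_zip_tail hp hv) a ha).trans ?_
  gcongr
  simp

theorem length_nextVec (x : ℕ) (s : R) (p : List (Instr R)) (v : List R) :
    (nextVec x s p v).length = (p.zip v.tail).length + 1 :=
  length_nextStep _

@[fun_prop] theorem PolyTime.nextVec' {x : γ → ℕ} {s : γ → R} {p : γ → List (Instr R)}
    {v : γ → List R} (hx : PolyTime x) (hs : PolyTime s) (hp : PolyTime p) (hv : PolyTime v) :
    PolyTime fun c => nextVec (x c) (s c) (p c) (v c) := by
  let Z : γ → ℕ := fun c => tsize (s c) + tsize (v c) + 1 + tsize (p c) * (tsize (p c) + 1)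
  have hZ : PolyBdd Z := ((hs.1.add hv.1).add (.const 1)).add (hp.1.mul (hp.1.add (.const 1)))
  refine foldr (hp.zip hv.tail) (hs.cons (const [])) (f := fun c q H =>
    slpStep (fun y _ => bif decide (y = x c) then q.2 else 0) lin 0 q.1 H)
    (by unfold slpStep; fun_prop)
    (fun c => (tsize (p c) + 1) * (PolyRing.factor R * (Z c + 1) + 1) + 1)
    (((hp.1.add (.const 1)).mul (((PolyBdd.const _).mul (hZ.add (.const 1))).add
      (.const 1))).add (.const 1)) fun c l₁ hl₁ => ?_
  have hlen : l₁.length ≤ tsize (p c) := by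
    refine hl₁.length_le.trans (le_trans ?_ (length_le_tsize (p c)))
    simp
  refine (tsize_list_le_of_nm (B := Z c) fun a ha => ?_).trans ?_
  · refine (nm_nextStep (S := tsize (p c)) (W := tsize (v c)) (PolyRing.nm_le (s c))
      (fun q hq => mem_zip_tail (nmProg_tsize (p c)) (fun a ha => nm_le_of_mem ha) q
        (hl₁.subset hq)) a ha).trans ?_
    dsimp only [Z]
    gcongr
  · rw [length_nextStep]
    gcongr

theorem nm_linVec_le {a b : R} {u v : List R} {S B : ℕ} (ha : nm a ≤ S) (hu : ∀ s ∈ u, nm s ≤ B)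
    (hb : nm b ≤ S) (hv : ∀ s ∈ v, nm s ≤ B) : ∀ s ∈ linVec a u b v, nm s ≤ S + B + 1 := by
  intro s hs
  unfold linVec at hs
  rw [show List.zipWith (fun s t => lin a s b t) u v = (u.zip v).map fun q => lin a q.1 b q.2 by
    rw [List.zip, List.map_zipWith]] at hs
  obtain ⟨q, hq, rfl⟩ := List.mem_map.1 hs
  have h := List.of_mem_zip hq
  exact nm_lin_le ha (hu _ h.1) hb (hv _ h.2)

/-- Obtaining a row from earlier rows adds a fixed amount to the sizes of the entries, so the bound
grows linearly with the number of rows and not geometrically. -/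
theorem gram_bounds {S : ℕ} {p : List (Instr R)} (hp : NmProg S p) : ∀ {l : List (Instr R)},
    NmProg S l → ∀ v ∈ slpRun (fun x v => nextVec x 0 p v) linVec (zeroVec p) l
      [nextVec 0 1 p (zeroVec p)],
      v.length ≤ p.length + 1 ∧ ∀ a ∈ v, nm a ≤ (l.length + 1) * (3 + (p.length + 1) * (S + 1)) := by
  have hz : ∀ a ∈ zeroVec p, nm a ≤ 1 := by
    intro a ha
    have := PolyRing.nm_zero (R := R)
    simp only [zeroVec, List.mem_cons, List.mem_map] at ha
    rcases ha with rfl | ⟨_, _, rfl⟩ <;> exact this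
  have hn : ∀ x (s : R) v, (nextVec x s p v).length ≤ p.length + 1 := fun x s v => by
    rw [length_nextVec]; simp
  intro l
  induction l with
  | nil =>
    intro _ v hv
    simp only [slpRun, List.foldr_nil, List.mem_singleton] at hv
    subst hv
    refine ⟨hn _ _ _, fun a ha => (nm_nextVec PolyRing.nm_one hp hz a ha).trans ?_⟩
    simp only [List.length_nil, Nat.add_mul]
    omega
  | cons i l ih =>
    intro hl v hv
    have ih := ih fun i hi => hl i (List.mem_cons_of_mem _ hi)
    obtain ⟨h₁, h₂⟩ := hl i List.mem_cons_self
    simp only [slpRun, List.foldr_cons] at hv ih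
    generalize l.foldr _ _ = H at *
    have hk : ∀ k, (nth (zeroVec p) H k).length ≤ p.length + 1 ∧ ∀ a ∈ nth (zeroVec p) H k,
        nm a ≤ (l.length + 1) * (3 + (p.length + 1) * (S + 1)) := fun k => by
      rcases nth_mem_or (zeroVec p) H k with h | h
      · rw [h]
        refine ⟨by simp [zeroVec], fun a ha => (hz a ha).trans ?_⟩
        exact Nat.mul_pos (Nat.succ_pos _) (by omega)
      · exact ih _ h
    rw [List.length_cons, Nat.add_mul (l.length + 1)]
    generalize (l.length + 1) * (3 + (p.length + 1) * (S + 1)) = Q at *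
    rcases List.mem_cons.1 hv with rfl | hv
    · rcases i.1 with _ | y
      · simp only [Option.elim_none]
        refine ⟨?_, fun a ha => (nm_linVec_le h₁ (hk []).2 h₂ (hk i.2.2.1).2 a ha).trans ?_⟩
        · simp only [linVec, List.length_zipWith]
          have := (hk []).1
          omega
        · simp only [Nat.add_mul]; omega
      · simp only [Option.elim_some]
        refine ⟨hn _ _ _, fun a ha => (nm_nextVec PolyRing.nm_zero hp (hk []).2 a ha).trans ?_⟩
        simp only [Nat.add_mul]; omega
    · exact ⟨(ih v hv).1, fun a ha => ((ih v hv).2 a ha).trans (by omega)⟩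

theorem slpRun_length {R V : Type*} (X : ℕ → V → V) (L : R → V → R → V → V) (d : V)
    (p : List (Instr R)) (H : List V) : (slpRun X L d p H).length = p.length + H.length := by
  induction p with
  | nil => simp [slpRun]
  | cons i p ih =>
    change (slpRun X L d p H).length + 1 = _
    rw [ih, List.length_cons]
    omega

theorem tsize_list_list_le {α : Type*} [TreeEnc α] {l : List α} {B : ℕ} (h : ∀ a ∈ l, tsize a ≤ B) :
    tsize l ≤ l.length * (B + 1) + 1 := by
  induction l with
  | nil => simp
  | cons a l ih =>
    have h₁ := ih fun b hb => h b (List.mem_cons_of_mem _ hb)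
    have h₃ := h a List.mem_cons_self
    simp only [tsize_cons, List.length_cons, Nat.add_mul] at *
    omega

theorem gram_polyTime : PolyTime fun p : List (Instr R) => gram p := by
  let Q : List (Instr R) → ℕ := fun p => (tsize p + 1) * (3 + (tsize p + 1) * (tsize p + 1))
  have h1 : PolyBdd fun p : List (Instr R) => tsize p + 1 := PolyBdd.size.add (.const 1)
  have hQ : PolyBdd Q := h1.mul ((PolyBdd.const 3).add (h1.mul h1))
  let Q' : List (Instr R) → ℕ := fun p =>
    (tsize p + 1) * (PolyRing.factor R * (Q p + 1) + 1) + 1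
  have hQ' : PolyBdd Q' :=
    (h1.mul (((PolyBdd.const _).mul (hQ.add (.const 1))).add (.const 1))).add (.const 1)
  refine PolyTime.foldr (l := fun p : List (Instr R) => p) PolyTime.id'
    (s := fun p => [nextVec 0 1 p (zeroVec p)]) (by fun_prop)
    (f := fun p => slpStep (fun x v => nextVec x 0 p v) linVec (zeroVec p))
    (by unfold slpStep; fun_prop) (fun p => (tsize p + 1) * (Q' p + 1) + 1)
    ((h1.mul (hQ'.add (.const 1))).add (.const 1)) fun p l₁ hl₁ => ?_
  have hlen := hl₁.length_le.trans (PolyTime.length_le_tsize p)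
  have hplen := PolyTime.length_le_tsize p
  have hb := gram_bounds (nmProg_tsize p) (l := l₁) fun i hi => nmProg_tsize p i (hl₁.subset hi)
  refine (tsize_list_list_le (B := Q' p) fun v hv => ?_).trans ?_
  · obtain ⟨hv₁, hv₂⟩ := hb v hv
    refine (tsize_list_le_of_nm (B := Q p) fun a ha => (hv₂ a ha).trans ?_).trans ?_
    · dsimp only [Q]; gcongr
    · dsimp only [Q']; gcongr; omega
  · have := slpRun_length (fun x v => nextVec x 0 p v) linVec (zeroVec p) l₁
      [nextVec 0 1 p (zeroVec p)]
    unfold slpRun at this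
    rw [this]
    gcongr
    simp

end Bounds

/-! ### Non-commutative polynomials and functionals on them -/

section Functionals

variable {K : Type*} [Field K]

/-- The monomials. -/
noncomputable abbrev monoBasis (K : Type*) [Field K] :
    Module.Basis (FreeMonoid ℕ) K (FreeAlgebra K ℕ) := FreeAlgebra.basisFreeMonoid K ℕ

theorem monoBasis_eq (w : FreeMonoid ℕ) :
    monoBasis K w = FreeMonoid.lift (FreeAlgebra.ι K) w := by
  simp [monoBasis, FreeAlgebra.basisFreeMonoid, FreeAlgebra.equivMonoidAlgebraFreeMonoid]

theorem monoBasis_one : monoBasis K 1 = 1 := by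
  rw [monoBasis_eq, map_one]

theorem monoBasis_mul_of (w : FreeMonoid ℕ) (y : ℕ) :
    monoBasis K (w * FreeMonoid.of y) = monoBasis K w * FreeAlgebra.ι K y := by
  rw [monoBasis_eq, monoBasis_eq, map_mul, FreeMonoid.lift_eval_of]

/-- The linear map dividing by the variable `x` from the right. -/
noncomputable def rightDiv (x : ℕ) : FreeAlgebra K ℕ →ₗ[K] FreeAlgebra K ℕ :=
  (monoBasis K).constr K fun w => match w.toList.reverse with
    | [] => 0
    | y :: r => if y = x then monoBasis K (FreeMonoid.ofList r.reverse) else 0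

theorem rightDiv_one (x : ℕ) : rightDiv (K := K) x 1 = 0 := by
  rw [← monoBasis_one, rightDiv, Module.Basis.constr_basis]
  rfl

theorem rightDiv_mul (x y : ℕ) (f : FreeAlgebra K ℕ) :
    rightDiv x (f * FreeAlgebra.ι K y) = if y = x then f else 0 := by
  have h : (rightDiv x ∘ₗ LinearMap.mulRight K (FreeAlgebra.ι K y)) =
      if y = x then LinearMap.id else 0 := by
    refine (monoBasis K).ext fun w => ?_
    simp only [LinearMap.comp_apply, LinearMap.mulRight_apply, ← monoBasis_mul_of]
    rw [rightDiv, Module.Basis.constr_basis]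
    simp only [FreeMonoid.toList_mul, FreeMonoid.toList_of, List.reverse_append,
      List.reverse_singleton, List.singleton_append, List.reverse_reverse, FreeMonoid.ofList_toList]
    split_ifs <;> rfl
  have := LinearMap.congr_fun h f
  simp only [LinearMap.comp_apply, LinearMap.mulRight_apply] at this
  rw [this]
  split_ifs <;> rfl

theorem freeMonoid_cases (u : FreeMonoid ℕ) : u = 1 ∨ ∃ r z, u = r * FreeMonoid.of z := by
  rcases List.eq_nil_or_concat' u.toList with h | ⟨l, z, h⟩
  · exact Or.inl h
  · exact Or.inr ⟨FreeMonoid.ofList l, z, h⟩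

/-- The coefficient of a monomial. -/
noncomputable abbrev coeffAt (w : FreeMonoid ℕ) : FreeAlgebra K ℕ →ₗ[K] K := (monoBasis K).coord w

/-- Repeating this peels off a word letter by letter: every coefficient functional is `coeffAt 1`
composed with right divisions, which is the form that `nextVec` can handle. -/
theorem coeffAt_mul_of (w : FreeMonoid ℕ) (x : ℕ) :
    coeffAt (K := K) (w * FreeMonoid.of x) = coeffAt w ∘ₗ rightDiv x := by
  refine (monoBasis K).ext fun u => ?_
  rcases freeMonoid_cases u with rfl | ⟨r, z, rfl⟩
  · have h : (1 : FreeMonoid ℕ) ≠ w * FreeMonoid.of x := fun h => by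
      have := congrArg (fun v => v.toList.length) h
      simp at this
    rw [LinearMap.comp_apply, monoBasis_one, rightDiv_one, map_zero, ← monoBasis_one]
    simp [Module.Basis.coord_apply]
  · rw [LinearMap.comp_apply, monoBasis_mul_of, rightDiv_mul, ← monoBasis_mul_of]
    have h : r * FreeMonoid.of z = w * FreeMonoid.of x ↔ r = w ∧ z = x := by
      rw [← FreeMonoid.toList.injective.eq_iff]
      simp
    classical
    rw [coeffAt, Module.Basis.coord_apply, Module.Basis.repr_self, Finsupp.single_apply]
    by_cases hz : z = x
    · rw [if_pos hz, coeffAt, Module.Basis.coord_apply, Module.Basis.repr_self,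
        Finsupp.single_apply]
      exact if_congr (h.trans (and_iff_left hz)) rfl rfl
    · rw [if_neg hz, map_zero, if_neg fun hh => hz (h.1 hh).2]

theorem coeffAt_one_mul (f : FreeAlgebra K ℕ) (y : ℕ) :
    coeffAt 1 (f * FreeAlgebra.ι K y) = 0 := by
  have h : coeffAt (K := K) 1 ∘ₗ LinearMap.mulRight K (FreeAlgebra.ι K y) = 0 := by
    refine (monoBasis K).ext fun u => ?_
    simp only [LinearMap.comp_apply, LinearMap.mulRight_apply, ← monoBasis_mul_of]
    have h : u * FreeMonoid.of y ≠ 1 := fun h => by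
      have := congrArg (fun v => v.toList.length) h
      simp at this
    simp [Module.Basis.coord_apply, h]
  exact LinearMap.congr_fun h f

theorem coeffAt_one_one : coeffAt (K := K) 1 1 = 1 := by
  rw [← monoBasis_one]
  simp [Module.Basis.coord_apply]

/-- The bilinear form for which the monomials are an orthonormal basis. -/
noncomputable def pairing : FreeAlgebra K ℕ →ₗ[K] FreeAlgebra K ℕ →ₗ[K] K :=
  (monoBasis K).constr K fun w => coeffAt w

theorem pairing_one : pairing (K := K) 1 = coeffAt 1 := by
  rw [← monoBasis_one, pairing, Module.Basis.constr_basis]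

/-- Right multiplication by a variable and right division by it are adjoint, as one sees on
monomials. -/
theorem pairing_mul (f : FreeAlgebra K ℕ) (x : ℕ) :
    pairing (f * FreeAlgebra.ι K x) = pairing f ∘ₗ rightDiv x := by
  have h : pairing ∘ₗ LinearMap.mulRight K (FreeAlgebra.ι K x) =
      LinearMap.lcomp K K (rightDiv (K := K) x) ∘ₗ pairing := by
    refine (monoBasis K).ext fun w => ?_
    simp only [LinearMap.comp_apply, LinearMap.mulRight_apply, ← monoBasis_mul_of]
    rw [pairing, Module.Basis.constr_basis, Module.Basis.constr_basis, coeffAt_mul_of]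
    rfl
  exact LinearMap.congr_fun h f

/-- The value is the sum of the squares of the coefficients; the order of the field excludes
cancellation. -/
theorem pairing_self_eq_zero {K : Type*} [Field K] [LinearOrder K] [IsStrictOrderedRing K]
    {f : FreeAlgebra K ℕ} (h : pairing f f = 0) : f = 0 := by
  rw [pairing, Module.Basis.constr_apply, Finsupp.sum, LinearMap.sum_apply] at h
  simp only [LinearMap.smul_apply, Module.Basis.coord_apply, smul_eq_mul] at h
  rw [Finset.sum_eq_zero_iff_of_nonneg fun w _ => mul_self_nonneg _] at h
  refine (monoBasis K).repr.map_eq_zero_iff.1 (Finsupp.ext fun w => ?_)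
  by_contra hw
  exact hw (mul_self_eq_zero.1 (h w (Finsupp.mem_support_iff.2 hw)))

end Functionals

/-! ### Polynomials computed by straight-line programs, and the zero test over ordered fields. -/

section Semantics

variable {R K : Type*} [CommRing R] [Field K] [Algebra R K]

/-- Linear combinations of polynomials with coefficients in a subring. -/
noncomputable def polyLin (a : R) (f : FreeAlgebra K ℕ) (b : R) (g : FreeAlgebra K ℕ) :
    FreeAlgebra K ℕ :=
  algebraMap R K a • f + algebraMap R K b • g

/-- The polynomials computed by a straight-line program, starting from the polynomials `H`. -/
noncomputable def polyRun (p : List (Instr R)) (H : List (FreeAlgebra K ℕ)) :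
    List (FreeAlgebra K ℕ) :=
  slpRun (fun y f => f * FreeAlgebra.ι K y) polyLin 0 p H

theorem nth_map {V W : Type*} (φ : V → W) {d : V} {e : W} (h : φ d = e) (H : List V)
    (k : List Unit) : nth e (H.map φ) k = φ (nth d H k) := by
  unfold nth
  rw [← List.map_drop, List.head?_map]
  cases (H.drop k.length).head? <;> simp [h]

/-- Products in a program are by single variables on the right, where `ψ'` is given by `ψ`; sums are
covered by linearity. Hence the values of `ψ'` follow from those of `ψ` in one pass along the
program. -/
theorem map_nextVec {x : ℕ} {s : R} {ψ ψ' : FreeAlgebra K ℕ →ₗ[K] K}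
    (hX : ∀ f y, ψ' (f * FreeAlgebra.ι K y) = if y = x then ψ f else 0)
    (h1 : ψ' 1 = algebraMap R K s) (p : List (Instr R)) : ∀ v : List R,
    v.map (algebraMap R K) = (polyRun p [1]).map ψ →
    (nextVec x s p v).map (algebraMap R K) = (polyRun p [1]).map ψ' := by
  induction p with
  | nil =>
    intro v _
    simp [nextVec, polyRun, slpRun, h1]
  | cons i p ih =>
    intro v hv
    have hrun : polyRun (K := K) (i :: p) [1] =
      slpStep (fun y f => f * FreeAlgebra.ι K y) polyLin 0 i (polyRun p [1]) := rfl
    rcases v with _ | ⟨a, v⟩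
    · simp [hrun, slpStep] at hv
    have hv' : v.map (algebraMap R K) = (polyRun p [1]).map ψ := by
      rw [hrun] at hv
      simpa [slpStep] using (List.cons.inj hv).2
    have hne : (polyRun (K := K) p [1]).length = p.length + 1 := slpRun_length _ _ _ _ _
    rcases v with _ | ⟨b, v⟩
    · have := congrArg List.length hv'
      simp [hne] at this
    -- Values are listed with the last one first, so the head of the tail belongs to the polynomial
    -- that the instruction `i` multiplies.
    have hb : algebraMap R K b = ψ (nth 0 (polyRun p [1]) []) := by
      have := congrArg (fun l => nth 0 l []) hv'
      simp only [nth_map ψ (map_zero ψ)] at this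
      rw [← this]
      rfl
    have ih := ih _ hv'
    have hnext : nextVec x s (i :: p) (a :: b :: v) =
      slpStep (fun y _ => bif decide (y = x) then b else 0) lin 0 i (nextVec x s p (b :: v)) := rfl
    rw [hnext, hrun]
    simp only [slpStep, List.map_cons, ih]
    congr 1
    rcases i.1 with _ | y
    · simp only [Option.elim_none, lin, polyLin, map_add, map_mul, map_smul, smul_eq_mul]
      rw [← nth_map ψ' (map_zero ψ'), ← nth_map ψ' (map_zero ψ'), ← ih,
        nth_map (algebraMap R K) (map_zero _), nth_map (algebraMap R K) (map_zero _)]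
    · simp only [Option.elim_some, hX]
      by_cases hy : y = x <;> simp [hy, hb]

theorem map_nextVec_rightDiv (x : ℕ) (ψ : FreeAlgebra K ℕ →ₗ[K] K) (p : List (Instr R)) (v : List R)
    (h : v.map (algebraMap R K) = (polyRun p [1]).map ψ) :
    (nextVec x 0 p v).map (algebraMap R K) = (polyRun p [1]).map (ψ ∘ₗ rightDiv x) :=
  map_nextVec (fun f y => by
    rw [LinearMap.comp_apply, rightDiv_mul]; split_ifs <;> simp)
    (by rw [LinearMap.comp_apply, rightDiv_one]; simp) p v h

theorem map_zeroVec (p : List (Instr R)) :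
    (zeroVec p).map (algebraMap R K) = (polyRun p [1]).map (0 : FreeAlgebra K ℕ →ₗ[K] K) := by
  have hne : (polyRun (K := K) p [1]).length = p.length + 1 := slpRun_length _ _ _ _ _
  refine List.ext_getElem (by simp [zeroVec, hne]) fun i h₁ h₂ => ?_
  rcases i with _ | i <;> simp [zeroVec]

theorem map_nextVec_zero (p : List (Instr R)) :
    (nextVec 0 1 p (zeroVec p)).map (algebraMap R K) = (polyRun p [1]).map (coeffAt (K := K) 1) :=
  map_nextVec (ψ := 0) (fun f y => by rw [coeffAt_one_mul]; simp)
    (by rw [coeffAt_one_one, map_one]) p _ (map_zeroVec p)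

/-- The assignment of its row to a polynomial is linear and, by `pairing_mul`, turns right
multiplication by `x` into `nextVec x 0`. So running the program on vectors, from the row of `1`,
yields the rows. -/
theorem map_gram (p : List (Instr R)) : (gram p).map (List.map (algebraMap R K)) =
    (polyRun p [1]).map fun f => (polyRun p [1]).map (pairing (K := K) f) := by
  -- The induction is on the program `l` that produces the rows, while `p` fixes the columns.
  have key : ∀ l : List (Instr R), (slpRun (fun x v => nextVec x 0 p v) linVec (zeroVec p) l
      [nextVec 0 1 p (zeroVec p)]).map (List.map (algebraMap R K)) =
      (polyRun l [1]).map fun f => (polyRun p [1]).map (pairing (K := K) f) := by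
    intro l
    induction l with
    | nil => simp [slpRun, polyRun, map_nextVec_zero, pairing_one]
    | cons i l ih =>
      have hrun : polyRun (K := K) (i :: l) [1] =
        slpStep (fun y f => f * FreeAlgebra.ι K y) polyLin 0 i (polyRun l [1]) := rfl
      have hrun' : slpRun (fun x v => nextVec x 0 p v) linVec (zeroVec p) (i :: l)
        [nextVec 0 1 p (zeroVec p)] = slpStep (fun x v => nextVec x 0 p v) linVec (zeroVec p) i
          (slpRun (fun x v => nextVec x 0 p v) linVec (zeroVec p) l
            [nextVec 0 1 p (zeroVec p)]) := rfl
      rw [hrun, hrun']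
      generalize slpRun (fun x v => nextVec x 0 p v) linVec (zeroVec p) l
            [nextVec 0 1 p (zeroVec p)] = G at *
      have hk : ∀ k, (nth (zeroVec p) G k).map (algebraMap R K) =
          (polyRun p [1]).map (pairing (nth 0 (polyRun (K := K) l [1]) k)) := fun k => by
        rw [← nth_map (List.map (algebraMap R K)) (map_zeroVec (K := K) p), ih]
        refine nth_map (fun f => (polyRun p [1]).map (pairing (K := K) f)) ?_ _ _
        rw [map_zero]
      simp only [slpStep, List.map_cons, ih]
      congr 1
      rcases i.1 with _ | y
      · simp only [Option.elim_none, linVec, polyLin]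
        rw [List.map_zipWith]
        have : ∀ u v : List R, List.zipWith (fun s t => algebraMap R K (lin i.2.1 s i.2.2.2 t)) u v
            = List.zipWith (fun s t => algebraMap R K i.2.1 * s + algebraMap R K i.2.2.2 * t)
              (u.map (algebraMap R K)) (v.map (algebraMap R K)) := fun u v => by
          rw [List.zipWith_map]
          simp [lin]
        rw [this, hk, hk, List.zipWith_map, List.zipWith_self]
        refine List.map_congr_left fun f _ => ?_
        rw [map_add, map_smul, map_smul]
        rfl
      · simp only [Option.elim_some, pairing_mul]
        exact map_nextVec_rightDiv _ _ _ _ (hk _)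
  exact key p

/-- The zero test for polynomials over an ordered field: the sum of the squares of the coefficients
vanishes. -/
def gramTest {R : Type*} [CommRing R] [DecidableEq R] (p : List (Instr R)) : Bool :=
  decide (nth 0 (nth [] (gram p) []) [] = 0)

theorem gramTest_iff {R K : Type*} [CommRing R] [DecidableEq R] [Field K] [LinearOrder K]
    [IsStrictOrderedRing K] [Algebra R K] (hinj : Function.Injective (algebraMap R K))
    (p : List (Instr R)) : gramTest p = true ↔ nth 0 (polyRun (K := K) p [1]) [] = 0 := by
  have hne : (polyRun (K := K) p [1]).length = p.length + 1 := slpRun_length _ _ _ _ _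
  have h := map_gram (K := K) p
  have hg : algebraMap R K (nth 0 (nth [] (gram p) []) []) =
      pairing (nth 0 (polyRun (K := K) p [1]) []) (nth 0 (polyRun (K := K) p [1]) []) := by
    rw [← nth_map (algebraMap R K) (map_zero _), ← nth_map (List.map (algebraMap R K)) rfl, h]
    revert hne
    cases polyRun (K := K) p [1] with
    | nil => intro h; simp at h
    | cons f H => intro _; rfl
  rw [gramTest, decide_eq_true_iff, ← map_eq_zero_iff _ hinj, hg]
  exact ⟨pairing_self_eq_zero, fun h => by rw [h]; simp⟩

end Semantics

/-! ### Echelon bases -/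

section Echelon

variable {K : Type*} [Field K]

open Classical in
/-- Reduce the vector `v` by the basis vector `o` (if any) with leading entry `1` at the first
position, or make it the basis vector. The leading entries `1` of the basis vectors are left out. -/
noncomputable def insStep (v : List K) (o : Option (List K)) : List K × Option (List K) :=
  v.head?.elim (v, o) fun a => bif decide (a = 0) then (v.tail, o) else
    -- The empty remainder says that the vector has been absorbed; by `insVec_nil` the later
    -- positions do not change.
    o.elim ([], some (v.tail.map fun b => a⁻¹ * b)) fun b => (linVec 1 v.tail (-a) b, o)

/-- Insert a vector into a basis in echelon form. -/
noncomputable def insVec : List K → List (Option (List K)) → List (Option (List K))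
  | _, [] => []
  | v, o :: os => (insStep v o).2 :: insVec (insStep v o).1 os

/-- The vectors of a basis in echelon form. -/
def vecs : List (Option (List K)) → List (List K)
  | [] => []
  | o :: os => (o.toList.map fun b => 1 :: b) ++ (vecs os).map fun b => 0 :: b

/-- The vectors of a basis in echelon form have the right lengths. -/
def WF : List (Option (List K)) → Prop
  | [] => True
  | o :: os => (∀ b ∈ o, b.length = os.length) ∧ WF os

theorem length_insVec (v : List K) (os : List (Option (List K))) :
    (insVec v os).length = os.length := by
  induction os generalizing v with
  | nil => rfl
  | cons o os ih => simp [insVec, ih]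

theorem insVec_nil (os : List (Option (List K))) : insVec [] os = os := by
  induction os with
  | nil => rfl
  | cons o os ih => simp [insVec, insStep, ih]

theorem insStep_length {v : List K} {o : Option (List K)} {n : ℕ} (hv : v.length = n + 1)
    (ho : ∀ b ∈ o, b.length = n) : ((insStep v o).1.length = n ∨ (insStep v o).1 = []) ∧
      ∀ b ∈ (insStep v o).2, b.length = n := by
  rcases v with _ | ⟨a, v⟩
  · simp at hv
  · simp only [List.length_cons, Nat.add_right_cancel_iff] at hv
    unfold insStep
    by_cases ha : a = 0
    · simpa [ha, hv] using ho
    · rcases o with _ | b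
      · simp [ha, hv]
      · simp only [Option.mem_def, Option.some.injEq, forall_eq'] at ho
        simp [ha, hv, linVec, ho]

theorem WF.insVec {os : List (Option (List K))} (h : WF os) : ∀ {v : List K},
    v.length = os.length ∨ v = [] → WF (insVec v os) := by
  induction os with
  | nil => intro v _; trivial
  | cons o os ih =>
    intro v hv
    rcases hv with hv | rfl
    · have := insStep_length hv h.1
      refine ⟨?_, ih h.2 this.1⟩
      rw [length_insVec]
      exact this.2
    · rwa [insVec_nil]

theorem WF.length_vecs {os : List (Option (List K))} (h : WF os) :
    ∀ v ∈ vecs os, v.length = os.length := by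
  induction os with
  | nil => intro v hv; simp [vecs] at hv
  | cons o os ih =>
    intro v hv
    simp only [vecs, List.mem_append, List.mem_map, Option.mem_toList] at hv
    rcases hv with ⟨b, hb, rfl⟩ | ⟨b, hb, rfl⟩
    · simp [h.1 b hb]
    · simp [ih h.2 b hb]

/-- A list as a sequence that is eventually zero. -/
def toSeq (v : List K) : ℕ → K := fun i => v.getD i 0

/-- The right shift. -/
def shiftSeq : (ℕ → K) →ₗ[K] (ℕ → K) where
  toFun f i := i.casesOn 0 f
  map_add' f g := by ext i; cases i <;> simp
  map_smul' c f := by ext i; cases i <;> simp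

theorem toSeq_nil : toSeq ([] : List K) = 0 := by
  ext i; simp [toSeq]

theorem toSeq_zero_cons (v : List K) : toSeq (0 :: v) = shiftSeq (toSeq v) := by
  ext i; cases i <;> simp [toSeq, shiftSeq]

theorem toSeq_inj {v w : List K} (h : v.length = w.length) (h' : toSeq v = toSeq w) : v = w := by
  refine List.ext_getElem h fun i h₁ h₂ => ?_
  have := congrFun h' i
  simpa [toSeq, h₁, h₂] using this

theorem toSeq_map_mul (a : K) (v : List K) : toSeq (v.map fun b => a * b) = a • toSeq v := by
  ext i
  by_cases h : i < v.length <;> simp [toSeq, h]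

theorem toSeq_linVec {a b : K} {u v : List K} (h : u.length = v.length) :
    toSeq (linVec a u b v) = a • toSeq u + b • toSeq v := by
  ext i
  by_cases hi : i < v.length
  · simp [toSeq, linVec, hi, h, lin]
  · simp [toSeq, linVec, h, hi]

/-- The space spanned by a basis in echelon form. -/
def spanOf (os : List (Option (List K))) : Submodule K (ℕ → K) :=
  Submodule.span K (toSeq '' {v | v ∈ vecs os})

theorem spanOf_nil : spanOf ([] : List (Option (List K))) = ⊥ := by
  simp [spanOf, vecs]

theorem spanOf_none_cons (os : List (Option (List K))) :
    spanOf (none :: os) = (spanOf os).map shiftSeq := by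
  rw [spanOf, spanOf, Submodule.map_span]
  congr 1
  ext f
  simp only [vecs, Set.mem_image, Set.mem_ofPred_eq]
  constructor
  · rintro ⟨v, hv, rfl⟩
    simp only [Option.toList_none, List.map_nil, List.nil_append, List.mem_map] at hv
    obtain ⟨b, hb, rfl⟩ := hv
    exact ⟨_, ⟨b, hb, rfl⟩, (toSeq_zero_cons b).symm⟩
  · rintro ⟨_, ⟨b, hb, rfl⟩, rfl⟩
    exact ⟨0 :: b, by simpa using hb, toSeq_zero_cons b⟩

theorem spanOf_some_cons (b : List K) (os : List (Option (List K))) :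
    spanOf (some b :: os) = Submodule.span K {toSeq (1 :: b)} ⊔ (spanOf os).map shiftSeq := by
  rw [← spanOf_none_cons, spanOf, spanOf, ← Submodule.span_union]
  congr 1
  ext f
  simp only [vecs, Set.mem_image, Set.mem_ofPred_eq, Set.mem_union, Set.mem_singleton_iff,
    List.mem_append, Option.toList_some, Option.toList_none, List.map_cons, List.map_nil,
    List.mem_singleton, List.nil_append]
  constructor
  · rintro ⟨v, rfl | hv, rfl⟩
    · exact Or.inl rfl
    · exact Or.inr ⟨v, hv, rfl⟩
  · rintro (rfl | ⟨v, hv, rfl⟩)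
    · exact ⟨_, Or.inl rfl, rfl⟩
    · exact ⟨v, Or.inr hv, rfl⟩

/-- One step of Gaussian elimination per position: a vanishing entry passes to the shifted space, a
missing pivot is supplied by scaling `v`, and otherwise a multiple of the pivot vector is
subtracted, which does not change the joint span. -/
theorem spanOf_insVec {os : List (Option (List K))} (h : WF os) : ∀ {v : List K},
    v.length = os.length → spanOf (insVec v os) = spanOf os ⊔ Submodule.span K {toSeq v} := by
  induction os with
  | nil =>
    intro v hv
    rw [List.length_nil, List.length_eq_zero_iff] at hv
    simp [hv, insVec, toSeq_nil]
  | cons o os ih =>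
    intro v hv
    rcases v with _ | ⟨a, v⟩
    · simp at hv
    simp only [List.length_cons, Nat.add_right_cancel_iff] at hv
    by_cases ha : a = 0
    · subst ha
      have e : insVec (0 :: v) (o :: os) = o :: insVec v os := by simp [insVec, insStep]
      rw [e, toSeq_zero_cons]
      rcases o with _ | b
      · rw [spanOf_none_cons, spanOf_none_cons, ih h.2 hv, Submodule.map_sup, Submodule.map_span,
          Set.image_singleton]
      · rw [spanOf_some_cons, spanOf_some_cons, ih h.2 hv, Submodule.map_sup, Submodule.map_span,
          Set.image_singleton, sup_assoc]
    · rcases o with _ | b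
      · have e : insVec (a :: v) (none :: os) = some (v.map fun b => a⁻¹ * b) :: os := by
          simp [insVec, insStep, ha, insVec_nil]
        have e' : toSeq (1 :: v.map fun b => a⁻¹ * b) = a⁻¹ • toSeq (a :: v) := by
          rw [← toSeq_map_mul]
          simp [ha]
        rw [e, spanOf_some_cons, spanOf_none_cons, e',
          Submodule.span_singleton_smul_eq (IsUnit.mk0 _ (inv_ne_zero ha)), sup_comm]
      · have hb : b.length = os.length := h.1 b rfl
        have e : insVec (a :: v) (some b :: os) = some b :: insVec (linVec 1 v (-a) b) os := by
          simp [insVec, insStep, ha]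
        have e' : shiftSeq (toSeq (linVec 1 v (-a) b)) = toSeq (a :: v) - a • toSeq (1 :: b) := by
          rw [← toSeq_zero_cons, sub_eq_add_neg, ← neg_smul, ← one_smul K (toSeq (a :: v)),
            ← toSeq_linVec (by simp [hv, hb])]
          simp [linVec, lin]
        rw [e, spanOf_some_cons, spanOf_some_cons, ih h.2 (by simp [linVec, hv, hb]),
          Submodule.map_sup, Submodule.map_span, Set.image_singleton, e', sup_assoc,
          sup_left_comm, sup_left_comm (Submodule.span K {toSeq (1 :: b)})]
        congr 1
        rw [← Submodule.span_union, ← Submodule.span_union]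
        apply le_antisymm <;> rw [Submodule.span_le] <;> rintro f (rfl | rfl)
        · exact Submodule.subset_span (Or.inl rfl)
        · exact Submodule.sub_mem _ (Submodule.subset_span (Or.inr rfl))
            (Submodule.smul_mem _ _ (Submodule.subset_span (Or.inl rfl)))
        · exact Submodule.subset_span (Or.inl rfl)
        · have h₁ : toSeq (a :: v) - a • toSeq (1 :: b) ∈ Submodule.span K
              ({toSeq (1 :: b)} ∪ {toSeq (a :: v) - a • toSeq (1 :: b)}) :=
            Submodule.subset_span (Or.inr rfl)
          have h₂ : toSeq (1 :: b) ∈ Submodule.span K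
              ({toSeq (1 :: b)} ∪ {toSeq (a :: v) - a • toSeq (1 :: b)}) :=
            Submodule.subset_span (Or.inl rfl)
          simpa using Submodule.add_mem _ h₁ (Submodule.smul_mem _ a h₂)

/-- Only the first slot of an echelon basis can hold a vector with a nonzero first entry, and that
entry is `1`. -/
theorem head_isNone_iff (os : List (Option (List K))) :
    (nth none os []).isNone = true ↔ ∀ f ∈ spanOf os, f 0 = 0 := by
  rcases os with _ | ⟨_ | b, os⟩
  · simp [nth, spanOf_nil]
  · rw [spanOf_none_cons]
    simp [nth, shiftSeq]
  · rw [spanOf_some_cons]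
    simp only [nth, List.length_nil, List.drop_zero, List.head?_cons, Option.getD_some,
      Option.isNone_some, Bool.false_eq_true, false_iff]
    intro h
    have := h _ (Submodule.mem_sup_left (Submodule.mem_span_singleton_self _))
    simp [toSeq] at this

end Echelon

/-! ### The zero test over finite fields -/

section LevelTest

variable {K : Type*} [Field K]

/-- The variables of a program. -/
def progVars {R : Type*} (p : List (Instr R)) : List ℕ := p.filterMap fun i => i.1

/-- Insert vectors into a basis. -/
noncomputable def insAll (vs : List (List K)) (os : List (Option (List K))) :
    List (Option (List K)) :=
  vs.foldl (fun os v => insVec v os) os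

/-- Extend a space of functionals by their compositions with divisions by the variables. -/
noncomputable def levelStep (p : List (Instr K)) (os : List (Option (List K))) :
    List (Option (List K)) :=
  insAll ((progVars p).flatMap fun x => (vecs os).map fun v => nextVec x 0 p v) os

/-- The echelon basis that consists of the vector of constant coefficients. -/
noncomputable def levelInit (p : List (Instr K)) : List (Option (List K)) :=
  insVec (nextVec 0 1 p (zeroVec p)) ((zeroVec p).map fun _ => none)

/-- The zero test: the space spanned by the vectors of coefficients of all monomials vanishes at
the last polynomial. -/
noncomputable def levelTest (p : List (Instr K)) : Bool :=
  (nth none (p.foldl (fun os _ => levelStep p os) (levelInit p)) []).isNone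

/-- The values of a functional at the polynomials of a program. -/
noncomputable def valueMap (p : List (Instr K)) : (FreeAlgebra K ℕ →ₗ[K] K) →ₗ[K] (ℕ → K) where
  toFun ψ i := ψ ((polyRun p [1]).getD i 0)
  map_add' _ _ := rfl
  map_smul' _ _ := rfl

theorem toSeq_map (p : List (Instr K)) (ψ : FreeAlgebra K ℕ →ₗ[K] K) :
    toSeq ((polyRun p [1]).map ψ) = valueMap p ψ := by
  ext i
  by_cases h : i < (polyRun (K := K) p [1]).length <;> simp [toSeq, valueMap, h]

theorem length_polyRun {R : Type*} [CommRing R] [Algebra R K] (p : List (Instr R)) :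
    (polyRun (K := K) p [1]).length = p.length + 1 := slpRun_length _ _ _ _ _

theorem valueMap_eq_iff {p : List (Instr K)} {v : List K} (hv : v.length = p.length + 1)
    {ψ : FreeAlgebra K ℕ →ₗ[K] K} : toSeq v = valueMap p ψ ↔ v = (polyRun p [1]).map ψ := by
  rw [← toSeq_map]
  exact ⟨toSeq_inj (by rw [hv, List.length_map, length_polyRun]), fun h => by rw [h]⟩

theorem nextVec_map (p : List (Instr K)) (x : ℕ) (ψ : FreeAlgebra K ℕ →ₗ[K] K) :
    nextVec x 0 p ((polyRun p [1]).map ψ) = (polyRun p [1]).map (ψ ∘ₗ rightDiv x) := by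
  simpa using map_nextVec_rightDiv x ψ p ((polyRun p [1]).map ψ) (by simp)

/-- The data structure represents a space of functionals. -/
structure IsLevel (p : List (Instr K)) (os : List (Option (List K))) : Prop where
  wf : WF os
  length_eq : os.length = p.length + 1
  le_range : spanOf os ≤ LinearMap.range (valueMap p)

theorem IsLevel.insVec {p : List (Instr K)} {os : List (Option (List K))} (h : IsLevel p os)
    (ψ : FreeAlgebra K ℕ →ₗ[K] K) : IsLevel p (insVec ((polyRun p [1]).map ψ) os) ∧
      spanOf (insVec ((polyRun p [1]).map ψ) os) =
        spanOf os ⊔ Submodule.span K {valueMap p ψ} := by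
  have hl : ((polyRun p [1]).map ψ).length = os.length := by
    rw [List.length_map, length_polyRun, h.length_eq]
  have hs := spanOf_insVec h.wf hl
  rw [toSeq_map] at hs
  refine ⟨⟨h.wf.insVec (Or.inl hl), by rw [length_insVec, h.length_eq], ?_⟩, hs⟩
  rw [hs, sup_le_iff, Submodule.span_singleton_le_iff_mem]
  exact ⟨h.le_range, ψ, rfl⟩

theorem IsLevel.insAll {p : List (Instr K)} : ∀ {vs : List (List K)} {os : List (Option (List K))},
    IsLevel p os → (∀ v ∈ vs, ∃ ψ : FreeAlgebra K ℕ →ₗ[K] K, v = (polyRun p [1]).map ψ) →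
    IsLevel p (insAll vs os) ∧
      spanOf os ≤ spanOf (_root_.insAll vs os) ∧ ∀ v ∈ vs, toSeq v ∈ spanOf (_root_.insAll vs os) := by
  intro vs
  induction vs with
  | nil => intro os h _; exact ⟨h, le_rfl, by simp⟩
  | cons v vs ih =>
    intro os h hvs
    obtain ⟨ψ, rfl⟩ := hvs v List.mem_cons_self
    obtain ⟨h₁, h₂⟩ := h.insVec ψ
    obtain ⟨h₃, h₄, h₅⟩ := ih h₁ fun v hv => hvs v (List.mem_cons_of_mem _ hv)
    rw [h₂, sup_le_iff, Submodule.span_singleton_le_iff_mem] at h₄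
    refine ⟨h₃, h₄.1, fun v hv => ?_⟩
    rcases List.mem_cons.1 hv with rfl | hv
    · rw [toSeq_map]
      exact h₄.2
    · exact h₅ v hv

theorem IsLevel.exists_of_mem_vecs {p : List (Instr K)} {os : List (Option (List K))}
    (h : IsLevel p os) {v : List K} (hv : v ∈ vecs os) :
    ∃ ψ : FreeAlgebra K ℕ →ₗ[K] K, v = (polyRun p [1]).map ψ := by
  obtain ⟨ψ, hψ⟩ := h.le_range (Submodule.subset_span ⟨v, hv, rfl⟩)
  exact ⟨ψ, (valueMap_eq_iff ((h.wf.length_vecs v hv).trans h.length_eq)).1 hψ.symm⟩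

/-- It suffices to apply `nextVec x 0 p` to the basis vectors, since right division acts linearly on
functionals. -/
theorem IsLevel.levelStep {p : List (Instr K)} {os : List (Option (List K))} (h : IsLevel p os) :
    IsLevel p (levelStep p os) ∧ spanOf os ≤ spanOf (levelStep p os) ∧
      ∀ x ∈ progVars p, ∀ ψ : FreeAlgebra K ℕ →ₗ[K] K, valueMap p ψ ∈ spanOf os →
        valueMap p (ψ ∘ₗ rightDiv x) ∈ spanOf (_root_.levelStep p os) := by
  obtain ⟨h₁, h₂, h₃⟩ := h.insAll (vs := (progVars p).flatMap fun x =>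
      (vecs os).map fun v => nextVec x 0 p v) fun v hv => by
    simp only [List.mem_flatMap, List.mem_map] at hv
    obtain ⟨x, -, u, hu, rfl⟩ := hv
    obtain ⟨ψ, rfl⟩ := h.exists_of_mem_vecs hu
    exact ⟨_, nextVec_map p x ψ⟩
  refine ⟨h₁, h₂, fun x hx ψ hψ => ?_⟩
  have key : ∀ f ∈ spanOf os, ∃ φ, f = valueMap p φ ∧
      valueMap p (φ ∘ₗ rightDiv x) ∈ spanOf (_root_.levelStep p os) := by
    intro f hf
    refine Submodule.span_induction (p := fun f _ => ∃ φ, f = valueMap p φ ∧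
      valueMap p (φ ∘ₗ rightDiv x) ∈ spanOf (_root_.levelStep p os)) ?_ ⟨0, by simp, ?_⟩ ?_ ?_ hf
    · rintro _ ⟨v, hv, rfl⟩
      obtain ⟨φ, hφ⟩ := h.exists_of_mem_vecs hv
      refine ⟨φ, by rw [hφ, toSeq_map], ?_⟩
      rw [← toSeq_map, ← nextVec_map, ← hφ]
      exact h₃ _ (List.mem_flatMap.2 ⟨x, hx, List.mem_map.2 ⟨v, hv, rfl⟩⟩)
    · simp
    · rintro _ _ _ _ ⟨φ, rfl, hφ⟩ ⟨χ, rfl, hχ⟩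
      refine ⟨φ + χ, by simp, ?_⟩
      rw [LinearMap.add_comp, map_add]
      exact Submodule.add_mem _ hφ hχ
    · rintro c _ _ ⟨φ, rfl, hφ⟩
      refine ⟨c • φ, by simp, ?_⟩
      rw [LinearMap.smul_comp, map_smul]
      exact Submodule.smul_mem _ _ hφ
  -- The functionals `φ` and `ψ` need not be equal. They have the same values on the program, and
  -- `nextVec` depends on these values alone.
  obtain ⟨φ, hφ, hφ'⟩ := key _ hψ
  rw [← toSeq_map, ← toSeq_map] at hφ
  have e := toSeq_inj (by simp) hφ
  rw [← toSeq_map, ← nextVec_map, e, nextVec_map, toSeq_map]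
  exact hφ'

theorem mem_polyRun_cons {R : Type*} [CommRing R] [Algebra R K] {i : Instr R} {p : List (Instr R)}
    {f : FreeAlgebra K ℕ} (hf : f ∈ polyRun (i :: p) [1]) : f ∈ polyRun (K := K) p [1] ∨
    (∃ y g, i.1 = some y ∧ (g = 0 ∨ g ∈ polyRun p [1]) ∧ f = g * FreeAlgebra.ι K y) ∨
    ∃ a g b h, (g = 0 ∨ g ∈ polyRun p [1]) ∧ (h = 0 ∨ h ∈ polyRun p [1]) ∧
      f = polyLin (R := R) a g b h := by
  rcases List.mem_cons.1 hf with rfl | hf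
  · right
    rcases hi : i.1 with _ | y
    · exact Or.inr ⟨_, _, _, _, nth_mem_or _ _ _, nth_mem_or _ _ _, rfl⟩
    · exact Or.inl ⟨y, _, rfl, nth_mem_or _ _ _, rfl⟩
  · exact Or.inl hf

theorem rightDiv_eq_zero {x : ℕ} : ∀ {p : List (Instr K)}, x ∉ progVars p →
    ∀ f ∈ polyRun (K := K) p [1], rightDiv x f = 0 := by
  intro p
  induction p with
  | nil =>
    intro _ f hf
    simp only [polyRun, slpRun, List.foldr_nil, List.mem_singleton] at hf
    rw [hf, rightDiv_one]
  | cons i p ih =>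
    intro hx f hf
    have ih' : ∀ g, (g = 0 ∨ g ∈ polyRun (K := K) p [1]) → rightDiv x g = 0 := by
      rintro g (rfl | hg)
      · simp
      · refine ih (fun h => hx ?_) g hg
        simp only [progVars, List.mem_filterMap] at h ⊢
        obtain ⟨j, hj, hj'⟩ := h
        exact ⟨j, List.mem_cons_of_mem _ hj, hj'⟩
    rcases mem_polyRun_cons hf with hf | ⟨y, g, hi, hg, rfl⟩ | ⟨a, g, b, h, hg, hh, rfl⟩
    · exact ih' f (Or.inr hf)
    · rw [rightDiv_mul, if_neg]
      rintro rfl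
      exact hx (List.mem_filterMap.2 ⟨i, List.mem_cons_self, hi⟩)
    · simp [polyLin, ih' g hg, ih' h hh]

/-- Each instruction raises the degree by at most one. -/
theorem coeffAt_eq_zero_of_length : ∀ {p : List (Instr K)} {w : FreeMonoid ℕ},
    p.length < w.toList.length → ∀ f ∈ polyRun (K := K) p [1], coeffAt w f = 0 := by
  intro p
  induction p with
  | nil =>
    intro w hw f hf
    simp only [polyRun, slpRun, List.foldr_nil, List.mem_singleton] at hf
    subst hf
    rcases freeMonoid_cases w with rfl | ⟨r, z, rfl⟩
    · simp at hw
    · rw [coeffAt_mul_of, LinearMap.comp_apply, rightDiv_one, map_zero]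
  | cons i p ih =>
    intro w hw f hf
    rw [List.length_cons] at hw
    have ih' : ∀ g, (g = 0 ∨ g ∈ polyRun (K := K) p [1]) → ∀ w : FreeMonoid ℕ,
        p.length < w.toList.length → coeffAt w g = 0 := by
      rintro g (rfl | hg) w hw
      · simp
      · exact ih hw g hg
    rcases mem_polyRun_cons hf with hf | ⟨y, g, hi, hg, rfl⟩ | ⟨a, g, b, h, hg, hh, rfl⟩
    · exact ih' f (Or.inr hf) w (by omega)
    · rcases freeMonoid_cases w with rfl | ⟨r, z, rfl⟩
      · simp at hw
      · rw [coeffAt_mul_of, LinearMap.comp_apply, rightDiv_mul]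
        simp only [FreeMonoid.toList_mul, FreeMonoid.toList_of, List.length_append,
          List.length_singleton] at hw
        split_ifs
        · exact ih' g hg r (by omega)
        · simp
    · rw [polyLin, map_add, map_smul, map_smul, ih' g hg w (by omega), ih' h hh w (by omega)]
      simp

theorem isLevel_levelInit (p : List (Instr K)) : IsLevel p (levelInit p) ∧
    valueMap p (coeffAt 1) ∈ spanOf (levelInit p) := by
  have e : nextVec 0 1 p (zeroVec p) = (polyRun p [1]).map (coeffAt (K := K) 1) := by
    simpa using map_nextVec_zero (K := K) p
  have h : ∀ v : List K, WF (K := K) (v.map fun _ => none) ∧ spanOf (K := K) (v.map fun _ => none) = ⊥ := by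
    intro v
    induction v with
    | nil => exact ⟨trivial, spanOf_nil⟩
    | cons a v ih =>
      refine ⟨⟨by simp, ih.1⟩, ?_⟩
      rw [List.map_cons, spanOf_none_cons, ih.2, Submodule.map_bot]
  have h₀ : IsLevel p ((zeroVec p).map fun _ => none) :=
    ⟨(h _).1, by simp [zeroVec], by rw [(h _).2]; exact bot_le⟩
  rw [levelInit, e]
  obtain ⟨h₁, h₂⟩ := h₀.insVec (coeffAt 1)
  exact ⟨h₁, by rw [h₂]; exact Submodule.mem_sup_right (Submodule.mem_span_singleton_self _)⟩

/-- Each round admits words that are one letter longer. A letter that is not a variable of the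
program gives functionals that vanish on all its values, so only finitely many letters have to be
tried. -/
theorem isLevel_foldl {σ : Type*} (p : List (Instr K)) (l : List σ) :
    IsLevel p (l.foldl (fun os _ => levelStep p os) (levelInit p)) ∧
    ∀ w : FreeMonoid ℕ, w.toList.length ≤ l.length →
      valueMap p (coeffAt w) ∈ spanOf (l.foldl (fun os _ => levelStep p os) (levelInit p)) := by
  induction l using List.reverseRecOn with
  | nil =>
    refine ⟨(isLevel_levelInit p).1, fun w hw => ?_⟩
    rcases freeMonoid_cases w with rfl | ⟨r, z, rfl⟩
    · exact (isLevel_levelInit p).2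
    · simp at hw
  | append_singleton l x ih =>
    rw [List.foldl_append, List.foldl_cons, List.foldl_nil]
    obtain ⟨h₁, h₂, h₃⟩ := ih.1.levelStep
    refine ⟨h₁, fun w hw => ?_⟩
    rw [List.length_append, List.length_singleton] at hw
    rcases freeMonoid_cases w with rfl | ⟨r, z, rfl⟩
    · exact h₂ (ih.2 1 (by simp))
    · simp only [FreeMonoid.toList_mul, FreeMonoid.toList_of, List.length_append,
        List.length_singleton] at hw
      rw [coeffAt_mul_of]
      by_cases hz : z ∈ progVars p
      · exact h₃ z hz _ (ih.2 r (by omega))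
      · have : valueMap p (coeffAt r ∘ₗ rightDiv z) = 0 := by
          ext i
          simp only [valueMap, LinearMap.coe_mk, AddHom.coe_mk, LinearMap.comp_apply,
            Pi.zero_apply]
          by_cases hi : i < (polyRun (K := K) p [1]).length
          · rw [rightDiv_eq_zero hz _ (by simp [hi]), map_zero]
          · simp [hi]
        rw [this]
        exact Submodule.zero_mem _

/-- The span contains the coefficients of all words up to the degree bound and consists of value
vectors of functionals. So it vanishes at the last polynomial exactly if all coefficients of this
polynomial do. -/
theorem levelTest_iff (p : List (Instr K)) :
    levelTest p = true ↔ nth 0 (polyRun (K := K) p [1]) [] = 0 := by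
  obtain ⟨h₁, h₂⟩ := isLevel_foldl p p
  have e : ∀ ψ, valueMap p ψ 0 = ψ (nth 0 (polyRun p [1]) []) := fun ψ => by
    simp [valueMap, nth, List.head?_eq_getElem?]
  rw [levelTest, head_isNone_iff]
  constructor
  · intro h
    rw [← (monoBasis K).forall_coord_eq_zero_iff]
    intro w
    by_cases hw : w.toList.length ≤ p.length
    · rw [← e]
      exact h _ (h₂ w hw)
    · rcases nth_mem_or 0 (polyRun (K := K) p [1]) [] with h' | h'
      · rw [h', map_zero]
      · exact coeffAt_eq_zero_of_length (by omega) _ h'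
  · intro h f hf
    obtain ⟨ψ, rfl⟩ := h₁.le_range hf
    rw [e, h, map_zero]

end LevelTest

/-! ### Running time of the zero test over finite fields. -/

section LevelTestPolyTime

/-- All elements have encodings of the same length. -/
class UniformEnc (α : Type*) [TreeEnc α] : Prop where
  tsize_eq : ∀ a b : α, tsize a = tsize b

theorem uniformEnc_finTreeEnc (α : Type*) [Finite α] : @UniformEnc α (finTreeEnc α) :=
  letI := finTreeEnc α
  ⟨fun a b => by rw [tsize_finTreeEnc, tsize_finTreeEnc]⟩

theorem tsize_list_uniform {α : Type*} [TreeEnc α] [UniformEnc α] (a : α) (l : List α) :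
    tsize l = l.length * (tsize a + 1) + 1 := by
  induction l with
  | nil => simp
  | cons b l ih =>
    rw [tsize_cons, ih, UniformEnc.tsize_eq b a, List.length_cons]
    ring

theorem tsize_none {α : Type*} [TreeEnc α] : tsize (none : Option α) = 1 := rfl

theorem tsize_some {α : Type*} [TreeEnc α] (a : α) : tsize (some a) = tsize a + 2 := by
  rw [show tsize (some a) = tsize [a] from rfl, tsize_cons, tsize_nil]

variable {K γ : Type*} [Field K] [Finite K] [TreeEnc K] [InjTreeEnc K] [PolyRing K] [UniformEnc K]
  [TreeEnc γ]

theorem tsize_le_of_length {u v : List K} (h : u.length ≤ v.length) : tsize u ≤ tsize v := by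
  rw [tsize_list_uniform 0 u, tsize_list_uniform 0 v]
  gcongr

@[fun_prop] theorem PolyTime.fieldInv {f : γ → K} (hf : PolyTime f) : PolyTime fun c => (f c)⁻¹ :=
  (PolyTime.of_finite fun a : K => a⁻¹).comp hf

@[fun_prop] theorem PolyTime.fieldNeg {f : γ → K} (hf : PolyTime f) : PolyTime fun c => -f c :=
  (PolyTime.of_finite fun a : K => -a).comp hf

@[fun_prop] theorem PolyTime.fieldEqZero {f : γ → K} {i : ∀ c, Decidable (f c = 0)}
    (hf : PolyTime f) : PolyTime fun c => @decide (f c = 0) (i c) := by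
  classical
  exact ((PolyTime.of_finite fun a : K => decide (a = 0)).comp hf).congr_tcode fun c => by
    congr 1; exact decide_eq_decide.2 Iff.rfl

@[fun_prop] theorem PolyTime.insStep' {v : γ → List K} {o : γ → Option (List K)}
    (hv : PolyTime v) (ho : PolyTime o) : PolyTime fun c => insStep (v c) (o c) := by
  unfold insStep
  fun_prop

theorem tsize_insStep (v : List K) (o : Option (List K)) :
    tsize (insStep v o).1 + tsize (insStep v o).2 ≤ tsize v + tsize o + 2 := by
  rcases v with _ | ⟨a, v⟩
  · simp [insStep]
  by_cases ha : a = 0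
  · simp only [insStep, ha, List.head?_cons, Option.elim_some, decide_true, cond_true,
      List.tail_cons, tsize_cons]
    omega
  · rcases o with _ | b
    · have := tsize_le_of_length (u := v.map fun b => a⁻¹ * b) (v := v) (by simp)
      simp only [insStep, ha, List.head?_cons, Option.elim_some, decide_false, cond_false,
        List.tail_cons, tsize_cons, Option.elim_none, tsize_nil, tsize_some, tsize_none]
      omega
    · have := tsize_le_of_length (u := linVec 1 v (-a) b) (v := v) (by simp [linVec])
      simp only [insStep, ha, List.head?_cons, Option.elim_some, decide_false, cond_false,
        List.tail_cons, tsize_cons]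
      omega

theorem foldl_insStep (os : List (Option (List K))) : ∀ (v : List K) (r : List (Option (List K))),
    (os.foldl (fun s o => ((insStep s.1 o).1, (insStep s.1 o).2 :: s.2)) (v, r)).2 =
      (insVec v os).reverse ++ r := by
  induction os with
  | nil => intro v r; simp [insVec]
  | cons o os ih => intro v r; simp [insVec, ih]

@[fun_prop] theorem PolyTime.insVec' {v : γ → List K} {os : γ → List (Option (List K))}
    (hv : PolyTime v) (hos : PolyTime os) : PolyTime fun c => insVec (v c) (os c) := by
  have := foldl_of_add hos (hv.prodMk (const []))
    (f := fun _ s o => ((insStep s.1 o).1, (insStep s.1 o).2 :: s.2))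
    (by fun_prop) (G := fun p => tsize p.2 + 3)
    ((PolyTime.snd'.bdd).add (.const 3)) (fun c s o => by
      have := tsize_insStep s.1 o
      simp only [tsize_pair, tsize_cons]
      omega)
  simpa [foldl_insStep] using this.snd.reverse

/-- A bound for the lengths of the vectors of a basis. -/
def VecBound (M : ℕ) (os : List (Option (List K))) : Prop := ∀ o ∈ os, ∀ b ∈ o, b.length ≤ M

theorem VecBound.insVec {M : ℕ} {os : List (Option (List K))} (h : VecBound M os) :
    ∀ {v : List K}, v.length ≤ M → VecBound M (insVec v os) := by
  induction os with
  | nil => intro v _ o ho; simp [_root_.insVec] at ho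
  | cons o os ih =>
    intro v hv
    have hs : (insStep v o).1.length ≤ M ∧ ∀ b ∈ (insStep v o).2, b.length ≤ M := by
      have ho := h o List.mem_cons_self
      rcases v with _ | ⟨a, v⟩
      · exact ⟨hv, ho⟩
      rw [List.length_cons] at hv
      by_cases ha : a = 0
      · simp only [insStep, ha, List.head?_cons, Option.elim_some, decide_true, cond_true,
          List.tail_cons]
        exact ⟨by omega, ho⟩
      · rcases o with _ | b
        · simp only [insStep, ha, List.head?_cons, Option.elim_some, decide_false, cond_false,
            List.tail_cons, Option.elim_none, List.length_nil, Option.mem_def, Option.some.injEq,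
            forall_eq', List.length_map]
          omega
        · simp only [insStep, ha, List.head?_cons, Option.elim_some, decide_false, cond_false,
            List.tail_cons]
          exact ⟨by simp [linVec]; omega, ho⟩
    intro o' ho'
    rcases List.mem_cons.1 ho' with rfl | ho'
    · exact hs.2
    · exact ih (fun o ho => h o (List.mem_cons_of_mem _ ho)) hs.1 o' ho'

/-- All field elements have codes of one size, so only the number and the lengths of the vectors
matter. -/
theorem VecBound.tsize_le {M : ℕ} {os : List (Option (List K))} (h : VecBound M os) :
    tsize os ≤ os.length * (M * (tsize (0 : K) + 1) + 4) + 1 := by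
  refine tsize_list_list_le (B := M * (tsize (0 : K) + 1) + 3) fun o ho => ?_
  rcases o with _ | b
  · rw [tsize_none]; omega
  · rw [tsize_some, tsize_list_uniform 0]
    have := Nat.mul_le_mul_right (tsize (0 : K) + 1) (h _ ho b rfl)
    omega

theorem length_insAll (vs : List (List K)) : ∀ os : List (Option (List K)),
    (insAll vs os).length = os.length := by
  induction vs with
  | nil => intro os; rfl
  | cons v vs ih => intro os; exact (ih _).trans (length_insVec v os)

theorem VecBound.insAll {M : ℕ} {vs : List (List K)} (hvs : ∀ v ∈ vs, v.length ≤ M) :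
    ∀ {os : List (Option (List K))}, VecBound M os → VecBound M (insAll vs os) := by
  induction vs with
  | nil => intro os h; exact h
  | cons v vs ih =>
    intro os h
    exact ih (fun v hv => hvs v (List.mem_cons_of_mem _ hv)) (h.insVec (hvs v List.mem_cons_self))

theorem vecBound_tsize (os : List (Option (List K))) : VecBound (tsize os) os := by
  intro o ho b hb
  have h₁ := PolyTime.tsize_le_of_mem ho
  have h₂ := PolyTime.length_le_tsize b
  rw [Option.mem_def.1 hb, tsize_some] at h₁
  omega

@[fun_prop] theorem PolyTime.insAll' {vs : γ → List (List K)} {os : γ → List (Option (List K))}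
    (hvs : PolyTime vs) (hos : PolyTime os) : PolyTime fun c => insAll (vs c) (os c) := by
  refine foldl hvs hos (f := fun _ os v => insVec v os) (by fun_prop)
    (fun c => tsize (os c) * ((tsize (os c) + tsize (vs c)) * (tsize (0 : K) + 1) + 4) + 1)
    ((hos.1.mul (((hos.1.add hvs.1).mul (.const _)).add (.const 4))).add (.const 1))
    fun c l₁ hl₁ => ?_
  have h₁ : VecBound (tsize (os c) + tsize (vs c)) (insAll l₁ (os c)) :=
    .insAll (fun v hv => by
      have h₁ := tsize_le_of_mem (hl₁.subset hv)
      have h₂ := length_le_tsize v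
      omega) fun o ho b hb => (vecBound_tsize _ o ho b hb).trans (by omega)
  refine h₁.tsize_le.trans ?_
  rw [length_insAll]
  gcongr
  exact length_le_tsize _

theorem vecs_bounds {M : ℕ} {os : List (Option (List K))} (h : VecBound M os) :
    (vecs os).length ≤ os.length ∧ ∀ v ∈ vecs os, v.length ≤ M + os.length := by
  induction os with
  | nil => simp [vecs]
  | cons o os ih =>
    obtain ⟨h₁, h₂⟩ := ih fun o ho => h o (List.mem_cons_of_mem _ ho)
    have h₃ := h o List.mem_cons_self
    constructor
    · cases o <;> simp [vecs] <;> omega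
    · intro v hv
      simp only [vecs, List.mem_append, List.mem_map, Option.mem_toList] at hv
      rcases hv with ⟨b, hb, rfl⟩ | ⟨b, hb, rfl⟩
      · have := h₃ b hb
        simp; omega
      · have := h₂ b hb
        simp; omega

@[fun_prop] theorem PolyTime.vecs' {os : γ → List (Option (List K))} (hos : PolyTime os) :
    PolyTime fun c => vecs (os c) := by
  have h : PolyTime fun c => (os c).foldr (fun o s =>
      (o.toList.map fun b => (1 : K) :: b) ++ s.map fun b => 0 :: b) [] := by
    refine foldr hos (const []) (f := fun _ o s => (o.toList.map fun b => (1 : K) :: b) ++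
        s.map fun b => 0 :: b) (by fun_prop)
      (fun c => tsize (os c) * (((tsize (os c) + tsize (os c)) * (tsize (0 : K) + 1) + 1) + 1) + 1)
      ((hos.1.mul ((((hos.1.add hos.1).mul (.const _)).add (.const 1)).add (.const 1))).add
        (.const 1)) fun c l₁ hl₁ => ?_
    have e : l₁.foldr (fun o s => (o.toList.map fun b => (1 : K) :: b) ++ s.map fun b => 0 :: b) []
        = vecs l₁ := by
      induction l₁ with
      | nil => rfl
      | cons o l ih => rw [List.foldr_cons, ih ((List.suffix_cons _ _).trans hl₁)]; rfl
    rw [e]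
    obtain ⟨h₁, h₂⟩ := vecs_bounds (M := tsize (os c)) (os := l₁)
      fun o ho => vecBound_tsize _ o (hl₁.subset ho)
    have h₃ := hl₁.length_le.trans (length_le_tsize (os c))
    refine (tsize_list_list_le (B := (tsize (os c) + tsize (os c)) * (tsize (0 : K) + 1) + 1)
      fun v hv => ?_).trans ?_
    · rw [tsize_list_uniform 0]
      gcongr
      exact (h₂ v hv).trans (by omega)
    · gcongr
      omega
  refine h.congr_tcode fun c => ?_
  congr 1
  induction os c with
  | nil => rfl
  | cons o l ih => rw [List.foldr_cons, ← ih]; rfl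

@[fun_prop] theorem PolyTime.levelStep' {p : γ → List (Instr K)} {os : γ → List (Option (List K))}
    (hp : PolyTime p) (hos : PolyTime os) : PolyTime fun c => levelStep (p c) (os c) := by
  unfold levelStep progVars
  fun_prop

theorem levelTest_polyTime : PolyTime fun p : List (Instr K) => levelTest p := by
  have hinit : PolyTime fun p : List (Instr K) => levelInit p := by
    unfold levelInit
    fun_prop
  have hlen : ∀ (p : List (Instr K)) x s v, (nextVec x s p v).length ≤ p.length + 1 :=
    fun p x s v => by rw [length_nextVec]; simp
  have h : PolyTime fun p : List (Instr K) =>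
      p.foldl (fun os _ => levelStep p os) (levelInit p) := by
    refine PolyTime.foldl .id' hinit (f := fun p os _ => levelStep p os) (by fun_prop)
      (fun p => (tsize p + 1) * ((tsize p + 1) * (tsize (0 : K) + 1) + 4) + 1)
      (((PolyBdd.size.add (.const 1)).mul (((PolyBdd.size.add (.const 1)).mul (.const _)).add
        (.const 4))).add (.const 1)) fun p l₁ _ => ?_
    -- The basis has `p.length + 1` slots in every round; a mere list of spanning vectors could be
    -- multiplied by the number of variables each time.
    have key : (l₁.foldl (fun os _ => levelStep p os) (levelInit p)).length = p.length + 1 ∧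
        VecBound (p.length + 1) (l₁.foldl (fun os _ => levelStep p os) (levelInit p)) := by
      induction l₁ using List.reverseRecOn with
      | nil =>
        refine ⟨by simp [levelInit, length_insVec, zeroVec], VecBound.insVec ?_ (hlen _ _ _ _)⟩
        intro o ho b hb
        simp only [List.mem_map] at ho
        obtain ⟨_, _, rfl⟩ := ho
        simp at hb
      | append_singleton l x ih =>
        have ih := ih ((List.prefix_append _ _).trans ‹_›)
        rw [List.foldl_append, List.foldl_cons, List.foldl_nil]
        refine ⟨by rw [levelStep, length_insAll, ih.1], .insAll (fun v hv => ?_) ih.2⟩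
        simp only [List.mem_flatMap, List.mem_map] at hv
        obtain ⟨x, -, u, -, rfl⟩ := hv
        exact hlen _ _ _ _
    refine key.2.tsize_le.trans ?_
    rw [key.1]
    have := PolyTime.length_le_tsize p
    gcongr
  unfold levelTest
  fun_prop

end LevelTestPolyTime

open PolyRing

/-! ### Compiling formulas to straight-line programs -/

/-- A straight-line program that multiplies its input by a polynomial, up to a denominator. -/
abbrev Item (R : Type*) := List (Instr R) × R

namespace Item

section Semantics

variable {R K : Type*} [CommRing R] [Field K] [Algebra R K]

/-- The constant with a given numerator and denominator. -/
def const (c : R × R) : Item R := ([(none, c.1, [], 0)], c.2)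

/-- A variable. -/
def var (x : ℕ) : Item R := ([(some x, 0, [], 0)], 1)

/-- The product. -/
def mul (A B : Item R) : Item R := (B.1 ++ A.1, A.2 * B.2)

/-- The sum. -/
def add (A B : Item R) : Item R :=
  -- Read from the end: run `A`, recall the input from below the `A.1.length` values computed since,
  -- run `B` on it, and add crosswise. The result of `A` then lies below the results of `B` and the
  -- recalled input, hence the extra unit. Weighting by the other denominator gives the common one.
  ((none, A.2, () :: B.1.map fun _ => (), B.2) ::
    (B.1 ++ (none, 0, A.1.map fun _ => (), 1) :: A.1), A.2 * B.2)

/-- The program multiplies its input by `F`. -/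
def Computes (A : Item R) (F : FreeAlgebra K ℕ) : Prop :=
  algebraMap R K A.2 ≠ 0 ∧ ∀ q H, ∃ M, M.length + 1 = A.1.length ∧
    polyRun A.1 (q :: H) = (algebraMap R K A.2 • (q * F)) :: (M ++ q :: H)

theorem computes_const {c : R × R} {a : K} (h : algebraMap R K c.2 ≠ 0)
    (ha : algebraMap R K c.1 = algebraMap R K c.2 * a) :
    (const c).Computes (algebraMap K (FreeAlgebra K ℕ) a) := by
  refine ⟨h, fun q H => ⟨[], rfl, ?_⟩⟩
  simp only [const, polyRun, slpRun, List.foldr_cons, List.foldr_nil, slpStep, Option.elim_none,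
    polyLin, map_zero, zero_smul, add_zero, nth, List.length_nil, List.drop_zero, List.head?_cons,
    Option.getD_some, List.nil_append]
  rw [ha, ← Algebra.commutes a q, ← Algebra.smul_def (R := K), mul_smul]

theorem computes_var (x : ℕ) : (var x : Item R).Computes (FreeAlgebra.ι K x) :=
  ⟨by simp [var], fun q H => ⟨[], rfl, by simp [var, polyRun, slpRun, slpStep, nth]⟩⟩

theorem polyRun_append (p p' : List (Instr R)) (H : List (FreeAlgebra K ℕ)) :
    polyRun (p ++ p') H = polyRun p (polyRun p' H) := by
  simp [polyRun, slpRun]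

/-- The input `q` is arbitrary, so `B` can be run on `q * F`. Programs are written in reverse, hence
`B.1 ++ A.1`. -/
theorem Computes.mul {A B : Item R} {F G : FreeAlgebra K ℕ} (hA : A.Computes F)
    (hB : B.Computes G) : (A.mul B).Computes (F * G) := by
  refine ⟨by simpa [Item.mul] using ⟨hA.1, hB.1⟩, fun q H => ?_⟩
  obtain ⟨M, hM, h⟩ := hA.2 q H
  obtain ⟨M', hM', h'⟩ := hB.2 (algebraMap R K A.2 • (q * F)) (M ++ q :: H)
  refine ⟨M' ++ (algebraMap R K A.2 • (q * F)) :: M, ?_, ?_⟩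
  · simp [Item.mul]; omega
  · simp only [Item.mul, polyRun_append, h, h', map_mul]
    simp only [smul_mul_assoc, smul_smul, mul_assoc, List.append_assoc, List.cons_append,
      mul_comm (algebraMap R K B.2)]

theorem polyRun_cons (i : Instr R) (p : List (Instr R)) (H : List (FreeAlgebra K ℕ)) :
    polyRun (i :: p) H = slpStep (fun y f => f * FreeAlgebra.ι K y) polyLin 0 i (polyRun p H) :=
  rfl

theorem nth_append {V : Type*} (d : V) (M H : List V) (k : List Unit) (h : k.length = M.length) :
    nth d (M ++ H) k = nth d H [] := by
  simp [nth, h]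

theorem Computes.add {A B : Item R} {F G : FreeAlgebra K ℕ} (hA : A.Computes F)
    (hB : B.Computes G) : (A.add B).Computes (F + G) := by
  refine ⟨by simpa [Item.add] using ⟨hA.1, hB.1⟩, fun q H => ?_⟩
  obtain ⟨M, hM, h⟩ := hA.2 q H
  set f := algebraMap R K A.2 • (q * F) with hf
  obtain ⟨M', hM', h'⟩ := hB.2 q (f :: (M ++ q :: H))
  set g := algebraMap R K B.2 • (q * G) with hg
  have h₁ : polyRun ((none, 0, A.1.map fun _ => (), 1) :: A.1) (q :: H) =
      q :: f :: (M ++ q :: H) := by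
    rw [polyRun_cons, h]
    simp only [slpStep, Option.elim_none, polyLin, map_zero, zero_smul, zero_add, map_one, one_smul]
    rw [← List.cons_append, nth_append _ _ _ _ (by simp [hM])]
    rfl
  have h₂ : polyRun (A.add B).1 (q :: H) = (algebraMap R K A.2 • g + algebraMap R K B.2 • f) ::
      g :: (M' ++ q :: f :: (M ++ q :: H)) := by
    rw [Item.add, polyRun_cons, polyRun_append, h₁, h']
    simp only [slpStep, Option.elim_none, polyLin]
    have e : nth 0 (g :: (M' ++ q :: f :: (M ++ q :: H))) (() :: B.1.map fun _ => ()) = f := by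
      have := nth_append 0 (g :: (M' ++ [q])) (f :: (M ++ q :: H)) (() :: B.1.map fun _ => ())
        (by simp [← hM'])
      simpa [nth] using this
    rw [e]
    rfl
  refine ⟨g :: (M' ++ q :: f :: M), ?_, ?_⟩
  · simp [Item.add]; omega
  · rw [h₂, hf, hg]
    simp only [Item.add, map_mul, mul_add, smul_add, smul_smul]
    rw [add_comm, mul_comm (algebraMap R K B.2)]
    simp

theorem Computes.head {A : Item R} {F : FreeAlgebra K ℕ} (hA : A.Computes F) :
    nth 0 (polyRun (K := K) A.1 [1]) [] = 0 ↔ F = 0 := by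
  obtain ⟨M, -, h⟩ := hA.2 1 []
  rw [h]
  simp only [nth, List.length_nil, List.drop_zero, List.head?_cons, Option.getD_some, one_mul]
  exact smul_eq_zero_iff_right hA.1

end Semantics

section PolyTime

variable {R γ : Type*} [CommRing R] [TreeEnc R] [PolyRing R] [TreeEnc γ]

@[fun_prop] theorem _root_.PolyTime.itemConst {c : γ → R × R} (hc : PolyTime c) :
    PolyTime fun x => const (c x) := by
  unfold const; fun_prop

@[fun_prop] theorem _root_.PolyTime.itemVar {f : γ → ℕ} (hf : PolyTime f) :
    PolyTime fun x => (var (f x) : Item R) := by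
  unfold var; fun_prop

@[fun_prop] theorem _root_.PolyTime.itemMul {A B : γ → Item R} (hA : PolyTime A)
    (hB : PolyTime B) : PolyTime fun x => (A x).mul (B x) := by
  unfold mul; fun_prop

@[fun_prop] theorem _root_.PolyTime.itemAdd {A B : γ → Item R} (hA : PolyTime A)
    (hB : PolyTime B) : PolyTime fun x => (A x).add (B x) := by
  unfold add; fun_prop

/-! ### The sizes of items on a stack -/

/-- The length of a program, together with the size of its denominator. -/
def weight (A : Item R) : ℕ := A.1.length + nm A.2 + 1

/-- A bound for the total weight of a stack, and for the instructions that occur in it. -/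
def Bounded (n : ℕ) (st : List (Item R)) : Prop :=
  (st.map weight).sum ≤ n ∧ ∀ A ∈ st, ∀ i ∈ A.1,
    tsize i.1 ≤ n ∧ nm i.2.1 ≤ n ∧ i.2.2.1.length ≤ n ∧ nm i.2.2.2 ≤ n

theorem Bounded.push {n : ℕ} {st : List (Item R)} (h : Bounded n st) (A : Item R) :
    Bounded (n + (2 * tsize A + 1)) (A :: st) := by
  have hs : tsize A = tsize A.1 + tsize A.2 + 1 := tsize_pair A
  constructor
  · have h₁ := PolyTime.length_le_tsize A.1
    have h₂ := nm_le A.2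
    have h₃ := h.1
    simp only [List.map_cons, List.sum_cons, weight]
    omega
  · intro B hB i hi
    rcases List.mem_cons.1 hB with rfl | hB
    · have h₁ := PolyTime.tsize_le_of_mem hi
      have h₂ := nm_le i.2.1
      have h₃ := nm_le i.2.2.2
      have h₄ := PolyTime.length_le_tsize i.2.2.1
      simp only [tsize_pair] at h₁
      omega
    · have := h.2 B hB i hi
      omega

theorem Bounded.mul {n : ℕ} {A B : Item R} {st : List (Item R)} (h : Bounded n (A :: B :: st)) :
    Bounded n (A.mul B :: st) := by
  constructor
  · have h₁ := h.1
    have h₂ := nm_mul A.2 B.2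
    simp only [List.map_cons, List.sum_cons, weight, Item.mul, List.length_append] at *
    omega
  · intro C hC i hi
    rcases List.mem_cons.1 hC with rfl | hC
    · rcases List.mem_append.1 hi with hi | hi
      · exact h.2 B (by simp) i hi
      · exact h.2 A (by simp) i hi
    · exact h.2 C (by simp [hC]) i hi

/-- Two new instructions cost `2` and merging two items regains `1`. The new counters and
coefficients are covered by the total weight, except for small constants. -/
theorem Bounded.add {n : ℕ} {A B : Item R} {st : List (Item R)} (h : Bounded n (A :: B :: st)) :
    Bounded (n + 1) (A.add B :: st) := by
  have h₁ := h.1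
  simp only [List.map_cons, List.sum_cons, weight] at h₁
  constructor
  · have h₂ := nm_mul A.2 B.2
    simp only [List.map_cons, List.sum_cons, weight, Item.add, List.length_append,
      List.length_cons] at *
    omega
  · intro C hC i hi
    have h₀ := nm_zero (R := R)
    have h₀' := nm_one (R := R)
    have hA := h.2 A (by simp)
    have hB := h.2 B (by simp)
    rcases List.mem_cons.1 hC with rfl | hC
    · rcases List.mem_cons.1 hi with rfl | hi
      · simp only [tsize_none, List.length_cons, List.length_map]
        omega
      · rcases List.mem_append.1 hi with hi | hi
        · have := hB i hi
          omega
        · rcases List.mem_cons.1 hi with rfl | hi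
          · simp only [tsize_none, List.length_map]
            omega
          · have := hA i hi
            omega
    · have := h.2 C (by simp [hC]) i hi
      omega

theorem Bounded.tsize_le {n : ℕ} {st : List (Item R)} (h : Bounded n st) : tsize st ≤
    n * (n * (n + (factor R * n + factor R) + (2 * n + 1) + (factor R * n + factor R) + 4) + 1 +
      (factor R * n + factor R) + 2) + 1 := by
  have hw : ∀ A ∈ st, weight A ≤ n := fun A hA =>
    (List.single_le_sum (by simp) _ (List.mem_map_of_mem hA)).trans h.1
  have hf : ∀ a : R, nm a ≤ n → tsize a ≤ factor R * n + factor R := fun a ha =>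
    (PolyRing.tsize_le a).trans (by gcongr)
  refine (tsize_list_list_le (B := n * (n + (factor R * n + factor R) + (2 * n + 1) +
    (factor R * n + factor R) + 4) + 1 + (factor R * n + factor R) + 1) fun A hA => ?_).trans
    (Nat.add_le_add_right (Nat.mul_le_mul ?_ le_rfl) 1)
  · have h₁ := hw A hA
    unfold weight at h₁
    rw [tsize_pair]
    have h₂ : tsize A.1 ≤ A.1.length *
        ((n + (factor R * n + factor R) + (2 * n + 1) + (factor R * n + factor R) + 3) + 1) + 1 :=
      tsize_list_list_le fun i hi => by
        obtain ⟨h₁, h₂, h₃, h₄⟩ := h.2 A hA i hi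
        have h₂ := hf _ h₂
        have h₄ := hf _ h₄
        simp only [tsize_pair, tsize_unary]
        omega
    have h₃ := hf A.2 (by omega)
    have h₄ := Nat.mul_le_mul_right ((n + (factor R * n + factor R) + (2 * n + 1) +
      (factor R * n + factor R) + 3) + 1) (show A.1.length ≤ n by omega)
    calc _ ≤ n * ((n + (factor R * n + factor R) + (2 * n + 1) +
      (factor R * n + factor R) + 3) + 1) + 1 + (factor R * n + factor R) + 1 := by omega
      _ = _ := by simp only [Nat.mul_add]; ring
  · have h₁ : st.length ≤ (st.map weight).sum := by
      have := List.card_nsmul_le_sum (st.map (weight (R := R))) 1 fun x hx => by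
        obtain ⟨A, -, rfl⟩ := List.mem_map.1 hx
        simp [weight]
      simpa using this
    exact h₁.trans h.1

end PolyTime

end Item

/-! ### Parsing words -/

noncomputable instance : TreeEnc Letter := finTreeEnc Letter
instance : InjTreeEnc Letter := finTreeEnc_injective Letter
instance : UniformEnc Letter := uniformEnc_finTreeEnc Letter

/-- The letters that numbers consist of. -/
def Letter.isDigit : Letter → Bool
  | .bit _ => true
  | .minus => true
  | .slash => true
  | _ => false

/-- Read one more letter from the right. The state consists of the numbers that have not been
consumed and of a stack. The numbers are consumed by the next operator. -/
def parseStep {α : Type*} (act : Letter → List (List Letter) → List α → Option (List α))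
    (ℓ : Letter) (s : Option (List (List Letter) × List α)) :
    Option (List (List Letter) × List α) :=
  s.bind fun s => bif decide (ℓ = .endMark) then some ([] :: s.1, s.2) else
    bif ℓ.isDigit then s.1.head?.map fun b => ((ℓ :: b) :: s.1.tail, s.2) else
      (act ℓ s.1 s.2).map fun st => ([], st)

/-- The bit written by a letter. -/
def Letter.toBool : Letter → Bool
  | .bit b => b
  | _ => false

/-- The natural number with a given canonical binary word. -/
def decodeNat (b : List Letter) : Option ℕ :=
  bif decide ((ofBits (b.map Letter.toBool)).bits.map Letter.bit = b) then
    some (ofBits (b.map Letter.toBool)) else none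

/-- The natural number below `n` with a given canonical binary word. -/
def decodeVar (n : ℕ) (b : List Letter) : Option ℕ :=
  (decodeNat b).bind fun k => bif decide (k < n) then some k else none

/-- Encoding the number again and comparing rejects superfluous zeros and letters that are not bits,
so exactly the canonical words are accepted. -/
theorem decodeNat_eq_some {b : List Letter} {k : ℕ} :
    decodeNat b = some k ↔ b = k.bits.map Letter.bit := by
  unfold decodeNat
  constructor
  · intro h
    by_cases hb : (ofBits (b.map Letter.toBool)).bits.map Letter.bit = b
    · simp only [hb, decide_true, cond_true, Option.some.injEq] at h
      rw [← h, hb]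
    · simp [hb] at h
  · rintro rfl
    have : (k.bits.map Letter.bit).map Letter.toBool = k.bits := by
      rw [List.map_map]
      exact List.map_id _
    simp [this]

theorem decodeVar_eq_some {n : ℕ} {b : List Letter} {k : ℕ} :
    decodeVar n b = some k ↔ k < n ∧ b = k.bits.map Letter.bit := by
  rw [decodeVar, Option.bind_eq_some_iff]
  constructor
  · rintro ⟨j, hj, h⟩
    by_cases hn : j < n
    · simp only [hn, decide_true, cond_true, Option.some.injEq] at h
      subst h
      exact ⟨hn, decodeNat_eq_some.1 hj⟩
    · simp [hn] at h
  · rintro ⟨h, hb⟩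
    exact ⟨k, decodeNat_eq_some.2 hb, by simp [h]⟩

/-- The only element of a list. -/
def single {α : Type*} (l : List α) : Option α := bif l.tail.isEmpty then l.head? else none

theorem single_eq_some {α : Type*} {l : List α} {a : α} : single l = some a ↔ l = [a] := by
  rcases l with _ | ⟨b, _ | ⟨c, l⟩⟩ <;> simp [single]

/-- Replace the two topmost elements of a stack by one. -/
def binary {α : Type*} (F : α → α → α) (st : List α) : Option (List α) :=
  st.head?.bind fun A => st.tail.head?.map fun B => F A B :: st.tail.tail

theorem binary_eq_some {α : Type*} {F : α → α → α} {st st' : List α} :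
    binary F st = some st' ↔ ∃ A B r, st = A :: B :: r ∧ st' = F A B :: r := by
  rcases st with _ | ⟨A, _ | ⟨B, r⟩⟩ <;> simp [binary, eq_comm]

/-- Field elements, the words for them and a zero test for straight-line programs. -/
structure ArithCode {K : Type*} [Field K] (code : K → List Letter) (R : Type*) [CommRing R]
    [Algebra R K] [TreeEnc R] [PolyRing R] where
  -- Numerator and denominator. Over the rationals, programs then have integer coefficients and no
  -- fraction has to be reduced; for a finite field `R = K` and the denominators are `1`.
  frac : K → R × R
  den_ne_zero : ∀ a, algebraMap R K (frac a).2 ≠ 0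
  num_eq : ∀ a, algebraMap R K (frac a).1 = algebraMap R K (frac a).2 * a
  read : List Letter → Option (R × R)
  read_polyTime : PolyTime read
  read_code : ∀ a, read (code a) = some (frac a)
  exists_of_read : ∀ b c, read b = some c → ∃ a, code a = b ∧ frac a = c
  isDigit_code : ∀ a, ∀ ℓ ∈ code a, ℓ.isDigit = true
  test : List (Instr R) → Bool
  test_polyTime : PolyTime test
  test_iff : ∀ p, test p = true ↔ nth 0 (polyRun (K := K) p [1]) [] = 0

namespace ArithCode

variable {K : Type*} [Field K] {code : K → List Letter} {R : Type*} [CommRing R]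
    [Algebra R K] [TreeEnc R] [PolyRing R] (D : ArithCode code R)

/-- A constant. -/
def constItem (a : K) : Item R := .const (D.frac a)

/-- The item for `1 - f`. -/
def oneSub (A : Item R) : Item R := (D.constItem 1).add ((D.constItem (-1)).mul A)

/-- The item for a Boolean axiom. -/
def booleanItem (i : ℕ) : Item R := (Item.var i).mul (D.oneSub (.var i))

/-- The item for a commutator axiom. -/
def commutatorItem (i j : ℕ) : Item R :=
  ((Item.var i).mul (.var j)).add ((D.constItem (-1)).mul ((Item.var j).mul (.var i)))

/-- The items for leaves. The items for the axioms are multiplied by `s`. -/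
def leaf (n : ℕ) (s f : Item R) : Letter → List (List Letter) → Option (Item R)
  | .xVar, bufs => (single bufs).bind fun b => (decodeVar n b).map fun i => .var i
  | .tru, bufs => bif bufs.isEmpty then some (D.constItem 0) else none
  | .fls, bufs => bif bufs.isEmpty then some (D.constItem 1) else none
  | .const, bufs => (single bufs).bind fun b => (D.read b).map fun c => .const c
  | .yFormula, bufs => bif bufs.isEmpty then some (s.mul f) else none
  | .yBoolean, bufs => (single bufs).bind fun b => (decodeVar n b).map fun i =>
      s.mul (D.booleanItem i)
  | .yCommutator, bufs => bufs.head?.bind fun b => (single bufs.tail).bind fun b' =>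
      (decodeVar n b).bind fun i => (decodeVar n b').bind fun j =>
        bif decide (i < j) then some (s.mul (D.commutatorItem i j)) else none
  | _, _ => none

/-- The effect of operators on a stack. -/
def op : Letter → List (Item R) → Option (List (Item R))
  | .neg, st => st.head?.map fun A => D.oneSub A :: st.tail
  | .or, st => binary Item.mul st
  | .and, st => binary (fun A B => D.oneSub ((D.oneSub A).mul (D.oneSub B))) st
  | .add, st => binary Item.add st
  | .mul, st => binary Item.mul st
  | _, _ => none

/-- The effect of leaves and operators on a stack. -/
def act (n : ℕ) (s f : Item R) (ℓ : Letter) (bufs : List (List Letter)) (st : List (Item R)) :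
    Option (List (Item R)) :=
  (D.leaf n s f ℓ bufs).elim (bif bufs.isEmpty then D.op ℓ st else none) fun A => some (A :: st)

/-- Parse a word. -/
def parse (n : ℕ) (s f : Item R) (w : List Letter) :
    Option (List (List Letter) × List (Item R)) :=
  w.foldr (parseStep (D.act n s f)) (some ([], []))

section PolyTime

variable {γ α : Type*} [TreeEnc γ] [TreeEnc α]

@[fun_prop] theorem _root_.PolyTime.decodeNat' {b : γ → List Letter} (hb : PolyTime b) :
    PolyTime fun c => decodeNat (b c) := by
  have h : PolyTime fun p : List Letter × List Letter => decide (p.1 = p.2) :=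
    PolyTime.listEq (.of_finite_prod _)
  have h₁ : PolyTime fun c => ofBits ((b c).map Letter.toBool) :=
    (hb.map (f := fun _ ℓ => ℓ.toBool) ((PolyTime.of_finite _).comp PolyTime.snd')).natOfBits
  have h₂ : PolyTime Letter.bit := .of_finite _
  unfold decodeNat
  exact .cond (h.comp ((h₁.natBits.map (f := fun _ x => Letter.bit x)
    (h₂.comp PolyTime.snd')).prodMk hb)) h₁.some (.const _)

@[fun_prop] theorem _root_.PolyTime.decodeVar' {n : γ → ℕ} {b : γ → List Letter} (hn : PolyTime n)
    (hb : PolyTime b) : PolyTime fun c => decodeVar (n c) (b c) := by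
  unfold decodeVar; fun_prop

@[fun_prop] theorem _root_.PolyTime.single' {l : γ → List α} (hl : PolyTime l) :
    PolyTime fun c => single (l c) := by
  unfold single; fun_prop

@[fun_prop] theorem _root_.PolyTime.itemOneSub {A : γ → Item R} (hA : PolyTime A) :
    PolyTime fun c => D.oneSub (A c) := by
  unfold oneSub; fun_prop

@[fun_prop] theorem _root_.PolyTime.arithRead {b : γ → List Letter} (hb : PolyTime b) :
    PolyTime fun c => D.read (b c) := D.read_polyTime.comp hb

@[fun_prop] theorem _root_.PolyTime.arithTest {b : γ → List (Instr R)} (hb : PolyTime b) :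
    PolyTime fun c => D.test (b c) := D.test_polyTime.comp hb

theorem leaf_polyTime : PolyTime fun p : (ℕ × Item R × Item R) × Letter × List (List Letter) =>
    D.leaf p.1.1 p.1.2.1 p.1.2.2 p.2.1 p.2.2 := by
  refine PolyTime.finCases (g := fun p : (ℕ × Item R × Item R) × Letter × List (List Letter) =>
    p.2.1) (f := fun p ℓ => D.leaf p.1.1 p.1.2.1 p.1.2.2 ℓ p.2.2) (by fun_prop) fun ℓ => ?_
  cases ℓ <;> simp only [leaf, booleanItem, commutatorItem] <;> fun_prop

theorem op_polyTime : PolyTime fun p : Letter × List (Item R) => D.op p.1 p.2 := by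
  refine PolyTime.finCases (g := fun p : Letter × List (Item R) => p.1) (f := fun p ℓ => D.op ℓ p.2)
    (by fun_prop) fun ℓ => ?_
  cases ℓ <;> simp only [op, binary] <;> fun_prop

@[fun_prop] theorem _root_.PolyTime.arithLeaf {n : γ → ℕ} {s f : γ → Item R} {ℓ : γ → Letter}
    {b : γ → List (List Letter)} (hn : PolyTime n) (hs : PolyTime s) (hf : PolyTime f)
    (hℓ : PolyTime ℓ) (hb : PolyTime b) : PolyTime fun c => D.leaf (n c) (s c) (f c) (ℓ c) (b c) :=
  D.leaf_polyTime.comp ((hn.prodMk (hs.prodMk hf)).prodMk (hℓ.prodMk hb))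

@[fun_prop] theorem _root_.PolyTime.arithOp {ℓ : γ → Letter} {st : γ → List (Item R)}
    (hℓ : PolyTime ℓ) (hst : PolyTime st) : PolyTime fun c => D.op (ℓ c) (st c) :=
  D.op_polyTime.comp (hℓ.prodMk hst)

@[fun_prop] theorem _root_.PolyTime.isDigit' {ℓ : γ → Letter} (hℓ : PolyTime ℓ) :
    PolyTime fun c => (ℓ c).isDigit := (PolyTime.of_finite Letter.isDigit).comp hℓ

@[fun_prop] theorem _root_.PolyTime.eqEndMark {ℓ : γ → Letter} (hℓ : PolyTime ℓ) :
    PolyTime fun c => decide (ℓ c = .endMark) :=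
  (PolyTime.of_finite fun ℓ : Letter => decide (ℓ = .endMark)).comp hℓ

end PolyTime

section Bounds

/-- A bound for the growth of the weight caused by `oneSub`. -/
def growth : ℕ := 2 * tsize (D.constItem (-1)) + 1 + (2 * tsize (D.constItem 1) + 1) + 1

theorem bounded_oneSub {n : ℕ} {A : Item R} {st : List (Item R)} (h : Item.Bounded n (A :: st)) :
    Item.Bounded (n + D.growth) (D.oneSub A :: st) := by
  have h₁ := ((h.push (D.constItem (-1))).mul.push (D.constItem 1)).add
  have : n + D.growth = n + (2 * tsize (D.constItem (-1)) + 1) +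
    (2 * tsize (D.constItem 1) + 1) + 1 := by unfold growth; omega
  rw [this]
  exact h₁

theorem bounded_swap {n : ℕ} {A B : Item R} {st : List (Item R)}
    (h : Item.Bounded n (A :: B :: st)) : Item.Bounded n (B :: A :: st) := by
  refine ⟨?_, fun C hC => h.2 C (by simp only [List.mem_cons] at hC ⊢; tauto)⟩
  have := h.1
  simp only [List.map_cons, List.sum_cons] at this ⊢
  omega

theorem _root_.Item.Bounded.mono {m n : ℕ} {st : List (Item R)} (h : Item.Bounded m st)
    (hmn : m ≤ n) : Item.Bounded n st :=
  ⟨h.1.trans hmn, fun A hA i hi => by have := h.2 A hA i hi; omega⟩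

/-- The worst case is conjunction, which applies `oneSub` three times. -/
theorem bounded_op {n : ℕ} {ℓ : Letter} {st st' : List (Item R)} (h : Item.Bounded n st)
    (h' : D.op ℓ st = some st') : Item.Bounded (n + (3 * D.growth + 1)) st' := by
  cases ℓ <;> simp only [op, reduceCtorEq] at h'
  · rcases st with _ | ⟨A, st⟩
    · simp at h'
    · simp only [List.head?_cons, Option.map_some, List.tail_cons, Option.some.injEq] at h'
      subst h'
      exact (D.bounded_oneSub h).mono (by omega)
  · obtain ⟨A, B, r, rfl, rfl⟩ := binary_eq_some.1 h'
    exact h.mul.mono (by omega)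
  · obtain ⟨A, B, r, rfl, rfl⟩ := binary_eq_some.1 h'
    refine (D.bounded_oneSub (bounded_swap (D.bounded_oneSub (bounded_swap
      (D.bounded_oneSub h)))).mul).mono (by omega)
  · obtain ⟨A, B, r, rfl, rfl⟩ := binary_eq_some.1 h'
    exact h.add.mono (by omega)
  · obtain ⟨A, B, r, rfl, rfl⟩ := binary_eq_some.1 h'
    exact h.mul.mono (by omega)

/-- Pending words, counted together with their number, never exceed the letters read, so leaves have
bounded arguments. Thus every letter adds at most `E` to the weight of the stack, where `E` is the
same for all words of length at most `L`. -/
theorem parse_bounds {n : ℕ} {s f : Item R} {L E : ℕ} (hE : 3 * D.growth + 1 ≤ E)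
    (hleaf : ∀ ℓ (bufs : List (List Letter)) A, bufs.flatten.length + bufs.length ≤ L →
      D.leaf n s f ℓ bufs = some A → 2 * tsize A + 1 ≤ E) : ∀ (w : List Letter) bufs st,
    w.length ≤ L → D.parse n s f w = some (bufs, st) →
    bufs.flatten.length + bufs.length ≤ w.length ∧ Item.Bounded (w.length * E) st := by
  intro w
  induction w with
  | nil =>
    intro bufs st _ h
    simp only [parse, List.foldr_nil, Option.some.injEq, Prod.mk.injEq] at h
    obtain ⟨rfl, rfl⟩ := h
    simp [Item.Bounded]
  | cons ℓ w ih =>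
    intro bufs st hL h
    rw [List.length_cons] at hL
    change parseStep _ ℓ (D.parse n s f w) = _ at h
    obtain ⟨⟨bufs₀, st₀⟩, h₀, h⟩ := Option.bind_eq_some_iff.1 h
    obtain ⟨ih₁, ih₂⟩ := ih _ _ (by omega) h₀
    have hmono : w.length * E ≤ (w.length + 1) * E := Nat.mul_le_mul_right _ (by omega)
    rw [List.length_cons]
    by_cases h₁ : ℓ = .endMark
    · simp only [h₁, decide_true, cond_true, Option.some.injEq, Prod.mk.injEq] at h
      obtain ⟨rfl, rfl⟩ := h
      refine ⟨?_, ih₂.mono hmono⟩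
      simp only [List.flatten_cons, List.nil_append, List.length_cons]
      omega
    simp only [h₁, decide_false, cond_false] at h
    by_cases h₂ : ℓ.isDigit = true
    · simp only [h₂, cond_true] at h
      rcases bufs₀ with _ | ⟨b, bufs₀⟩
      · simp at h
      · simp only [List.head?_cons, Option.map_some, List.tail_cons, Option.some.injEq,
          Prod.mk.injEq] at h
        obtain ⟨rfl, rfl⟩ := h
        refine ⟨?_, ih₂.mono hmono⟩
        simp only [List.flatten_cons, List.length_append, List.length_cons] at ih₁ ⊢
        omega
    · simp only [h₂, cond_false] at h
      obtain ⟨st', h', h⟩ := Option.map_eq_some_iff.1 h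
      simp only [Prod.mk.injEq] at h
      obtain ⟨rfl, rfl⟩ := h
      refine ⟨by simp, ?_⟩
      rw [Nat.add_mul, Nat.one_mul]
      unfold act at h'
      cases hl : D.leaf n s f ℓ bufs₀ with
      | none =>
        simp only [hl, Option.elim_none] at h'
        rcases bufs₀ with _ | ⟨b, bufs₀⟩
        · exact (D.bounded_op ih₂ (by simpa using h')).mono (by omega)
        · simp at h'
      | some A =>
        simp only [hl, Option.elim_some, Option.some.injEq] at h'
        subst h'
        exact (ih₂.push A).mono (by have := hleaf _ _ _ (by omega) hl; omega)

theorem tsize_bufs (bufs : List (List Letter)) : tsize bufs ≤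
    (bufs.flatten.length + bufs.length) * (tsize Letter.endMark + 3) + 1 := by
  induction bufs with
  | nil => simp
  | cons b bufs ih =>
    rw [tsize_cons, tsize_list_uniform Letter.endMark]
    simp only [List.flatten_cons, List.length_append, List.length_cons]
    simp only [Nat.mul_add, Nat.add_mul] at ih ⊢
    omega

theorem parse_polyTime : PolyTime fun p : (ℕ × Item R × Item R) × List Letter =>
    D.parse p.1.1 p.1.2.1 p.1.2.2 p.2 := by
  obtain ⟨P, hP⟩ := D.leaf_polyTime.bdd
  have hbufs := tsize_bufs
  have hletter : ∀ ℓ : Letter, tsize ℓ = tsize Letter.endMark :=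
    fun ℓ => UniformEnc.tsize_eq ℓ Letter.endMark
  generalize tsize Letter.endMark = τ at hbufs hletter
  -- The argument of `P` bounds the size of a leaf's arguments when the pending words come from a
  -- word of at most `tsize p.2` letters.
  let E : (ℕ × Item R × Item R) × List Letter → ℕ := fun p =>
    2 * P.eval (tsize p.1 + (τ + (tsize p.2 * (τ + 3) + 1) + 1) + 1) + 1 + (3 * D.growth + 1)
  have hE : PolyBdd E :=
    (((PolyBdd.const 2).mul ((((PolyTime.fst'.bdd).add (((PolyBdd.const τ).add
      (((PolyTime.snd'.bdd).mul (.const (τ + 3))).add (.const 1))).add (.const 1))).add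
        (.const 1)).eval P)).add (.const 1)).add (.const (3 * D.growth + 1))
  let N : (ℕ × Item R × Item R) × List Letter → ℕ := fun p => tsize p.2 * E p
  have hN : PolyBdd N := (PolyTime.snd'.bdd).mul hE
  have hF : PolyBdd fun p => factor R * N p + factor R :=
    ((PolyBdd.const _).mul hN).add (.const _)
  let B : (ℕ × Item R × Item R) × List Letter → ℕ := fun p =>
    (tsize p.2 * (τ + 3) + 1) + (N p * (N p * (N p + (factor R * N p + factor R) + (2 * N p + 1) +
      (factor R * N p + factor R) + 4) + 1 + (factor R * N p + factor R) + 2) + 1) + 3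
  have hB : PolyBdd B :=
    (((((PolyTime.snd'.bdd).mul (.const (τ + 3))).add (.const 1)).add
      ((hN.mul ((((hN.mul ((((hN.add hF).add (((PolyBdd.const 2).mul hN).add (.const 1))).add
        hF).add (.const 4))).add (.const 1)).add hF).add (.const 2))).add (.const 1)))).add
        (.const 3)
  have hact : PolyTime fun p : ((ℕ × Item R × Item R) × List Letter) × Letter ×
      Option (List (List Letter) × List (Item R)) =>
      parseStep (D.act p.1.1.1 p.1.1.2.1 p.1.1.2.2) p.2.1 p.2.2 := by
    unfold parseStep act
    fun_prop
  unfold parse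
  refine PolyTime.foldr (f := fun (p : (ℕ × Item R × Item R) × List Letter) ℓ s =>
    parseStep (D.act p.1.1 p.1.2.1 p.1.2.2) ℓ s) (by fun_prop) (by fun_prop) hact B hB
    fun p l₁ hl₁ => ?_
  have hlen := hl₁.length_le.trans (PolyTime.length_le_tsize p.2)
  change tsize (D.parse p.1.1 p.1.2.1 p.1.2.2 l₁) ≤ B p
  cases hp : D.parse p.1.1 p.1.2.1 p.1.2.2 l₁ with
  | none => rw [tsize_none]; dsimp only [B]; omega
  | some s =>
    obtain ⟨h₁, h₂⟩ := D.parse_bounds (n := p.1.1) (s := p.1.2.1) (f := p.1.2.2) (L := tsize p.2)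
      (E := E p) (by dsimp only [E]; omega) (fun ℓ bufs A hb hA => by
        have h₁ := hP (p.1, ℓ, bufs)
        simp only [hA, tsize_some] at h₁
        have h₂ : P.eval (tsize (p.1, ℓ, bufs)) ≤
            P.eval (tsize p.1 + (τ + (tsize p.2 * (τ + 3) + 1) + 1) + 1) := by
          refine P.eval_le_eval_of_le ?_
          have h₃ := hbufs bufs
          have h₄ := Nat.mul_le_mul_right (τ + 3) hb
          have h₅ := hletter ℓ
          rw [tsize_pair, tsize_pair (ℓ, bufs)]
          dsimp only
          generalize (bufs.flatten.length + bufs.length) * (τ + 3) = X at h₃ h₄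
          generalize tsize p.2 * (τ + 3) = Y at h₄ ⊢
          omega
        dsimp only [E]
        omega) l₁ s.1 s.2 hlen hp
    have h₃ := (h₂.mono (n := N p) (Nat.mul_le_mul_right _ hlen)).tsize_le
    have h₄ := hbufs s.1
    have h₅ := Nat.mul_le_mul_right (τ + 3) (h₁.trans hlen)
    rw [tsize_some, tsize_pair]
    dsimp only [B]
    generalize (s.1.flatten.length + s.1.length) * (τ + 3) = X at h₄ h₅
    generalize tsize p.2 * (τ + 3) = Y at h₅ ⊢
    omega

end Bounds

end ArithCode

namespace ArithCode

variable {K : Type*} [Field K] {code : K → List Letter} {R : Type*} [CommRing R]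
    [Algebra R K] [TreeEnc R] [PolyRing R] (D : ArithCode code R)

/-! ### Correctness of the parser -/

/-- The item for an arithmetic formula. -/
def formulaItem {V : Type*} (var : V → Item R) : NCFormula K V → Item R
  | .var v => var v
  | .const a => D.constItem a
  | .add f g => (formulaItem var f).add (formulaItem var g)
  | .mul f g => (formulaItem var f).mul (formulaItem var g)

/-- The item for a propositional formula. -/
def propItem {n : ℕ} (f : PropFormula (Fin n)) : Item R :=
  D.formulaItem (fun i : Fin n => Item.var i) (f.tr K)

/-- The items for the variables of certificates. -/
def varItem {n : ℕ} (s f : Item R) : Fin n ⊕ AxiomIndex n → Item R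
  | .inl i => .var i
  | .inr .formula => s.mul f
  | .inr (.boolean i) => s.mul (D.booleanItem i)
  | .inr (.commutator i j _) => s.mul (D.commutatorItem i j)

/-- Words for numbers, closed by end marks. -/
def closed (bufs : List (List Letter)) : List Letter := bufs.flatMap fun b => b ++ [Letter.endMark]

theorem parse_cons (n : ℕ) (s f : Item R) (ℓ : Letter) (w : List Letter) :
    D.parse n s f (ℓ :: w) = parseStep (D.act n s f) ℓ (D.parse n s f w) := rfl

/-- The invariant of reading from the right: the part read consists of the pending numbers followed
by the words of the trees on the stack. The predicate `ok` singles out one of the two grammars,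
since `act` serves both. -/
theorem parse_sound {τ : Type*} {word : τ → List Letter} {item : τ → Item R} {ok : Letter → Bool}
    {n : ℕ} {s f : Item R} (h : ∀ ℓ bufs (ts : List τ) st, ok ℓ = true → ℓ.isDigit = false →
      ℓ ≠ .endMark → D.act n s f ℓ bufs (ts.map item) = some st →
      ∃ ts' : List τ, st = ts'.map item ∧
        ts'.flatMap word = ℓ :: (closed bufs ++ ts.flatMap word)) :
    ∀ (w : List Letter) bufs st, w.all ok = true → D.parse n s f w = some (bufs, st) →
      ∃ ts : List τ, st = ts.map item ∧ w = closed bufs ++ ts.flatMap word ∧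
        ∀ b ∈ bufs, ∀ ℓ ∈ b, ℓ.isDigit = true := by
  intro w
  induction w with
  | nil =>
    intro bufs st _ h
    simp only [parse, List.foldr_nil, Option.some.injEq, Prod.mk.injEq] at h
    obtain ⟨rfl, rfl⟩ := h
    exact ⟨[], rfl, rfl, by simp⟩
  | cons ℓ w ih =>
    intro bufs st hok hp
    rw [List.all_cons, Bool.and_eq_true] at hok
    rw [parse_cons] at hp
    obtain ⟨⟨bufs₀, st₀⟩, h₀, hp⟩ := Option.bind_eq_some_iff.1 hp
    obtain ⟨ts, rfl, hw, hd⟩ := ih _ _ hok.2 h₀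
    by_cases h₁ : ℓ = .endMark
    · simp only [h₁, decide_true, cond_true, Option.some.injEq, Prod.mk.injEq] at hp
      obtain ⟨rfl, rfl⟩ := hp
      exact ⟨ts, rfl, by rw [hw, h₁]; rfl, by simpa using hd⟩
    simp only [h₁, decide_false, cond_false] at hp
    by_cases h₂ : ℓ.isDigit = true
    · simp only [h₂, cond_true] at hp
      rcases bufs₀ with _ | ⟨b, bufs₀⟩
      · simp at hp
      · simp only [List.head?_cons, Option.map_some, List.tail_cons, Option.some.injEq,
          Prod.mk.injEq] at hp
        obtain ⟨rfl, rfl⟩ := hp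
        refine ⟨ts, rfl, by rw [hw]; rfl, fun b' hb' => ?_⟩
        rcases List.mem_cons.1 hb' with rfl | hb'
        · intro ℓ' hℓ'
          rcases List.mem_cons.1 hℓ' with rfl | hℓ'
          · exact h₂
          · exact hd b List.mem_cons_self ℓ' hℓ'
        · exact hd b' (List.mem_cons_of_mem _ hb')
    · rw [Bool.not_eq_true] at h₂
      simp only [h₂, cond_false] at hp
      obtain ⟨st', h', hp⟩ := Option.map_eq_some_iff.1 hp
      simp only [Prod.mk.injEq] at hp
      obtain ⟨rfl, rfl⟩ := hp
      obtain ⟨ts', rfl, hts'⟩ := h ℓ bufs₀ ts st' hok.1 h₂ h₁ h'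
      exact ⟨ts', rfl, by rw [hts', hw]; rfl, by simp⟩

theorem act_eq_some {n : ℕ} {s f : Item R} {ℓ : Letter} {bufs : List (List Letter)}
    {st st' : List (Item R)} : D.act n s f ℓ bufs st = some st' ↔
      (∃ A, D.leaf n s f ℓ bufs = some A ∧ st' = A :: st) ∨
      D.leaf n s f ℓ bufs = none ∧ bufs = [] ∧ D.op ℓ st = some st' := by
  unfold act
  cases D.leaf n s f ℓ bufs with
  | none => cases bufs <;> simp
  | some A => simp [eq_comm]

theorem map_eq_cons_cons {τ : Type*} {item : τ → Item R} {ts : List τ} {A B : Item R}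
    {r : List (Item R)} (h : ts.map item = A :: B :: r) :
    ∃ t t' ts', ts = t :: t' :: ts' ∧ item t = A ∧ item t' = B ∧ ts'.map item = r := by
  rcases ts with _ | ⟨t, _ | ⟨t', ts⟩⟩
  · simp at h
  · simp at h
  · simp only [List.map_cons, List.cons.injEq] at h
    exact ⟨t, t', ts, rfl, h.1, h.2.1, h.2.2⟩

theorem cond_isEmpty {α β : Type*} {l : List α} {a b : β}
    (h : (bif l.isEmpty then some a else none) = some b) : l = [] ∧ a = b := by
  cases l <;> simp_all

/-- The letters of propositional formulas. -/
def propLetter : Letter → Bool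
  | .const | .add | .mul | .yFormula | .yBoolean | .yCommutator => false
  | _ => true

/-- The letters of arithmetic formulas. -/
def arithLetter : Letter → Bool
  | .tru | .fls | .neg | .or | .and => false
  | _ => true

theorem act_propFormula {n : ℕ} {s f : Item R} (ℓ : Letter) (bufs : List (List Letter))
    (ts : List (PropFormula (Fin n))) (st : List (Item R)) (hok : propLetter ℓ = true)
    (hd : ℓ.isDigit = false) (he : ℓ ≠ .endMark)
    (h : D.act n s f ℓ bufs (ts.map D.propItem) = some st) :
    ∃ ts' : List (PropFormula (Fin n)), st = ts'.map D.propItem ∧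
      ts'.flatMap PropFormula.code = ℓ :: (closed bufs ++ ts.flatMap PropFormula.code) := by
  rcases D.act_eq_some.1 h with ⟨A, hA, rfl⟩ | ⟨-, rfl, hop⟩
  · cases ℓ <;> simp only [propLetter, Letter.isDigit, leaf, reduceCtorEq, Bool.false_eq_true,
      Bool.true_eq_false] at hok hd hA
    · obtain ⟨b, hb, hA⟩ := Option.bind_eq_some_iff.1 hA
      obtain ⟨i, hi, rfl⟩ := Option.map_eq_some_iff.1 hA
      obtain ⟨hin, rfl⟩ := decodeVar_eq_some.1 hi
      rw [single_eq_some.1 hb]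
      exact ⟨.var ⟨i, hin⟩ :: ts, rfl, by simp [PropFormula.code, closed, natCode]⟩
    · obtain ⟨rfl, rfl⟩ := cond_isEmpty hA
      exact ⟨.tru :: ts, rfl, by simp [PropFormula.code, closed]⟩
    · obtain ⟨rfl, rfl⟩ := cond_isEmpty hA
      exact ⟨.fls :: ts, rfl, by simp [PropFormula.code, closed]⟩
  · cases ℓ <;> simp only [propLetter, Letter.isDigit, op, reduceCtorEq, Bool.false_eq_true,
      Bool.true_eq_false] at hok hd hop
    · rcases ts with _ | ⟨t, ts⟩
      · simp at hop
      · simp only [List.map_cons, List.head?_cons, Option.map_some, List.tail_cons,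
          Option.some.injEq] at hop
        subst hop
        exact ⟨.neg t :: ts, rfl, by simp [PropFormula.code, closed]⟩
    · obtain ⟨A, B, r, hr, rfl⟩ := binary_eq_some.1 hop
      obtain ⟨t, t', ts, rfl, rfl, rfl, rfl⟩ := map_eq_cons_cons hr
      exact ⟨.or t t' :: ts, rfl, by simp [PropFormula.code, closed]⟩
    · obtain ⟨A, B, r, hr, rfl⟩ := binary_eq_some.1 hop
      obtain ⟨t, t', ts, rfl, rfl, rfl, rfl⟩ := map_eq_cons_cons hr
      exact ⟨.and t t' :: ts, rfl, by simp [PropFormula.code, closed]⟩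

theorem act_ncFormula {n : ℕ} {s f : Item R} (ℓ : Letter) (bufs : List (List Letter))
    (ts : List (NCFormula K (Fin n ⊕ AxiomIndex n))) (st : List (Item R))
    (hok : arithLetter ℓ = true) (hd : ℓ.isDigit = false) (he : ℓ ≠ .endMark)
    (h : D.act n s f ℓ bufs (ts.map (D.formulaItem (D.varItem s f))) = some st) :
    ∃ ts' : List (NCFormula K (Fin n ⊕ AxiomIndex n)),
      st = ts'.map (D.formulaItem (D.varItem s f)) ∧
      ts'.flatMap (NCFormula.code code) =
        ℓ :: (closed bufs ++ ts.flatMap (NCFormula.code code)) := by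
  rcases D.act_eq_some.1 h with ⟨A, hA, rfl⟩ | ⟨-, rfl, hop⟩
  · cases ℓ <;> simp only [arithLetter, Letter.isDigit, leaf, reduceCtorEq, Bool.false_eq_true,
      Bool.true_eq_false] at hok hd hA
    · obtain ⟨b, hb, hA⟩ := Option.bind_eq_some_iff.1 hA
      obtain ⟨i, hi, rfl⟩ := Option.map_eq_some_iff.1 hA
      obtain ⟨hin, rfl⟩ := decodeVar_eq_some.1 hi
      rw [single_eq_some.1 hb]
      exact ⟨.var (.inl ⟨i, hin⟩) :: ts, rfl, by simp [NCFormula.code, varCode, closed, natCode]⟩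
    · obtain ⟨b, hb, hA⟩ := Option.bind_eq_some_iff.1 hA
      obtain ⟨c, hc, rfl⟩ := Option.map_eq_some_iff.1 hA
      obtain ⟨a, rfl, rfl⟩ := D.exists_of_read _ _ hc
      rw [single_eq_some.1 hb]
      exact ⟨.const a :: ts, rfl, by simp [NCFormula.code, closed]⟩
    · obtain ⟨rfl, rfl⟩ := cond_isEmpty hA
      exact ⟨.var (.inr .formula) :: ts, rfl, by simp [NCFormula.code, varCode, closed]⟩
    · obtain ⟨b, hb, hA⟩ := Option.bind_eq_some_iff.1 hA
      obtain ⟨i, hi, rfl⟩ := Option.map_eq_some_iff.1 hA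
      obtain ⟨hin, rfl⟩ := decodeVar_eq_some.1 hi
      rw [single_eq_some.1 hb]
      exact ⟨.var (.inr (.boolean ⟨i, hin⟩)) :: ts, rfl,
        by simp [NCFormula.code, varCode, closed, natCode]⟩
    · obtain ⟨b, hb, hA⟩ := Option.bind_eq_some_iff.1 hA
      obtain ⟨b', hb', hA'⟩ := Option.bind_eq_some_iff.1 hA
      obtain ⟨i, hi, hA''⟩ := Option.bind_eq_some_iff.1 hA'
      obtain ⟨j, hj, hA'''⟩ := Option.bind_eq_some_iff.1 hA''
      obtain ⟨hin, rfl⟩ := decodeVar_eq_some.1 hi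
      obtain ⟨hjn, rfl⟩ := decodeVar_eq_some.1 hj
      by_cases hij : i < j
      · simp only [hij, decide_true, cond_true, Option.some.injEq] at hA'''
        subst hA'''
        rcases bufs with _ | ⟨b, bufs⟩
        · simp at hb
        simp only [List.head?_cons, Option.some.injEq, List.tail_cons] at hb hb'
        rw [hb, single_eq_some.1 hb']
        exact ⟨.var (.inr (.commutator ⟨i, hin⟩ ⟨j, hjn⟩ hij)) :: ts, rfl,
          by simp [NCFormula.code, varCode, closed, natCode]⟩
      · simp [hij] at hA'''
  · cases ℓ <;> simp only [arithLetter, Letter.isDigit, op, reduceCtorEq, Bool.false_eq_true,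
      Bool.true_eq_false] at hok hd hop
    · obtain ⟨A, B, r, hr, rfl⟩ := binary_eq_some.1 hop
      obtain ⟨t, t', ts, rfl, rfl, rfl, rfl⟩ := map_eq_cons_cons hr
      exact ⟨.add t t' :: ts, rfl, by simp [NCFormula.code, closed]⟩
    · obtain ⟨A, B, r, hr, rfl⟩ := binary_eq_some.1 hop
      obtain ⟨t, t', ts, rfl, rfl, rfl, rfl⟩ := map_eq_cons_cons hr
      exact ⟨.mul t t' :: ts, rfl, by simp [NCFormula.code, closed]⟩

theorem parse_digits {n : ℕ} {s f : Item R} {w : List Letter} {bufs : List (List Letter)}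
    {st : List (Item R)} (h : D.parse n s f w = some (bufs, st)) : ∀ b : List Letter,
    (∀ ℓ ∈ b, ℓ.isDigit = true) →
    D.parse n s f (b ++ Letter.endMark :: w) = some (b :: bufs, st) := by
  intro b
  induction b with
  | nil => intro _; rw [List.nil_append, parse_cons, h]; rfl
  | cons ℓ b ih =>
    intro hb
    have h₁ := hb ℓ List.mem_cons_self
    have h₂ : ℓ ≠ .endMark := by rintro rfl; simp [Letter.isDigit] at h₁
    rw [List.cons_append, parse_cons, ih fun ℓ' h' => hb ℓ' (List.mem_cons_of_mem _ h')]
    simp [parseStep, h₁, h₂]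

theorem isDigit_bits {k : ℕ} : ∀ ℓ ∈ k.bits.map Letter.bit, ℓ.isDigit = true := by
  intro ℓ hℓ
  obtain ⟨b, -, rfl⟩ := List.mem_map.1 hℓ
  rfl

theorem parse_natCode {n : ℕ} {s f : Item R} {w : List Letter} {bufs : List (List Letter)}
    {st : List (Item R)} (h : D.parse n s f w = some (bufs, st)) (k : ℕ) :
    D.parse n s f (natCode k ++ w) = some (k.bits.map Letter.bit :: bufs, st) := by
  rw [natCode, List.append_assoc]
  exact D.parse_digits h _ isDigit_bits

theorem parse_op {n : ℕ} {s f : Item R} {w : List Letter} {bufs : List (List Letter)}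
    {st st' : List (Item R)} {ℓ : Letter} (h : D.parse n s f w = some (bufs, st))
    (hd : ℓ.isDigit = false) (he : ℓ ≠ .endMark) (ha : D.act n s f ℓ bufs st = some st') :
    D.parse n s f (ℓ :: w) = some ([], st') := by
  rw [parse_cons, h]
  simp [parseStep, hd, he, ha]

theorem decodeVar_fin {n : ℕ} (i : Fin n) :
    decodeVar n ((i : ℕ).bits.map Letter.bit) = some (i : ℕ) := decodeVar_eq_some.2 ⟨i.2, rfl⟩

/-- From right to left, operands are read before their operator and the left operand last, so it
lies on top of the stack. -/
theorem parse_propFormula {n : ℕ} {s f : Item R} (g : PropFormula (Fin n)) :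
    ∀ {w : List Letter} {st : List (Item R)}, D.parse n s f w = some ([], st) →
    D.parse n s f (g.code ++ w) = some ([], D.propItem g :: st) := by
  induction g with
  | var i =>
    intro w st h
    exact D.parse_op (D.parse_natCode h i) rfl (by simp) (D.act_eq_some.2 (Or.inl
      ⟨_, by simp [leaf, single, decodeVar_fin]; rfl, rfl⟩))
  | fls => intro w st h; exact D.parse_op h rfl (by simp) (D.act_eq_some.2 (Or.inl ⟨_, rfl, rfl⟩))
  | tru => intro w st h; exact D.parse_op h rfl (by simp) (D.act_eq_some.2 (Or.inl ⟨_, rfl, rfl⟩))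
  | neg g ih =>
    intro w st h
    exact D.parse_op (ih h) rfl (by simp) (D.act_eq_some.2 (Or.inr ⟨rfl, rfl, rfl⟩))
  | or g g' ih ih' =>
    intro w st h
    have := ih (ih' h)
    rw [← List.append_assoc] at this
    exact D.parse_op this rfl (by simp) (D.act_eq_some.2 (Or.inr ⟨rfl, rfl, rfl⟩))
  | and g g' ih ih' =>
    intro w st h
    have := ih (ih' h)
    rw [← List.append_assoc] at this
    exact D.parse_op this rfl (by simp) (D.act_eq_some.2 (Or.inr ⟨rfl, rfl, rfl⟩))

theorem parse_ncFormula {n : ℕ} {s f : Item R} (g : NCFormula K (Fin n ⊕ AxiomIndex n)) :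
    ∀ {w : List Letter} {st : List (Item R)}, D.parse n s f w = some ([], st) →
    D.parse n s f (g.code code ++ w) = some ([], D.formulaItem (D.varItem s f) g :: st) := by
  induction g with
  | var v =>
    intro w st h
    rcases v with i | _ | i | ⟨i, j, hij⟩
    · exact D.parse_op (D.parse_natCode h i) rfl (by simp) (D.act_eq_some.2 (Or.inl
        ⟨_, by simp [leaf, single, decodeVar_fin]; rfl, rfl⟩))
    · exact D.parse_op h rfl (by simp) (D.act_eq_some.2 (Or.inl ⟨_, rfl, rfl⟩))
    · exact D.parse_op (D.parse_natCode h i) rfl (by simp) (D.act_eq_some.2 (Or.inl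
        ⟨_, by simp [leaf, single, decodeVar_fin]; rfl, rfl⟩))
    · have := D.parse_natCode (D.parse_natCode h j) i
      rw [← List.append_assoc] at this
      exact D.parse_op this rfl (by simp) (D.act_eq_some.2 (Or.inl
        ⟨_, by simp [leaf, single, decodeVar_fin, hij]; rfl, rfl⟩))
  | const a =>
    intro w st h
    have := D.parse_digits h (code a) (D.isDigit_code a)
    refine Eq.trans (congrArg _ ?_) (D.parse_op (ℓ := .const) this rfl (by simp) (D.act_eq_some.2
      (Or.inl ⟨_, by simp [leaf, single, D.read_code]; rfl, rfl⟩)))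
    simp [NCFormula.code]
  | add g g' ih ih' =>
    intro w st h
    have := ih (ih' h)
    rw [← List.append_assoc] at this
    exact D.parse_op this rfl (by simp) (D.act_eq_some.2 (Or.inr ⟨rfl, rfl, rfl⟩))
  | mul g g' ih ih' =>
    intro w st h
    have := ih (ih' h)
    rw [← List.append_assoc] at this
    exact D.parse_op this rfl (by simp) (D.act_eq_some.2 (Or.inr ⟨rfl, rfl, rfl⟩))

end ArithCode

/-! ### Verification of refutations. -/

/-- The free algebra on finitely many variables as a part of that on countably many. -/
noncomputable def embed (K : Type*) [Field K] (n : ℕ) : FreeAlgebra K (Fin n) →ₐ[K] FreeAlgebra K ℕ :=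
  FreeAlgebra.lift K fun i => FreeAlgebra.ι K (i : ℕ)

/-- Sending the surplus variables to zero gives a left inverse. -/
theorem embed_injective (K : Type*) [Field K] (n : ℕ) : Function.Injective (embed K n) := by
  let ψ : FreeAlgebra K ℕ →ₐ[K] FreeAlgebra K (Fin n) :=
    FreeAlgebra.lift K fun y => if h : y < n then FreeAlgebra.ι K ⟨y, h⟩ else 0
  have h : ψ.comp (embed K n) = AlgHom.id K _ := by
    refine FreeAlgebra.hom_ext (funext fun i => ?_)
    simp [ψ, embed]
  exact Function.LeftInverse.injective (g := ψ) fun f => DFunLike.congr_fun h f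

/-- The letters before the first end mark. -/
def firstNumber (w : List Letter) : List Letter :=
  w.foldr (fun ℓ s => bif decide (ℓ = .endMark) then [] else ℓ :: s) []

theorem firstNumber_append {b w : List Letter} (h : ∀ ℓ ∈ b, ℓ.isDigit = true) :
    firstNumber (b ++ Letter.endMark :: w) = b := by
  induction b with
  | nil => rfl
  | cons ℓ b ih =>
    have h₁ := h ℓ List.mem_cons_self
    have h₂ : ℓ ≠ .endMark := by rintro rfl; simp [Letter.isDigit] at h₁
    have ih := ih fun ℓ' h' => h ℓ' (List.mem_cons_of_mem _ h')
    simpa [firstNumber, h₂] using ih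

theorem PropFormula.all_code {n : ℕ} (f : PropFormula (Fin n)) :
    f.code.all ArithCode.propLetter = true := by
  induction f <;> simp_all [PropFormula.code, natCode, ArithCode.propLetter]

namespace ArithCode

variable {K : Type*} [Field K] {code : K → List Letter} {R : Type*} [CommRing R]
    [Algebra R K] [TreeEnc R] [PolyRing R] (D : ArithCode code R)

theorem all_code (D : ArithCode code R) {n : ℕ} (C : NCFormula K (Fin n ⊕ AxiomIndex n)) :
    (C.code code).all arithLetter = true := by
  induction C with
  | var v =>
    rcases v with i | _ | i | ⟨i, j, hij⟩ <;>
      simp [NCFormula.code, varCode, natCode, arithLetter]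
  | const a =>
    have h : ∀ ℓ ∈ code a, arithLetter ℓ = true := fun ℓ hℓ => by
      have := D.isDigit_code a ℓ hℓ
      cases ℓ <;> simp_all [arithLetter, Letter.isDigit]
    simpa [NCFormula.code, arithLetter] using h
  | add f g ihf ihg => rw [NCFormula.code, List.all_cons, List.all_append, ihf, ihg]; rfl
  | mul f g ihf ihg => rw [NCFormula.code, List.all_cons, List.all_append, ihf, ihg]; rfl

/-! ### The polynomials computed by items -/

theorem computes_constItem (a : K) : (D.constItem a).Computes (algebraMap K (FreeAlgebra K ℕ) a) :=
  Item.computes_const (D.den_ne_zero a) (D.num_eq a)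

theorem computes_oneSub {A : Item R} {F : FreeAlgebra K ℕ} (h : A.Computes F) :
    (D.oneSub A).Computes (1 - F) := by
  have := (D.computes_constItem 1).add ((D.computes_constItem (-1)).mul h)
  simpa [oneSub, sub_eq_add_neg] using this

theorem computes_formulaItem {V : Type*} {var : V → Item R} {G : V → FreeAlgebra K ℕ}
    (h : ∀ v, (var v).Computes (G v)) (f : NCFormula K V) :
    (D.formulaItem var f).Computes (FreeAlgebra.lift K G f.toPoly) := by
  induction f with
  | var v => simpa [formulaItem, NCFormula.toPoly] using h v
  | const a => simpa [formulaItem, NCFormula.toPoly] using D.computes_constItem a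
  | add f g ihf ihg => simpa [formulaItem, NCFormula.toPoly] using ihf.add ihg
  | mul f g ihf ihg => simpa [formulaItem, NCFormula.toPoly] using ihf.mul ihg

theorem computes_propItem {n : ℕ} (f : PropFormula (Fin n)) :
    (D.propItem f).Computes (embed K n (f.tr K).toPoly) :=
  D.computes_formulaItem (fun _ => Item.computes_var _) _

theorem computes_varItem {n : ℕ} (σ : K) (f : PropFormula (Fin n)) (v : Fin n ⊕ AxiomIndex n) :
    (D.varItem (D.constItem σ) (D.propItem f) v).Computes
      (embed K n (Sum.elim (FreeAlgebra.ι K) (fun k => σ • f.system K k) v)) := by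
  have hs := D.computes_constItem σ
  rcases v with i | _ | i | ⟨i, j, hij⟩
  · simpa [varItem, embed] using Item.computes_var (R := R) (K := K) (i : ℕ)
  · simpa [varItem, booleanItem, commutatorItem, PropFormula.system, ← Algebra.smul_def] using hs.mul (D.computes_propItem f)
  · have hi := Item.computes_var (R := R) (K := K) (i : ℕ)
    simpa [varItem, booleanItem, commutatorItem, PropFormula.system, embed, booleanAxiom, ← Algebra.smul_def] using
      hs.mul (hi.mul (D.computes_oneSub hi))
  · have hi := Item.computes_var (R := R) (K := K) (i : ℕ)
    have hj := Item.computes_var (R := R) (K := K) (j : ℕ)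
    have h := hs.mul ((hi.mul hj).add ((D.computes_constItem (-1)).mul (hj.mul hi)))
    simpa [varItem, booleanItem, commutatorItem, PropFormula.system, embed, commutatorAxiom, ← Algebra.smul_def, sub_eq_add_neg] using h

/-- Scaling the axioms by `σ` covers both substitutions at once: `σ = 0` gives `C(x, 0)` and `σ = 1`
gives `C(x, F)`. -/
theorem computes_certificate {n : ℕ} (σ : K) (f : PropFormula (Fin n))
    (C : NCFormula K (Fin n ⊕ AxiomIndex n)) :
    (D.formulaItem (D.varItem (D.constItem σ) (D.propItem f)) C).Computes (embed K n
      (FreeAlgebra.lift K (Sum.elim (FreeAlgebra.ι K) fun k => σ • f.system K k) C.toPoly)) := by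
  have h := D.computes_formulaItem (D.computes_varItem σ f) C
  have e : (embed K n).comp (FreeAlgebra.lift K
      (Sum.elim (FreeAlgebra.ι K) fun k => σ • f.system K k)) = FreeAlgebra.lift K fun v =>
        embed K n (Sum.elim (FreeAlgebra.ι K) (fun k => σ • f.system K k) v) := by
    refine FreeAlgebra.hom_ext (funext fun v => ?_)
    simp
  rw [← e] at h
  exact h

/-! ### Checking refutations -/

/-- Check that the formula written as `v`, with the axioms multiplied by `σ`, computes `-δ`. -/
def checkWith (σ δ : K) (n : ℕ) (f : Item R) (v : List Letter) : Bool :=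
  (D.parse n (D.constItem σ) f v).elim false fun p => p.1.isEmpty &&
    (single p.2).elim false fun C => D.test (C.add (D.constItem δ)).1

/-- Check a refutation. -/
def check (u v : List Letter) : Bool :=
  (decodeNat (firstNumber u)).elim false fun n => u.all propLetter &&
    -- The two items are dummies, because the letters that refer to them have been excluded by
    -- `propLetter`.
    (D.parse n (D.constItem 0) (D.constItem 0) u).elim false fun p => (single p.1).isSome &&
      (single p.2).elim false fun f => v.all arithLetter &&
        (D.checkWith 0 0 n f v && D.checkWith 1 (-1) n f v)

theorem parse_nil (n : ℕ) (s f : Item R) : D.parse n s f [] = some ([], []) := rfl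

/-- With `(σ, δ) = (0, 0)` and `(1, -1)` these are the two conditions on a certificate. The
embedding reflects zero, so testing in countably many variables is enough. -/
theorem checkWith_code {n : ℕ} (σ δ : K) (f : PropFormula (Fin n))
    (C : NCFormula K (Fin n ⊕ AxiomIndex n)) :
    D.checkWith σ δ n (D.propItem f) (C.code code) = true ↔ FreeAlgebra.lift K
      (Sum.elim (FreeAlgebra.ι K) fun k => σ • f.system K k) C.toPoly +
        algebraMap K (FreeAlgebra K (Fin n)) δ = 0 := by
  have h := D.parse_ncFormula (s := D.constItem σ) (f := D.propItem f) C (D.parse_nil n _ _)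
  rw [List.append_nil] at h
  have h' := (D.computes_certificate σ f C).add (D.computes_constItem δ)
  have e : D.checkWith σ δ n (D.propItem f) (C.code code) = D.test
      ((D.formulaItem (D.varItem (D.constItem σ) (D.propItem f)) C).add (D.constItem δ)).1 := by
    rw [checkWith, h]
    rfl
  rw [e, D.test_iff, h'.head, ← AlgHom.commutes (embed K n), ← map_add]
  exact map_eq_zero_iff _ (embed_injective K n)

theorem exists_of_checkWith {n : ℕ} {σ δ : K} {f : PropFormula (Fin n)} {v : List Letter}
    (hv : v.all arithLetter = true) (h : D.checkWith σ δ n (D.propItem f) v = true) :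
    ∃ C : NCFormula K (Fin n ⊕ AxiomIndex n), v = C.code code := by
  unfold checkWith at h
  cases hp : D.parse n (D.constItem σ) (D.propItem f) v with
  | none => simp [hp] at h
  | some p =>
    simp only [hp, Option.elim_some, Bool.and_eq_true, List.isEmpty_iff] at h
    obtain ⟨ts, hts, hw, -⟩ := D.parse_sound (word := NCFormula.code code)
      (fun ℓ bufs ts st => D.act_ncFormula ℓ bufs ts st) v p.1 p.2 hv hp
    cases hs : single p.2 with
    | none => simp [hs] at h
    | some A =>
      rw [single_eq_some.1 hs, eq_comm, List.map_eq_singleton_iff] at hts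
      obtain ⟨C, rfl, -⟩ := hts
      exact ⟨C, by rw [hw, h.1]; simp [closed]⟩

/-- The number `n` is needed before parsing, as the bound for variable indices, so `firstNumber`
extracts it. The parser meets it last and must end with it as the only pending number, next to a
single formula. -/
theorem check_iff (u v : List Letter) : D.check u v = true ↔ NCIPSRefutes code u v := by
  have key : ∀ (n : ℕ) (f : PropFormula (Fin n)) (C : NCFormula K (Fin n ⊕ AxiomIndex n)),
      (D.checkWith 0 0 n (D.propItem f) (C.code code) &&
        D.checkWith 1 (-1) n (D.propItem f) (C.code code)) = true ↔
      IsNCIPSRefutation (f.system K) C := by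
    intro n f C
    rw [Bool.and_eq_true, D.checkWith_code, D.checkWith_code, IsNCIPSRefutation,
      IsNCIPSCertificate]
    simp only [zero_smul, one_smul, map_zero, add_zero, map_neg, map_one, ← sub_eq_add_neg,
      sub_eq_zero]
  constructor
  · intro h
    unfold check at h
    cases hn : decodeNat (firstNumber u) with
    | none => simp [hn] at h
    | some n =>
      simp only [hn, Option.elim_some, Bool.and_eq_true] at h
      obtain ⟨hu, h⟩ := h
      cases hp : D.parse n (D.constItem 0) (D.constItem 0) u with
      | none => simp [hp] at h
      | some p =>
        simp only [hp, Option.elim_some, Bool.and_eq_true, Option.isSome_iff_exists] at h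
        obtain ⟨⟨b, hb⟩, h⟩ := h
        obtain ⟨ts, hts, hw, hd⟩ := D.parse_sound (word := PropFormula.code)
          (fun ℓ bufs ts st => D.act_propFormula ℓ bufs ts st) u p.1 p.2 hu hp
        cases hs : single p.2 with
        | none => simp [hs] at h
        | some A =>
          rw [single_eq_some.1 hs, eq_comm, List.map_eq_singleton_iff] at hts
          obtain ⟨f, rfl, rfl⟩ := hts
          simp only [hs, Option.elim_some, Bool.and_eq_true] at h
          obtain ⟨C, rfl⟩ := D.exists_of_checkWith h.1 h.2.1
          rw [single_eq_some.1 hb] at hw hd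
          have hw : u = b ++ Letter.endMark :: f.code := by simpa [closed] using hw
          rw [hw, firstNumber_append (hd b List.mem_cons_self), decodeNat_eq_some] at hn
          refine ⟨n, f, C, ?_, rfl, (key n f C).1 (by simpa using h.2)⟩
          rw [hw, hn, instanceCode, natCode]
          simp
  · rintro ⟨n, f, C, rfl, rfl, h⟩
    have h₁ : firstNumber (instanceCode n f) = n.bits.map Letter.bit := by
      rw [instanceCode, natCode, List.append_assoc]
      exact firstNumber_append isDigit_bits
    have h₂ : (instanceCode n f).all propLetter = true := by
      rw [instanceCode, natCode, List.all_append, f.all_code]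
      simp [propLetter]
    have h₃ := D.parse_propFormula (s := D.constItem 0) (f := D.constItem 0) f (D.parse_nil n _ _)
    rw [List.append_nil] at h₃
    have h₄ := D.parse_natCode h₃ n
    unfold check
    rw [h₁, decodeNat_eq_some.2 rfl, Option.elim_some, h₂, instanceCode, h₄]
    rw [Option.elim_some, D.all_code C]
    simpa [single] using (key n f C).2 h

section PolyTime

variable {γ : Type*} [TreeEnc γ]

@[fun_prop] theorem _root_.PolyTime.arithParse {n : γ → ℕ} {s f : γ → Item R} {w : γ → List Letter}
    (hn : PolyTime n) (hs : PolyTime s) (hf : PolyTime f) (hw : PolyTime w) :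
    PolyTime fun c => D.parse (n c) (s c) (f c) (w c) :=
  PolyTime.comp (g := fun p : (ℕ × Item R × Item R) × List Letter =>
    D.parse p.1.1 p.1.2.1 p.1.2.2 p.2) D.parse_polyTime
    (f := fun c => ((n c, s c, f c), w c)) ((hn.prodMk (hs.prodMk hf)).prodMk hw)

@[fun_prop] theorem _root_.PolyTime.firstNumber' {w : γ → List Letter} (hw : PolyTime w) :
    PolyTime fun c => firstNumber (w c) :=
  PolyTime.foldr_of_add hw (.const []) (f := fun _ ℓ s => bif decide (ℓ = .endMark) then [] else
    ℓ :: s) (by fun_prop) (G := fun p => tsize p.2 + 1) ((PolyTime.snd'.bdd).add (.const 1))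
    fun c ℓ s => by
      by_cases h : ℓ = .endMark
      · simp [h]; have := PolyTime.length_le_tsize s; have := tsize_pos s; omega
      · simp [h]; omega

theorem check_polyTime : PolyTime fun p : List Letter × List Letter => D.check p.1 p.2 := by
  have h₁ : PolyTime propLetter := .of_finite _
  have h₂ : PolyTime arithLetter := .of_finite _
  have h₁' : PolyTime fun l : List Letter => l.all propLetter :=
    PolyTime.id'.all (f := fun _ ℓ => propLetter ℓ) (h₁.comp PolyTime.snd')
  have h₂' : PolyTime fun l : List Letter => l.all arithLetter :=
    PolyTime.id'.all (f := fun _ ℓ => arithLetter ℓ) (h₂.comp PolyTime.snd')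
  have h₃ : ∀ σ δ : K, PolyTime fun p : ℕ × Item R × List Letter =>
      D.checkWith σ δ p.1 p.2.1 p.2.2 := fun σ δ => by
    unfold checkWith
    fun_prop
  have h₄ : PolyTime fun p : ((((List Letter × List Letter) × ℕ) ×
      (List (List Letter) × List (Item R))) × Item R) => p.1.1.1.2.all arithLetter &&
      (D.checkWith 0 0 p.1.1.2 p.2 p.1.1.1.2 && D.checkWith 1 (-1) p.1.1.2 p.2 p.1.1.1.2) :=
    (h₂'.comp (f := fun p : ((((List Letter × List Letter) × ℕ) ×
      (List (List Letter) × List (Item R))) × Item R) => p.1.1.1.2) (by fun_prop)).and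
    (((h₃ 0 0).comp (f := fun p : ((((List Letter × List Letter) × ℕ) ×
      (List (List Letter) × List (Item R))) × Item R) => (p.1.1.2, p.2, p.1.1.1.2))
        (by fun_prop)).and
    ((h₃ 1 (-1)).comp (f := fun p : ((((List Letter × List Letter) × ℕ) ×
      (List (List Letter) × List (Item R))) × Item R) => (p.1.1.2, p.2, p.1.1.1.2))
        (by fun_prop)))
  unfold check
  exact .optionElim (by fun_prop) (by fun_prop) ((h₁'.comp (f := fun p :
    (List Letter × List Letter) × ℕ => p.1.1) (by fun_prop)).and
      (.optionElim (by fun_prop) (by fun_prop) (.and (by fun_prop)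
        (.optionElim (by fun_prop) (by fun_prop) h₄))))

noncomputable local instance : TreeEnc (Letter ⊕ Letter) := finTreeEnc _

/-- The machine gets the two words joined, with letters tagged by their side; removing the tags
recovers both words. The `reverse` undoes the reversal caused by reading. -/
theorem polyTimeDecidable (D : ArithCode code R) : PolyTimeDecidable (NCIPSRefutes code) := by
  have := finTreeEnc_injective (Letter ⊕ Letter)
  have hl : PolyTime fun x : Letter ⊕ Letter => x.getLeft? := .of_finite _
  have hr : PolyTime fun x : Letter ⊕ Letter => x.getRight? := .of_finite _
  have hf : PolyTime fun l : List (Letter ⊕ Letter) =>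
      D.check (l.reverse.filterMap Sum.getLeft?) (l.reverse.filterMap Sum.getRight?) :=
    D.check_polyTime.comp (f := fun l : List (Letter ⊕ Letter) =>
      (l.reverse.filterMap Sum.getLeft?, l.reverse.filterMap Sum.getRight?))
      ((PolyTime.id'.reverse.filterMap (f := fun _ x => Sum.getLeft? x) (hl.comp PolyTime.snd')).prodMk
        (PolyTime.id'.reverse.filterMap (f := fun _ x => Sum.getRight? x) (hr.comp PolyTime.snd')))
  classical
  refine hf.tm2ComputableInPolyTime fun p => ?_
  rw [List.reverse_reverse]
  have e : (Computability.encodingProd (Computability.encodingList Letter)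
      (Computability.encodingList Letter)).encode p = p.1.map Sum.inl ++ p.2.map Sum.inr := rfl
  rw [e, Bool.eq_iff_iff, decide_eq_true_iff, ← D.check_iff]
  have h₁ : (p.1.map Sum.inl ++ p.2.map Sum.inr : List (Letter ⊕ Letter)).filterMap Sum.getLeft?
      = p.1 := by
    simp [List.filterMap_append, List.filterMap_map, Function.comp_def]
  have h₂ : (p.1.map Sum.inl ++ p.2.map Sum.inr : List (Letter ⊕ Letter)).filterMap Sum.getRight?
      = p.2 := by
    simp [List.filterMap_append, List.filterMap_map, Function.comp_def]
  rw [h₁, h₂]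

end PolyTime

end ArithCode

/-! ### Finite fields -/

section FiniteField

variable {K : Type*} [Field K] [Finite K]

/-- The field element with a given word, by comparison with the words for all field elements. -/
noncomputable def readFinite (c : K → List Bool) (L : List K) (b : List Letter) : Option (K × K) :=
  (L.find? fun a => decide (bitCode c a = b)).map fun a => (a, 1)

theorem readFinite_polyTime [TreeEnc K] (c : K → List Bool) (L : List K) :
    PolyTime (readFinite c L) := by
  induction L with
  | nil => exact .const none
  | cons a L ih =>
    have h := ((PolyTime.eqConst (bitCode c a)).cond (.const (some (a, 1))) ih)
    refine Eq.mp (congrArg PolyTime (funext fun b => ?_)) h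
    by_cases hb : b = bitCode c a
    · simp [readFinite, hb]
    · simp [readFinite, hb, Ne.symm hb]

theorem bitCode_injective {c : K → List Bool} (hc : Function.Injective c) :
    Function.Injective (bitCode c) := fun a b h =>
  hc (List.map_injective_iff.2 (fun _ _ h => by injection h) h)

theorem polyTimeDecidable_finite {c : K → List Bool} (hc : Function.Injective c) :
    PolyTimeDecidable (NCIPSRefutes (bitCode c)) := by
  let := finTreeEnc K
  have := finTreeEnc_injective K
  have := uniformEnc_finTreeEnc K
  let := finPolyRing K
  let := Fintype.ofFinite K
  let D : ArithCode (bitCode c) K :=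
    { frac := fun a => (a, 1)
      den_ne_zero := fun a => by simp
      num_eq := fun a => by simp
      read := readFinite c Finset.univ.toList
      read_polyTime := readFinite_polyTime c _
      read_code := fun a => by
        cases h : (Finset.univ.toList : List K).find? fun a' => decide (bitCode c a' = bitCode c a) with
        | none =>
          rw [List.find?_eq_none] at h
          simpa using h a (by simp)
        | some a' =>
          have := List.find?_some h
          rw [readFinite, h, bitCode_injective hc (of_decide_eq_true this)]
          rfl
      exists_of_read := fun b p h => by
        obtain ⟨a, ha, rfl⟩ := Option.map_eq_some_iff.1 h
        have ha := List.find?_some ha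
        exact ⟨a, of_decide_eq_true ha, rfl⟩
      isDigit_code := fun a ℓ hℓ => by
        obtain ⟨b, -, rfl⟩ := List.mem_map.1 hℓ
        rfl
      test := levelTest
      test_polyTime := levelTest_polyTime
      test_iff := levelTest_iff }
  exact D.polyTimeDecidable

end FiniteField

/-! ### The rationals -/

section Rational

/-- Does a word start with a minus sign? -/
def signOf (b : List Letter) : Bool := b.head?.elim false fun ℓ => decide (ℓ = .minus)

/-- A word without the sign. -/
def bodyOf (b : List Letter) : List Letter := bif signOf b then b.tail else b

/-- The part before the slash. -/
def numWord (b : List Letter) : List Letter :=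
  b.foldr (fun ℓ s => bif decide (ℓ = .slash) then [] else ℓ :: s) []

/-- The part after the slash. -/
def denWord (b : List Letter) : List Letter :=
  b.drop (() :: (numWord b).map fun _ => ()).length

/-- Read a rational number. -/
def readRat (b : List Letter) : Option (ℤ × ℤ) :=
  (decodeNat (numWord (bodyOf b))).bind fun m => (decodeNat (denWord (bodyOf b))).bind fun d =>
    -- The conditions ask for a slash, a nonzero denominator, lowest terms and no negative zero; so
    -- the accepted words are exactly those of `ratCode`. The result is written as differences to
    -- suit `natSubNat`.
    bif decide (numWord (bodyOf b) ++ Letter.slash :: denWord (bodyOf b) = bodyOf b) &&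
      (!decide (d = 0) && (decide (Nat.Coprime m d) && !(signOf b && decide (m = 0)))) then
    some (((bif signOf b then 0 else m : ℕ) : ℤ) - ((bif signOf b then m else 0 : ℕ) : ℤ),
      (d : ℤ) - ((0 : ℕ) : ℤ)) else none

theorem readRat_polyTime : PolyTime readRat := by
  have h₁ : PolyTime fun ℓ : Letter => decide (ℓ = .minus) := .of_finite _
  have h₂ : PolyTime fun ℓ : Letter => decide (ℓ = Letter.slash) := .of_finite _
  have h₃ : PolyTime fun p : List Letter × List Letter => decide (p.1 = p.2) :=
    PolyTime.listEq (.of_finite_prod _)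
  have hs : PolyTime signOf :=
    .optionElim (o := fun b : List Letter => b.head?) (d := fun _ => false)
      (f := fun _ ℓ => decide (ℓ = Letter.minus)) (by fun_prop) (by fun_prop)
      (h₁.comp PolyTime.snd')
  have hb : PolyTime bodyOf := hs.cond (by fun_prop) (by fun_prop)
  have hn : PolyTime numWord :=
    PolyTime.foldr_of_add (α := Letter) (β := List Letter) .id' (.const []) (f := fun _ ℓ s => bif decide (ℓ = Letter.slash) then [] else
      ℓ :: s) (.cond (h₂.comp (f := fun p : List Letter × Letter × List Letter => p.2.1)
        (by fun_prop)) (by fun_prop) (by fun_prop)) (G := fun p => tsize p.2 + 1)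
      ((PolyTime.snd'.bdd).add (.const 1)) fun c ℓ s => by
        by_cases h : ℓ = .slash
        · have := tsize_pos s
          simp [h]; omega
        · simp [h]; omega
  have hd : PolyTime denWord := .drop .id' (.cons (.const ()) (hn.map (by fun_prop)))
  have hok : PolyTime fun p : (List Letter × ℕ) × ℕ =>
      decide (numWord (bodyOf p.1.1) ++ Letter.slash :: denWord (bodyOf p.1.1) = bodyOf p.1.1) &&
      (!decide (p.2 = 0) && (decide (Nat.Coprime p.1.2 p.2) &&
        !(signOf p.1.1 && decide (p.1.2 = 0)))) := by
    have hb' : PolyTime fun p : (List Letter × ℕ) × ℕ => bodyOf p.1.1 :=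
      hb.comp (f := fun p : (List Letter × ℕ) × ℕ => p.1.1) (by fun_prop)
    exact (h₃.comp (((hn.comp hb').append ((PolyTime.const Letter.slash).cons
      (hd.comp hb'))).prodMk hb')).and ((by fun_prop : PolyTime fun p : (List Letter × ℕ) × ℕ =>
        !decide (p.2 = 0)).and ((PolyTime.natCoprime (by fun_prop) (by fun_prop)).and
          ((hs.comp (f := fun p : (List Letter × ℕ) × ℕ => p.1.1) (by fun_prop)).and
            (by fun_prop)).not))
  have hs' : PolyTime fun p : (List Letter × ℕ) × ℕ => signOf p.1.1 :=
    hs.comp (f := fun p : (List Letter × ℕ) × ℕ => p.1.1) (by fun_prop)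
  unfold readRat
  exact .optionBind ((hn.comp hb).decodeNat') (.optionBind
    (((hd.comp hb).comp (f := fun p : List Letter × ℕ => p.1) (by fun_prop)).decodeNat')
    (hok.cond (.some ((PolyTime.natSubNat (hs'.cond (by fun_prop) (by fun_prop))
      (hs'.cond (by fun_prop) (by fun_prop))).prodMk (by fun_prop))) (by fun_prop)))

theorem numWord_append {b w : List Letter} (h : Letter.slash ∉ b) :
    numWord (b ++ Letter.slash :: w) = b := by
  induction b with
  | nil => rfl
  | cons ℓ b ih =>
    rw [List.mem_cons, not_or] at h
    have ih := ih h.2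
    simpa [numWord, Ne.symm h.1] using ih

theorem denWord_append {b w : List Letter} (h : Letter.slash ∉ b) :
    denWord (b ++ Letter.slash :: w) = w := by
  rw [denWord, numWord_append h]
  simp

theorem slash_notMem_bits (k : ℕ) : Letter.slash ∉ k.bits.map Letter.bit := by
  simp

theorem signOf_ratCode (r : ℚ) : signOf (ratCode r) = decide (r.num < 0) ∧
    bodyOf (ratCode r) = r.num.natAbs.bits.map Letter.bit ++
      Letter.slash :: r.den.bits.map Letter.bit := by
  by_cases h : r.num < 0
  · simp [ratCode, h, signOf, bodyOf]
  · have : signOf (r.num.natAbs.bits.map Letter.bit ++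
      Letter.slash :: r.den.bits.map Letter.bit) = false := by
      cases r.num.natAbs.bits <;> simp [signOf]
    simp [ratCode, h, bodyOf, this]

theorem readRat_ratCode (r : ℚ) : readRat (ratCode r) = some (r.num, (r.den : ℤ)) := by
  obtain ⟨h₁, h₂⟩ := signOf_ratCode r
  have hs := slash_notMem_bits r.num.natAbs
  rw [readRat, h₁, h₂, numWord_append hs, denWord_append hs, decodeNat_eq_some.2 rfl,
    decodeNat_eq_some.2 rfl]
  have hc : decide (Nat.Coprime r.num.natAbs r.den) = true := decide_eq_true r.reduced
  have hd := r.den_ne_zero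
  by_cases h : r.num < 0
  · have h' : r.num ≠ 0 := by omega
    simp [hc, h, hd, h', abs_of_neg]
  · simp [hc, h, hd, abs_of_nonneg (not_lt.1 h)]

theorem exists_of_readRat {b : List Letter} {c : ℤ × ℤ} (h : readRat b = some c) :
    ∃ r : ℚ, ratCode r = b ∧ (r.num, (r.den : ℤ)) = c := by
  obtain ⟨m, hm, h⟩ := Option.bind_eq_some_iff.1 h
  obtain ⟨d, hd, h'⟩ := Option.bind_eq_some_iff.1 h
  rw [decodeNat_eq_some] at hm hd
  rw [hm, hd] at h'
  cases hok : decide (m.bits.map Letter.bit ++ Letter.slash :: d.bits.map Letter.bit = bodyOf b) &&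
      (!decide (d = 0) && (decide (Nat.Coprime m d) && !(signOf b && decide (m = 0)))) with
  | false => rw [hok] at h'; simp at h'
  | true =>
    rw [hok] at h'
    simp only [cond_true, Option.some.injEq] at h'
    simp only [Bool.and_eq_true, Bool.not_eq_true', decide_eq_true_eq, decide_eq_false_iff_not,
      Bool.and_eq_false_iff] at hok
    obtain ⟨hb, hd0, hco, hz⟩ := hok
    set z : ℤ := bif signOf b then -(m : ℤ) else m with hzdef
    have hzabs : z.natAbs = m := by
      rw [hzdef]; cases signOf b <;> simp
    have hneg : z < 0 ↔ signOf b = true := by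
      rw [hzdef]
      cases hsb : signOf b
      · simp
      · have : m ≠ 0 := by simpa [hsb] using hz
        simp; omega
    have hbody : b = (bif signOf b then [Letter.minus] else []) ++ bodyOf b := by
      unfold bodyOf
      cases hsb : signOf b
      · simp
      · rcases b with _ | ⟨ℓ, b⟩
        · simp [signOf] at hsb
        · simp only [signOf, List.head?_cons, Option.elim_some, decide_eq_true_eq] at hsb
          simp [hsb]
    refine ⟨⟨z, d, hd0, by rwa [hzabs]⟩, ?_, ?_⟩
    · conv_rhs => rw [hbody, ← hb]
      unfold ratCode
      simp only [hneg, hzabs]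
      cases signOf b <;> simp
    · rw [← h']
      refine Prod.ext ?_ (by simp)
      simp only [hzdef]
      cases signOf b <;> simp

theorem polyTimeDecidable_rat : PolyTimeDecidable (NCIPSRefutes ratCode) := by
  let D : ArithCode ratCode ℤ :=
    { frac := fun r => (r.num, r.den)
      den_ne_zero := fun r => by simp
      num_eq := fun r => by simp [Rat.den_mul_eq_num]
      read := readRat
      read_polyTime := readRat_polyTime
      read_code := readRat_ratCode
      exists_of_read := fun b c h => exists_of_readRat h
      isDigit_code := fun r ℓ hℓ => by
        unfold ratCode at hℓ
        split_ifs at hℓ <;>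
        · simp only [List.nil_append, List.mem_append, List.mem_cons, List.mem_map,
            List.not_mem_nil, or_false] at hℓ
          rcases hℓ with h | h <;> aesop
      test := gramTest
      test_polyTime := by
        have := gram_polyTime (R := ℤ)
        unfold gramTest
        fun_prop
      test_iff := gramTest_iff (algebraMap ℤ ℚ).injective_int }
  exact D.polyTimeDecidable

end Rational

/-! ### Soundness and completeness -/

section Completeness

variable {K : Type*} [Field K] {n : ℕ}

theorem NCFormula.toPoly_surjective {V : Type*} (f : FreeAlgebra K V) :
    ∃ C : NCFormula K V, C.toPoly = f := by
  induction f using FreeAlgebra.induction with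
  | grade0 r => exact ⟨.const r, rfl⟩
  | grade1 v => exact ⟨.var v, rfl⟩
  | mul a b ha hb =>
    obtain ⟨⟨C, rfl⟩, ⟨D, rfl⟩⟩ := And.intro ha hb
    exact ⟨.mul C D, rfl⟩
  | add a b ha hb =>
    obtain ⟨⟨C, rfl⟩, ⟨D, rfl⟩⟩ := And.intro ha hb
    exact ⟨.add C D, rfl⟩

variable {I : Type*} {P : I → FreeAlgebra K (Fin n)}

/-- After evaluation at a solution the two substitutions agree on all variables, hence on `C`, where
they give `1` and `0`. -/
theorem IsNCIPSCertificate.not_isZeroOneSolution {C : FreeAlgebra K (Fin n ⊕ I)}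
    (h : IsNCIPSCertificate P C) (a : Fin n → K) : ¬ IsZeroOneSolution P a := by
  intro ha
  have e : (FreeAlgebra.lift K a).comp (FreeAlgebra.lift K (Sum.elim (FreeAlgebra.ι K) P)) =
      (FreeAlgebra.lift K a).comp (FreeAlgebra.lift K (Sum.elim (FreeAlgebra.ι K)
        fun _ : I => (0 : FreeAlgebra K (Fin n)))) := by
    refine FreeAlgebra.hom_ext (funext fun v => ?_)
    rcases v with i | k
    · simp
    · simp [ha.2 k]
  have := DFunLike.congr_fun e C
  simp [h.1, h.2] at this

/-- The polynomials that have a certificate form a two-sided ideal. -/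
theorem exists_certificate_of_mem_span {f : FreeAlgebra K (Fin n)}
    (hf : f ∈ TwoSidedIdeal.span (Set.range P)) : ∃ C : FreeAlgebra K (Fin n ⊕ I),
    FreeAlgebra.lift K (Sum.elim (FreeAlgebra.ι K)
      (fun _ : I => (0 : FreeAlgebra K (Fin n)))) C = 0 ∧
    FreeAlgebra.lift K (Sum.elim (FreeAlgebra.ι K) P) C = f := by
  -- A polynomial in `x` alone, viewed as a polynomial in `x` and `y`, is unaffected by any
  -- substitution for `y`; such polynomials act as multipliers below.
  have hx : ∀ (G : I → FreeAlgebra K (Fin n)) (g : FreeAlgebra K (Fin n)),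
      FreeAlgebra.lift K (Sum.elim (FreeAlgebra.ι K) G)
        (FreeAlgebra.lift K (fun i => FreeAlgebra.ι K (Sum.inl i)) g) = g := by
    intro G g
    have e : (FreeAlgebra.lift K (Sum.elim (FreeAlgebra.ι K) G)).comp
        (FreeAlgebra.lift K (fun i => FreeAlgebra.ι K (Sum.inl i))) = AlgHom.id K _ :=
      FreeAlgebra.hom_ext (funext fun i => by simp)
    exact DFunLike.congr_fun e g
  induction hf using TwoSidedIdeal.span_induction with
  | mem f hf =>
    obtain ⟨k, rfl⟩ := hf
    exact ⟨FreeAlgebra.ι K (Sum.inr k), by simp, by simp⟩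
  | zero => exact ⟨0, by simp, by simp⟩
  | add f g _ _ hf hg =>
    obtain ⟨⟨C, hC, hC'⟩, ⟨D, hD, hD'⟩⟩ := And.intro hf hg
    exact ⟨C + D, by simp [hC, hD], by simp [hC', hD']⟩
  | neg f _ hf =>
    obtain ⟨C, hC, hC'⟩ := hf
    exact ⟨-C, by simp [hC], by simp [hC']⟩
  | left_absorb a f _ hf =>
    obtain ⟨C, hC, hC'⟩ := hf
    exact ⟨FreeAlgebra.lift K (fun i => FreeAlgebra.ι K (Sum.inl i)) a * C, by simp [hC],
      by rw [map_mul, hx, hC']⟩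
  | right_absorb a f _ hf =>
    obtain ⟨C, hC, hC'⟩ := hf
    exact ⟨C * FreeAlgebra.lift K (fun i => FreeAlgebra.ι K (Sum.inl i)) a, by simp [hC],
      by rw [map_mul, hx, hC']⟩

/-- Modulo a maximal ideal there are no zero divisors, so each Boolean axiom forces its variable to
`0` or `1`. The point therefore has coordinates in `K` even if the residue field is larger. -/
theorem exists_zeroOne_of_algHom {Q : Type*} [CommRing Q] [Nontrivial Q] [Algebra K Q]
    (π : FreeAlgebra K (Fin n) →ₐ[K] Q) (h : ∀ i, π (booleanAxiom K i) = 0) :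
    ∃ a : Fin n → K, (∀ i, a i = 0 ∨ a i = 1) ∧
      ∀ f, π f = 0 → FreeAlgebra.lift K a f = 0 := by
  classical
  obtain ⟨M, hM⟩ := Ideal.exists_maximal Q
  let ρ : Q →ₐ[K] Q ⧸ M := Ideal.Quotient.mkₐ K M
  have h₁ : ∀ i, ρ (π (FreeAlgebra.ι K i)) = 0 ∨ ρ (π (FreeAlgebra.ι K i)) = 1 := fun i => by
    have := congrArg ρ (h i)
    simp only [booleanAxiom, map_mul, map_sub, map_one, map_zero, mul_eq_zero, sub_eq_zero] at this
    exact this.imp_right Eq.symm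
  refine ⟨fun i => if ρ (π (FreeAlgebra.ι K i)) = 0 then 0 else 1, fun i => ?_, fun f hf => ?_⟩
  · dsimp only
    split_ifs <;> simp
  -- Evaluation at the point, followed by the inclusion of `K`, agrees with the quotient map on
  -- generators; injectivity of the inclusion brings zeros back to `K`.
  · have e : (Algebra.ofId K (Q ⧸ M)).comp (FreeAlgebra.lift K
        fun i => if ρ (π (FreeAlgebra.ι K i)) = 0 then (0 : K) else 1) = ρ.comp π := by
      refine FreeAlgebra.hom_ext (funext fun i => ?_)
      by_cases hi : ρ (π (FreeAlgebra.ι K i)) = 0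
      · simp [hi]
      · simp [(h₁ i).resolve_left hi]
    have := DFunLike.congr_fun e f
    simp only [AlgHom.comp_apply, hf, map_zero] at this
    exact (algebraMap K (Q ⧸ M)).injective (this.trans (map_zero _).symm)

/-- A quotient by a proper two-sided ideal is nonzero, and it is commutative since the images of the
variables generate it and commute. Commutative algebra then provides the solution. -/
theorem exists_zeroOneSolution (hP : ContainsAxioms P)
    (h : (1 : FreeAlgebra K (Fin n)) ∉ TwoSidedIdeal.span (Set.range P)) :
    ∃ a : Fin n → K, IsZeroOneSolution P a := by
  set J := TwoSidedIdeal.span (Set.range P)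
  let π : FreeAlgebra K (Fin n) →ₐ[K] J.ringCon.Quotient := J.ringCon.mkₐ K
  have hπ : ∀ f, π f = 0 ↔ f ∈ J := fun f => RingCon.eq J.ringCon
  have hsurj : Function.Surjective π := J.ringCon.mk'_surjective
  have hPJ : ∀ k, P k ∈ J := fun k => TwoSidedIdeal.subset_span ⟨k, rfl⟩
  have hgen : ∀ i j : Fin n, Commute (π (FreeAlgebra.ι K i)) (π (FreeAlgebra.ι K j)) := by
    have hlt : ∀ i j : Fin n, i < j →
        Commute (π (FreeAlgebra.ι K i)) (π (FreeAlgebra.ι K j)) := fun i j hij => by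
      obtain ⟨k, hk⟩ := hP.2 i j hij
      have := (hπ _).2 (hPJ k)
      rw [hk, commutatorAxiom, map_sub, map_mul, map_mul, sub_eq_zero] at this
      exact this
    intro i j
    rcases lt_trichotomy i j with hij | rfl | hij
    · exact hlt i j hij
    · exact Commute.refl _
    · exact (hlt j i hij).symm
  -- What commutes with the generators commutes with everything. This is used twice, for one factor
  -- after the other.
  have hext : ∀ q : J.ringCon.Quotient, (∀ i, Commute q (π (FreeAlgebra.ι K i))) →
      ∀ f, Commute q (π f) := by
    intro q hq f
    induction f using FreeAlgebra.induction with
    | grade0 r => rw [AlgHom.commutes]; exact Algebra.commute_algebraMap_right r q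
    | grade1 i => exact hq i
    | mul f g hf hg => rw [map_mul]; exact hf.mul_right hg
    | add f g hf hg => rw [map_add]; exact hf.add_right hg
  have hcomm : ∀ q r : J.ringCon.Quotient, q * r = r * q := by
    intro q r
    obtain ⟨⟨f, rfl⟩, ⟨g, rfl⟩⟩ := And.intro (hsurj q) (hsurj r)
    exact hext _ (fun i => (hext _ (fun j => hgen i j) f).symm) g
  let _ : CommRing J.ringCon.Quotient := { (inferInstance : Ring J.ringCon.Quotient) with
    mul_comm := hcomm }
  have : Nontrivial J.ringCon.Quotient := ⟨⟨1, 0, fun e => h ((hπ 1).1 (by rw [map_one, e]))⟩⟩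
  obtain ⟨a, ha, ha'⟩ := exists_zeroOne_of_algHom π fun i => by
    obtain ⟨k, hk⟩ := hP.1 i
    rw [← hk]
    exact (hπ _).2 (hPJ k)
  exact ⟨a, ha, fun k => ha' _ ((hπ _).2 (hPJ k))⟩

theorem exists_refutation_iff (hP : ContainsAxioms P) :
    (∃ C : NCFormula K (Fin n ⊕ I), IsNCIPSRefutation P C) ↔
      ¬ ∃ a : Fin n → K, IsZeroOneSolution P a := by
  constructor
  · rintro ⟨C, hC⟩ ⟨a, ha⟩
    exact hC.not_isZeroOneSolution a ha
  · intro h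
    by_contra hC
    refine h (exists_zeroOneSolution hP fun h₁ => hC ?_)
    obtain ⟨F, hF⟩ := exists_certificate_of_mem_span h₁
    obtain ⟨C, rfl⟩ := NCFormula.toPoly_surjective F
    exact ⟨C, hF⟩

theorem PropFormula.containsAxioms_system (f : PropFormula (Fin n)) :
    ContainsAxioms (f.system K) :=
  ⟨fun i => ⟨.boolean i, rfl⟩, fun i j h => ⟨.commutator i j h, rfl⟩⟩

theorem PropFormula.lift_tr (f : PropFormula (Fin n)) (a : Fin n → Bool) :
    FreeAlgebra.lift K (fun i => bif a i then (0 : K) else 1) (f.tr K).toPoly =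
      bif f.eval a then 0 else 1 := by
  induction f with
  | var i => simp [tr, NCFormula.toPoly, eval]
  | fls => simp [tr, NCFormula.toPoly, eval]
  | tru => simp [tr, NCFormula.toPoly, eval]
  | neg f ih => cases h : f.eval a <;> simp [tr, NCFormula.oneSub, NCFormula.toPoly, eval, ih, h]
  | or f g ihf ihg =>
    cases h : f.eval a <;> cases h' : g.eval a <;>
      simp [tr, NCFormula.toPoly, eval, ihf, ihg, h, h']
  | and f g ihf ihg =>
    cases h : f.eval a <;> cases h' : g.eval a <;>
      simp [tr, NCFormula.oneSub, NCFormula.toPoly, eval, ihf, ihg, h, h']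

theorem PropFormula.unsat_iff (f : PropFormula (Fin n)) :
    f.Unsat ↔ ¬ ∃ a : Fin n → K, IsZeroOneSolution (f.system K) a := by
  classical
  constructor
  · rintro h ⟨a, ha, ha'⟩
    let b : Fin n → Bool := fun i => decide (a i = 0)
    have e : (fun i => bif b i then (0 : K) else 1) = a := funext fun i => by
      rcases ha i with h | h <;> simp [b, h]
    have h₁ := f.lift_tr (K := K) b
    rw [e, h b] at h₁
    have h₂ := ha' .formula
    rw [system, h₁] at h₂
    simp at h₂
  · intro h a
    by_contra hf
    rw [Bool.not_eq_false] at hf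
    refine h ⟨fun i => bif a i then 0 else 1, fun i => by cases h' : a i <;> simp [h'], fun k => ?_⟩
    rcases k with _ | i | ⟨i, j, hij⟩
    · rw [system, lift_tr, hf]
      rfl
    · simp only [system, booleanAxiom, map_mul, map_sub, map_one, FreeAlgebra.lift_ι_apply]
      cases a i <;> simp
    · simp [system, commutatorAxiom, mul_comm]

theorem PropFormula.exists_refutation_iff (f : PropFormula (Fin n)) :
    (∃ C : NCFormula K (Fin n ⊕ AxiomIndex n), IsNCIPSRefutation (f.system K) C) ↔ f.Unsat := by
  rw [_root_.exists_refutation_iff f.containsAxioms_system, f.unsat_iff (K := K)]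

theorem isCookReckhowSystem_of_decidable {code : K → List Letter}
    (h : PolyTimeDecidable (NCIPSRefutes code)) :
    IsCookReckhowSystem UnsatWords (NCIPSRefutes code) where
  sound := by
    rintro u v ⟨n, f, C, rfl, rfl, hC⟩
    exact ⟨n, f, rfl, f.exists_refutation_iff.1 ⟨C, hC⟩⟩
  complete := by
    rintro u ⟨n, f, rfl, hf⟩
    obtain ⟨C, hC⟩ := (f.exists_refutation_iff (K := K)).2 hf
    exact ⟨C.code code, n, f, C, rfl, rfl, hC⟩
  checkable := h

end Completeness

theorem corollary1p5 :
    -- soundness and completeness for systems of non-commutative equations, over every field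
    (∀ (K : Type*) [Field K] (n : ℕ) (I : Type*) [Finite I] (P : I → FreeAlgebra K (Fin n)),
      ContainsAxioms P →
      ((∃ C : NCFormula K (Fin n ⊕ I), IsNCIPSRefutation P C) ↔
        ¬ ∃ a : Fin n → K, IsZeroOneSolution P a)) ∧
    -- soundness and completeness for propositional formulas, over every field
    (∀ (K : Type*) [Field K] (n : ℕ) (f : PropFormula (Fin n)),
      (∃ C : NCFormula K (Fin n ⊕ AxiomIndex n), IsNCIPSRefutation (f.system K) C) ↔ f.Unsat) ∧
    -- a Cook–Reckhow refutation system over the rationals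
    IsCookReckhowSystem UnsatWords (NCIPSRefutes ratCode) ∧
    -- a Cook–Reckhow refutation system over every finite field
    (∀ (K : Type*) [Field K] [Finite K] (c : K → List Bool), Function.Injective c →
      IsCookReckhowSystem UnsatWords (NCIPSRefutes (bitCode c))) :=
  ⟨fun _ _ _ _ _ _ hP => exists_refutation_iff hP, fun _ _ _ f => f.exists_refutation_iff,
    isCookReckhowSystem_of_decidable polyTimeDecidable_rat,
    fun _ _ _ _ hc => isCookReckhowSystem_of_decidable (polyTimeDecidable_finite hc)⟩
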